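/- We work over $\mathbb C$. For a positive integer $r$ and integers $a_1,\dots,a_5$, let $\frac1r(a_1,\dots,a_5)$ denote the cyclic quotient singularity $(X\ni x)$, where $X=\mathbb C^5/\mu_r$ is the quotient by the action $\xi\cdot(x_1,\dots,x_5)=(\xi^{a_1}x_1,\dots,\xi^{a_5}x_5)$ of the group $\mu_r$ of $r$-th roots of unity, and $x$ is the image of the origin. Let $\mathrm{mld}(X\ni x)$ denote its minimal log discrepancy, that is, the infimum of the log discrepancies $a(E,X)$ over all prime divisors $E$ over $X$ with center $x$. Let $\epsilon\in(0,\frac16)$ be a real number. Then there exists a finite set $\Gamma_0$ of positive integers, depending only on $\epsilon$, with the following property. Let $r$ be a positive integer and $a_1,\dots,a_5$ integers, and let $(X\ni x)=\frac1r(a_1,a_2,a_3,a_4,a_5)$. Suppose that 1. $\gcd(a_1,r)=\gcd(a_2,r)=\gcd(a_3,r)=1$ and $\gcd(a_4,r)=\gcd(a_5,r)$; 2. $\gcd\left(\sum_{i=1}^5a_i,\,r\right)=1$; 3. $\mathrm{mld}(X\ni x)\in[\frac{11}6+\epsilon,2)$; 4. one of the following holds: (a) $a_1+a_2+a_5\equiv0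 \pmod r$; (b) $2a_4+a_5\equiv0 \pmod r$; (c) $2a_1+a_5\equiv0 \pmod r$ and $\gcd(a_4,r)=\gcd(a_5,r)\le2$. Then $r\in\Gamma_0$. -/

import Mathlib

open scoped KaehlerDifferential

noncomputable section

namespace CyclicQuotient

section Birational

/-! Throughout this section `X = Spec A` is a normal affine complex variety of dimension `n` with
function field `F`; a point of `X` is given by its prime ideal. -/

variable (A : Type*) [CommRing A] (F : Type*) [Field F] [Algebra A F]

/-- A prime divisor over `X = Spec A`, given by its discrete valuation ring in the function
field `F`: the local ring `B_P` of a normal affine variety `Spec B`, of finite type and birational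
over `X`, at the generic point `P` of a prime divisor of `Spec B`. -/
structure PrimeDivisorOver where
  ring : ValuationSubring F
  isDVR : IsDiscreteValuationRing ring
  exists_model : ∃ (B : Subalgebra A F) (P : Ideal B), B.FG ∧ IsIntegrallyClosed B ∧
    P.IsPrime ∧ P.height = 1 ∧
    ∀ f : F, f ∈ ring ↔ ∃ b s : B, s ∉ P ∧ f = (b : F) / (s : F)

namespace PrimeDivisorOver

variable {A F}

instance (E : PrimeDivisorOver A F) : IsDiscreteValuationRing E.ring := E.isDVR

theorem algebraMap_mem (E : PrimeDivisorOver A F) (a : A) :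
    algebraMap A F a ∈ E.ring.toSubring := by
  obtain ⟨B, P, -, -, hP, -, h⟩ := E.exists_model
  exact (h _).2 ⟨algebraMap A B a, 1, fun h1 => hP.ne_top ((Ideal.eq_top_iff_one P).2 h1), by simp⟩

/-- The center of `E` on `X`, as a prime ideal of `A`. -/
def center (E : PrimeDivisorOver A F) : Ideal A :=
  (IsLocalRing.maximalIdeal E.ring).comap
    ((algebraMap A F).codRestrict E.ring.toSubring E.algebraMap_mem : A →+* E.ring)

/-- The order of a nonzero rational function along `E`. -/
def ord (E : PrimeDivisorOver A F) (f : F) : ℤ :=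
  -WithZero.log ((IsDiscreteValuationRing.maximalIdeal E.ring).valuation F f)

variable [Algebra ℂ F]

/-- The rational `n`-forms that are regular at the generic point of `E`: the image of
`⋀ⁿ Ω_{R/ℂ}` in `⋀ⁿ Ω_{F/ℂ}`, where `R` is the valuation ring of `E`. -/
def regularForms (n : ℕ) (E : PrimeDivisorOver A F) :
    Submodule E.ring.toSubring (⋀[F]^n Ω[F⁄ℂ]) :=
  Submodule.span E.ring.toSubring
    {η | ∃ g : Fin n → E.ring, η = exteriorPower.ιMulti F n fun i => KaehlerDifferential.D ℂ F (g i)}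

/-- The order along `E` of the nonzero rational `n`-form `ω` is `k`, that is, the coefficient of
`E` in the canonical divisor of `ω` is `k`. -/
def FormHasOrd {n : ℕ} (E : PrimeDivisorOver A F) (ω : ⋀[F]^n Ω[F⁄ℂ]) (k : ℤ) : Prop :=
  ∃ (η : ⋀[F]^n Ω[F⁄ℂ]) (f : F), f ≠ 0 ∧ E.regularForms n = Submodule.span E.ring.toSubring {η} ∧
    ω = f • η ∧ E.ord f = k

/-- `q` is the log discrepancy `a(E, X)` of `E` with respect to the `n`-dimensional singularity
`x ∈ X`. Here `K_X` is the divisor of a rational `n`-form `ω`, and `m K_X` is the divisor of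
`g⁻¹` near `x`, so that the log discrepancy is one plus the coefficient of `E` in the
divisor of `ω` minus its coefficient in the pullback of `K_X`. -/
def IsLogDiscrepancy (n : ℕ) (x : Ideal A) (E : PrimeDivisorOver A F) (q : ℚ) : Prop :=
  ∃ (ω : ⋀[F]^n Ω[F⁄ℂ]) (m : ℕ) (g : F), ω ≠ 0 ∧ 0 < m ∧ g ≠ 0 ∧
    (∀ D : PrimeDivisorOver A F, D.center.height = 1 → D.center ≤ x →
      ∃ k : ℤ, D.FormHasOrd ω k ∧ m * k + D.ord g = 0) ∧
    ∃ k : ℤ, E.FormHasOrd ω k ∧ q = 1 + k + (E.ord g : ℚ) / m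

end PrimeDivisorOver

end Birational

/-- The minimal log discrepancy `mld(X ∋ x)` of an `n`-dimensional normal affine variety
`X = Spec A`: the infimum of the log discrepancies of all prime divisors over `X` with
center `x`. -/
def mld (A : Type*) [CommRing A] [IsDomain A] [Algebra ℂ A] (n : ℕ) (x : Ideal A) : EReal :=
  sInf {a | ∃ (E : PrimeDivisorOver A (FractionRing A)) (q : ℚ),
    E.center = x ∧ E.IsLogDiscrepancy n x q ∧ a = ((q : ℝ) : EReal)}

/-- The automorphism `x_i ↦ ξ^{a_i} x_i` of `ℂ[x_1, …, x_d]`, with `ξ = exp (2πi/r)`. -/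
def muAction {d : ℕ} (r : ℕ) (a : Fin d → ℤ) :
    MvPolynomial (Fin d) ℂ →ₐ[ℂ] MvPolynomial (Fin d) ℂ :=
  MvPolynomial.aeval fun i =>
    MvPolynomial.C (Complex.exp (2 * Real.pi * Complex.I / r) ^ a i) * MvPolynomial.X i

/-- The coordinate ring `ℂ[x_1, …, x_d]^{μ_r}` of the cyclic quotient `(1/r)(a_1, …, a_d)`. -/
def coordRing {d : ℕ} (r : ℕ) (a : Fin d → ℤ) : Subalgebra ℂ (MvPolynomial (Fin d) ℂ) :=
  AlgHom.equalizer (muAction r a) (AlgHom.id ℂ _)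

/-- The maximal ideal of the image of the origin in the cyclic quotient. -/
def originIdeal {d : ℕ} (r : ℕ) (a : Fin d → ℤ) : Ideal (coordRing r a) :=
  RingHom.ker (MvPolynomial.constantCoeff.comp (coordRing r a).val.toRingHom)

/-- The minimal log discrepancy of the cyclic quotient singularity `(1/r)(a_1, …, a_d)`, that is,
of `ℂ^d / μ_r` at the image of the origin. -/
def cyclicMld {d : ℕ} (r : ℕ) (a : Fin d → ℤ) : EReal :=
  mld (coordRing r a) d (originIdeal r a)

end CyclicQuotient

end

/-! The divisors over the quotient that matter are toric. If `v` is a point of `ℤ a / r + ℤ^d` with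
positive coordinates, the divisor of the monomial valuation with weights proportional to `v` has
log discrepancy at most `∑ v i`. Conversely, the form `dz₁ / z₁ ∧ ⋯ ∧ dz_d / z_d` in Laurent
monomials `z` has at most a simple pole along any divisor, so every log discrepancy at `x` is at
least such a sum. For `d = 2c + 1` the hypothesis on the minimal log discrepancy thus says that the
fractional parts of `k a / r` sum to at least `c - δ` with `δ < 1/6` whenever none of them vanishes;
by the conditions on the gcds, they sum to less than `c` for some such `k`.

If `r` were unbounded, the lattices of integral relations modulo `r` between the `a i` would have a
limit `L` along an ultrafilter. By a form of Kronecker's theorem that is uniform in `r`, every point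
of the dual group of `L` is a limit of multiples of `a / r`, so the lower bound `c - δ` persists
there. As `∑ a i` is prime to `r`, the dual group contains a line `ℝ v` with `∑ v i > 0`. The lower
bound for both `x` and `-x` determines `∑ ⌊x i⌋` from `∑ x i` when the latter is not close to an
integer, and multiplying by an integer prime to all denominators that moves `∑ x i` into
`[1/6, 5/6] + ℤ` shows that `∑ ⌊q i + t v i⌋`, for rational `q`, does not jump as `t` varies unless
the coordinate sum is an integer. Hence `∑ ⌊q i⌋ ≤ ∑ q i - c`, so the fractional parts of `q` sum to
at least `c`; this contradicts the existence of `k`. -/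

open scoped Matrix

noncomputable section

namespace CyclicQuotient

namespace PrimeDivisorOver

section Order

variable {A : Type*} [CommRing A] {F : Type*} [Field F] [Algebra A F]

theorem valuation_ne_zero (E : PrimeDivisorOver A F) {f : F} (hf : f ≠ 0) :
    (IsDiscreteValuationRing.maximalIdeal E.ring).valuation F f ≠ 0 :=
  (Valuation.ne_zero_iff _).2 hf

theorem ord_zero (E : PrimeDivisorOver A F) : E.ord 0 = 0 := by
  simp [ord]

theorem ord_one (E : PrimeDivisorOver A F) : E.ord 1 = 0 := by
  simp [ord]

theorem ord_mul (E : PrimeDivisorOver A F) {f g : F} (hf : f ≠ 0) (hg : g ≠ 0) :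
    E.ord (f * g) = E.ord f + E.ord g := by
  simp only [ord, map_mul, WithZero.log_mul (E.valuation_ne_zero hf) (E.valuation_ne_zero hg)]
  ring

theorem ord_inv (E : PrimeDivisorOver A F) (f : F) : E.ord f⁻¹ = -E.ord f := by
  simp [ord, WithZero.log_inv]

theorem ord_div (E : PrimeDivisorOver A F) {f g : F} (hf : f ≠ 0) (hg : g ≠ 0) :
    E.ord (f / g) = E.ord f - E.ord g := by
  rw [div_eq_mul_inv, E.ord_mul hf (inv_ne_zero hg), ord_inv, sub_eq_add_neg]

theorem ord_pow (E : PrimeDivisorOver A F) (f : F) (n : ℕ) : E.ord (f ^ n) = n * E.ord f := by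
  simp [ord, WithZero.log_pow]

theorem ord_zpow (E : PrimeDivisorOver A F) (f : F) (n : ℤ) : E.ord (f ^ n) = n * E.ord f := by
  simp [ord, WithZero.log_zpow]

theorem ord_prod (E : PrimeDivisorOver A F) {ι : Type*} (s : Finset ι) (f : ι → F)
    (hf : ∀ i ∈ s, f i ≠ 0) : E.ord (∏ i ∈ s, f i) = ∑ i ∈ s, E.ord (f i) := by
  classical
  induction s using Finset.induction_on with
  | empty => simp [ord_one]
  | insert i s hi ih =>
    rw [Finset.prod_insert hi, Finset.sum_insert hi, E.ord_mul (hf i (by simp))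
      (Finset.prod_ne_zero_iff.2 fun j hj => hf j (by simp [hj])),
      ih fun j hj => hf j (by simp [hj])]

theorem ord_nonneg_of_mem (E : PrimeDivisorOver A F) {f : F} (hf : f ∈ E.ring) : 0 ≤ E.ord f := by
  rcases eq_or_ne f 0 with rfl | h0
  · exact E.ord_zero.ge
  have hle := (IsDiscreteValuationRing.maximalIdeal E.ring).valuation_le_one (K := F) ⟨f, hf⟩
  exact neg_nonneg.2 ((WithZero.log_le_iff_le_exp (E.valuation_ne_zero h0)).2 (by simpa using hle))

theorem ord_pos_iff (E : PrimeDivisorOver A F) {f : F} (hf : f ∈ E.ring) (h0 : f ≠ 0) :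
    0 < E.ord f ↔ (⟨f, hf⟩ : E.ring) ∈ IsLocalRing.maximalIdeal E.ring := by
  rw [ord, neg_pos, WithZero.log_lt_iff_lt_exp (E.valuation_ne_zero h0), WithZero.exp_zero]
  exact (IsDiscreteValuationRing.maximalIdeal E.ring).valuation_lt_one_iff_mem (K := F) ⟨f, hf⟩

theorem mem_of_ord_nonneg (E : PrimeDivisorOver A F) {f : F} (h : 0 ≤ E.ord f) : f ∈ E.ring := by
  rcases eq_or_ne f 0 with rfl | h0
  · exact zero_mem _
  refine (E.ring.mem_or_inv_mem f).elim id fun hf => ?_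
  have hunit : IsUnit (⟨f⁻¹, hf⟩ : E.ring) := by
    rw [← not_not (a := IsUnit _), ← mem_nonunits_iff, ← IsLocalRing.mem_maximalIdeal,
      ← E.ord_pos_iff hf (inv_ne_zero h0), ord_inv]
    omega
  obtain ⟨g, hg⟩ := hunit.exists_right_inv
  have hg' : f⁻¹ * g = 1 := congrArg Subtype.val hg
  rw [inv_mul_eq_one₀ h0] at hg'
  exact hg' ▸ g.2

theorem mem_center_iff (E : PrimeDivisorOver A F) (a : A) :
    a ∈ E.center ↔
      (⟨algebraMap A F a, E.algebraMap_mem a⟩ : E.ring) ∈ IsLocalRing.maximalIdeal E.ring :=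
  Iff.rfl

theorem center_isPrime (E : PrimeDivisorOver A F) : E.center.IsPrime :=
  Ideal.comap_isPrime _ _

theorem ord_algebraMap_pos_iff [FaithfulSMul A F] (E : PrimeDivisorOver A F) {a : A} (ha : a ≠ 0) :
    0 < E.ord (algebraMap A F a) ↔ a ∈ E.center := by
  rw [mem_center_iff, ord_pos_iff _ (E.algebraMap_mem a)]
  simpa using ha

theorem ord_algebraMap_nonneg (E : PrimeDivisorOver A F) (a : A) :
    0 ≤ E.ord (algebraMap A F a) :=
  E.ord_nonneg_of_mem (E.algebraMap_mem a)

theorem ord_algebraMap_eq_zero [FaithfulSMul A F] (E : PrimeDivisorOver A F) {a : A}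
    (ha : a ∉ E.center) : E.ord (algebraMap A F a) = 0 := by
  have h0 : a ≠ 0 := by rintro rfl; exact ha (zero_mem _)
  exact le_antisymm (not_lt.1 ((E.ord_algebraMap_pos_iff h0).not.2 ha)) (E.ord_algebraMap_nonneg a)

theorem exists_uniformizer (E : PrimeDivisorOver A F) : ∃ t : F, t ≠ 0 ∧ E.ord t = 1 := by
  obtain ⟨t, ht⟩ := (IsDiscreteValuationRing.maximalIdeal E.ring).valuation_exists_uniformizer F
  refine ⟨t, ?_, by simp [ord, ht]⟩
  rintro rfl
  rw [map_zero] at ht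
  exact WithZero.exp_ne_zero ht.symm

end Order

end PrimeDivisorOver

section Regular

variable {A F : Type*} [CommRing A] [Field F] [Algebra A F]

/-- The rational function `f` on `Spec A` is regular at the point `p`, that is, it lies in the
local ring `A_p`. -/
def IsRegularAt (p : Ideal A) (f : F) : Prop :=
  ∃ b s : A, s ∉ p ∧ f = algebraMap A F b / algebraMap A F s

theorem isRegularAt_iff_not_colon_le [FaithfulSMul A F] (p : Ideal A) (f : F) :
    IsRegularAt p f ↔ ¬ (1 : Submodule A F).colon {f} ≤ p := by
  have ne_zero {s : A} (hs : s ∉ p) : algebraMap A F s ≠ 0 := by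
    have : s ≠ 0 := by rintro rfl; exact hs (zero_mem _)
    simpa
  simp only [IsRegularAt, SetLike.not_le_iff_exists, Submodule.mem_colon_singleton,
    Submodule.mem_one, Algebra.smul_def]
  constructor
  · rintro ⟨b, s, hs, rfl⟩
    exact ⟨s, ⟨b, (mul_div_cancel₀ _ (ne_zero hs)).symm⟩, hs⟩
  · rintro ⟨s, ⟨b, hb⟩, hs⟩
    exact ⟨b, s, hs, by rw [hb, mul_div_cancel_left₀ _ (ne_zero hs)]⟩

theorem PrimeDivisorOver.ord_nonneg_of_isRegularAt_center [FaithfulSMul A F]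
    (E : PrimeDivisorOver A F) {f : F} (hf : IsRegularAt E.center f) : 0 ≤ E.ord f := by
  obtain ⟨b, s, hs, rfl⟩ := hf
  rcases eq_or_ne b 0 with rfl | hb
  · simp [ord_zero]
  have hs0 : s ≠ 0 := by rintro rfl; exact hs (zero_mem _)
  rw [ord_div _ (by simpa using hb) (by simpa using hs0), E.ord_algebraMap_eq_zero hs, sub_zero]
  exact E.ord_algebraMap_nonneg b

theorem PrimeDivisorOver.center_eq_of_mem_ring_iff [FaithfulSMul A F] (E : PrimeDivisorOver A F)
    {p : Ideal A} (h : ∀ f : F, f ∈ E.ring ↔ IsRegularAt p f) : E.center = p := by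
  ext a
  rcases eq_or_ne a 0 with rfl | ha0
  · simp
  have ha0' : algebraMap A F a ≠ 0 := by simpa using ha0
  rw [← E.ord_algebraMap_pos_iff ha0]
  constructor
  · intro hpos
    by_contra ha
    have := E.ord_nonneg_of_mem ((h (algebraMap A F a)⁻¹).2 ⟨1, a, ha, by simp⟩)
    rw [ord_inv] at this
    omega
  · intro ha
    by_contra hpos
    obtain ⟨b, s, hs, hbs⟩ := (h _).1 (E.mem_of_ord_nonneg (f := (algebraMap A F a)⁻¹) (by
      rw [ord_inv]; omega))
    have hs0 : s ≠ 0 := by rintro rfl; exact hs (zero_mem _)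
    rw [inv_eq_one_div, div_eq_div_iff ha0' (by simpa using hs0), one_mul, ← map_mul] at hbs
    exact hs (FaithfulSMul.algebraMap_injective A F hbs ▸ p.mul_mem_left b ha)

end Regular

section HeightOne

variable {A : Type*} [CommRing A] {F : Type*} [Field F] [Algebra A F]

theorem isDiscreteValuationRing_of_height_eq_one [IsDomain A] [IsNoetherianRing A]
    [IsIntegrallyClosed A] (p : Ideal A) [p.IsPrime] (hp : p.height = 1) (S : Type*) [CommRing S]
    [IsDomain S] [Algebra A S] [IsLocalization.AtPrime S p] : IsDiscreteValuationRing S := by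
  have hdim : ringKrullDim S = 1 := by
    rw [IsLocalization.AtPrime.ringKrullDim_eq_height p S, hp]; rfl
  have : IsLocalRing S := IsLocalization.AtPrime.isLocalRing S p
  have : IsNoetherianRing S := IsLocalization.isNoetherianRing p.primeCompl S inferInstance
  have : IsIntegrallyClosed S :=
    isIntegrallyClosed_of_isLocalization S p.primeCompl p.primeCompl_le_nonZeroDivisors
  have : Ring.KrullDimLE 1 S := Ring.krullDimLE_iff.2 hdim.le
  have : Ring.DimensionLEOne S := ⟨Ring.krullDimLE_one_iff_of_noZeroDivisors.1 this _⟩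
  have : IsDedekindDomain S := { }
  refine ((IsDiscreteValuationRing.TFAE S fun hfield => ?_).out 0 2).2 this
  rw [ringKrullDim_eq_zero_of_isField hfield] at hdim
  exact zero_ne_one hdim

namespace PrimeDivisorOver

theorem exists_mem_ring_iff_of_subalgebra (B : Subalgebra A F) (hB : B.FG) [IsNoetherianRing B]
    [IsIntegrallyClosed B] [IsFractionRing B F] (P : Ideal B) [hP : P.IsPrime]
    (hP1 : P.height = 1) : ∃ E : PrimeDivisorOver A F, ∀ f : F, f ∈ E.ring ↔ IsRegularAt P f := by
  let S := Localization.subalgebra.ofField F P.primeCompl P.primeCompl_le_nonZeroDivisors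
  have hmem (f : F) : f ∈ S ↔ IsRegularAt P f := by
    simp only [IsRegularAt, div_eq_mul_inv, ← exists_prop]; rfl
  have : IsLocalization.AtPrime S P :=
    Localization.subalgebra.isLocalization_ofField F P.primeCompl P.primeCompl_le_nonZeroDivisors
  have hS : IsDiscreteValuationRing S := isDiscreteValuationRing_of_height_eq_one P hP1 S
  let R : ValuationSubring F := .ofSubring S.toSubring fun f =>
    (ValuationRing.isInteger_or_isInteger S f).imp (fun ⟨g, hg⟩ => hg ▸ g.2) fun ⟨g, hg⟩ => hg ▸ g.2
  exact ⟨⟨R, hS, B, P, hB, inferInstance, hP, hP1, hmem⟩, hmem⟩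

theorem exists_mem_ring_iff_of_height_eq_one [IsNoetherianRing A]
    [IsIntegrallyClosed A] [IsFractionRing A F] (p : Ideal A) [p.IsPrime] (hp : p.height = 1) :
    ∃ E : PrimeDivisorOver A F, ∀ f : F, f ∈ E.ring ↔ IsRegularAt p f := by
  let e : A ≃+* (⊥ : Subalgebra A F) :=
    (Algebra.botEquivOfInjective (IsFractionRing.injective A F)).symm.toRingEquiv
  have : IsNoetherianRing (⊥ : Subalgebra A F) := isNoetherianRing_of_ringEquiv A e
  have : IsIntegrallyClosed (⊥ : Subalgebra A F) := IsIntegrallyClosed.of_equiv e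
  have : (p.map e).IsPrime := Ideal.map_isPrime_of_equiv e
  obtain ⟨E, hE⟩ := exists_mem_ring_iff_of_subalgebra (⊥ : Subalgebra A F) Subalgebra.fg_bot
    (p.map e) (by rw [RingEquiv.height_map, hp])
  have hmem (s : A) : e s ∈ p.map e ↔ s ∈ p := by
    rw [Ideal.mem_map_of_equiv]
    exact ⟨fun ⟨x, hx, h⟩ => e.injective h ▸ hx, fun h => ⟨s, h, rfl⟩⟩
  refine ⟨E, fun f => ?_⟩
  simp only [hE, IsRegularAt, e.surjective.exists, hmem]
  rfl

/-- A discrete valuation ring is maximal among the proper subrings of its fraction field, so the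
local ring of `X` at the center is all of the valuation ring. -/
theorem mem_ring_iff_of_height_center_eq_one [IsNoetherianRing A] [IsIntegrallyClosed A]
    [IsFractionRing A F] (E : PrimeDivisorOver A F) (hE : E.center.height = 1) (f : F) :
    f ∈ E.ring ↔ IsRegularAt E.center f := by
  refine ⟨fun hf => ?_, fun hf => E.mem_of_ord_nonneg (E.ord_nonneg_of_isRegularAt_center hf)⟩
  have := E.center_isPrime
  obtain ⟨D, hD⟩ := exists_mem_ring_iff_of_height_eq_one (F := F) E.center hE
  rw [← hD]
  by_contra hfD
  have hf0 : f ≠ 0 := by rintro rfl; exact hfD (zero_mem _)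
  obtain ⟨b, s, hs, h⟩ := (hD f⁻¹).1 ((D.ring.mem_or_inv_mem f).resolve_left hfD)
  have hb : b ∈ E.center := by
    by_contra hb
    exact hfD ((hD f).2 ⟨s, b, hb, by rw [← inv_inv f, h, inv_div]⟩)
  have hb0 : b ≠ 0 := by rintro rfl; simp [hf0] at h
  have hs0 : s ≠ 0 := by rintro rfl; exact hs (zero_mem _)
  have hord : E.ord f⁻¹ = E.ord (algebraMap A F b) := by
    rw [h, ord_div _ (by simpa using hb0) (by simpa using hs0), E.ord_algebraMap_eq_zero hs,
      sub_zero]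
  have hb_pos := (E.ord_algebraMap_pos_iff hb0).2 hb
  have hf_nonneg := E.ord_nonneg_of_mem hf
  rw [ord_inv] at hord
  omega

end PrimeDivisorOver

section Hartogs

variable [IsNoetherianRing A] [IsIntegrallyClosed A] [IsFractionRing A F]

theorem exists_mul_eq_notMem_of_eq_colon {p : Ideal A} (hp : p ≠ ⊤) (hp0 : p ≠ ⊥) {y : F}
    (hpy : p = (1 : Submodule A F).colon {y}) :
    ∃ t ∈ p, ∃ w ∉ p, algebraMap A F w = algebraMap A F t * y := by
  by_contra! hall
  have hy_int : IsIntegral A y := by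
    refine isIntegral_of_smul_mem_submodule (Submodule.map (Algebra.linearMap A F) p) ?_
      ((IsNoetherian.noetherian p).map _) y ?_
    · rw [← Submodule.map_bot (Algebra.linearMap A F)]
      exact (Submodule.map_injective_of_injective (IsFractionRing.injective A F)).ne hp0
    · rintro _ ⟨t, ht, rfl⟩
      obtain ⟨w, hw⟩ := Submodule.mem_one.1 (Submodule.mem_colon_singleton.1 (hpy ▸ ht))
      rw [Algebra.smul_def] at hw
      exact ⟨w, by_contra fun hwp => hall t ht w hwp hw, by simpa [mul_comm y] using hw⟩
  rw [Ne, Ideal.eq_top_iff_one, hpy, Submodule.mem_colon_singleton, one_smul,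
    Submodule.mem_one] at hp
  exact hp (IsIntegrallyClosed.isIntegral_iff.1 hy_int)

variable [IsDomain A]

theorem height_eq_one_of_eq_colon {p : Ideal A} [p.IsPrime] {y : F}
    (hpy : p = (1 : Submodule A F).colon {y}) : p.height = 1 := by
  have hmem (s : A) : s ∈ p ↔ ∃ w, algebraMap A F w = algebraMap A F s * y := by
    rw [hpy, Submodule.mem_colon_singleton, Submodule.mem_one, Algebra.smul_def]
  have hp0 : p ≠ ⊥ := by
    obtain ⟨a, b, hb, rfl⟩ := IsFractionRing.div_surjective A y
    have hb0 : b ≠ 0 := nonZeroDivisors.ne_zero hb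
    have hb0' : algebraMap A F b ≠ 0 := by simpa using hb0
    exact Submodule.ne_bot_iff _ |>.2 ⟨b, (hmem b).2 ⟨a, (mul_div_cancel₀ _ hb0').symm⟩, hb0⟩
  obtain ⟨t, ht, w, hw, hwt⟩ := exists_mul_eq_notMem_of_eq_colon Ideal.IsPrime.ne_top' hp0 hpy
  -- `y = w / t` in `A_p`, so that the denominators of `y` generate the ideal `(t)` there.
  have hmin : p ∈ (Ideal.span {t}).minimalPrimes := by
    refine ⟨⟨inferInstance, (Ideal.span_singleton_le_iff_mem _).2 ht⟩, ?_⟩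
    rintro q ⟨hq, htq⟩ hqp s hs
    obtain ⟨z, hz⟩ := (hmem s).1 hs
    have hsw : s * w = z * t :=
      IsFractionRing.injective A F (by rw [map_mul, map_mul, hwt, hz]; ring)
    have hsw_mem : s * w ∈ q :=
      hsw ▸ q.mul_mem_left z ((Ideal.span_singleton_le_iff_mem _).1 htq)
    exact (hq.mem_or_mem hsw_mem).resolve_right fun hwq => hw (hqp hwq)
  refine le_antisymm (Ideal.height_le_one_of_isPrincipal_of_mem_minimalPrimes _ p hmin) ?_
  rwa [Order.one_le_iff_ne_zero, Ne, Ideal.height_eq_zero_iff_eq_bot]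

theorem isRegularAt_of_forall_height_eq_one (x : Ideal A) [x.IsPrime] (f : F)
    (h : ∀ p : Ideal A, p.IsPrime → p.height = 1 → p ≤ x → IsRegularAt p f) :
    IsRegularAt x f := by
  rw [isRegularAt_iff_not_colon_le]
  intro hx
  obtain ⟨p, hp, hpx⟩ := Ideal.exists_minimalPrimes_le hx
  have := hp.isPrime
  obtain ⟨y, hpy⟩ := Submodule.exists_eq_colon_of_mem_minimalPrimes hp
  exact (isRegularAt_iff_not_colon_le p f).1
    (h p hp.isPrime (height_eq_one_of_eq_colon hpy) hpx) hp.le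

end Hartogs

end HeightOne

section ExteriorAlgebra

theorem alternatingMap_sum_smul {R V W ι : Type*} [CommRing R] [AddCommGroup V] [Module R V]
    [AddCommGroup W] [Module R W] [Fintype ι] [DecidableEq ι] (f : V [⋀^ι]→ₗ[R] W)
    (M : Matrix ι ι R) (u : ι → V) : f (fun j => ∑ i, M j i • u i) = M.det • f u := by
  have h : f.compLinearMap (Fintype.linearCombination R u) =
      (LinearMap.toSpanSingleton R W (f u)).compAlternatingMap Matrix.detRowAlternating := by
    refine Module.Basis.ext_alternating (Pi.basisFun R ι) fun v hv => ?_
    let e : Equiv.Perm ι := Equiv.ofBijective v (Finite.injective_iff_bijective.1 hv)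
    have hbasis : (fun i => Pi.basisFun R ι (v i)) = (fun i => (1 : Matrix ι ι R) i) ∘ e := by
      funext i j
      simp [e, Matrix.one_apply, Pi.single_apply, eq_comm]
    have hdet : Matrix.detRowAlternating (fun i => (1 : Matrix ι ι R) i) = 1 := Matrix.det_one
    rw [hbasis, AlternatingMap.map_perm, AlternatingMap.map_perm]
    simp [hdet, Fintype.linearCombination_apply, Matrix.one_apply]
  exact congrArg (fun g => g M) h

end ExteriorAlgebra

section Unimodular

variable {R ι : Type*} [CommRing R] [IsDomain R] [IsPrincipalIdealRing R] [Finite ι]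

theorem exists_basis_eq_smul {M : Type*} [AddCommGroup M] [Module R M]
    (b₀ : Module.Basis ι R M) (w : M) (i₀ : ι) :
    ∃ (b : Module.Basis ι R M) (c : R), w = c • b i₀ := by
  classical
  obtain rfl | hw := eq_or_ne w 0
  · exact ⟨b₀, 0, (zero_smul _ _).symm⟩
  have : Module.IsTorsionFree R M := b₀.isTorsionFree
  obtain ⟨k, b, bN, f, a, hs⟩ := Submodule.smithNormalForm b₀ (Submodule.span R {w})
  obtain rfl : k = 1 := by
    have hrank := (LinearEquiv.toSpanNonzeroSingleton R M w hw).finrank_eq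
    rw [Module.finrank_eq_card_basis bN] at hrank
    simpa using hrank.symm
  have hrepr := congrArg Subtype.val (bN.sum_repr ⟨w, Submodule.mem_span_singleton_self w⟩)
  simp only [Finset.univ_unique, Fin.default_eq_zero, Finset.sum_singleton,
    Submodule.coe_smul, hs] at hrepr
  refine ⟨b.reindex (Equiv.swap (f 0) i₀),
    bN.repr ⟨w, Submodule.mem_span_singleton_self w⟩ 0 * a 0, ?_⟩
  rw [Module.Basis.reindex_apply, Equiv.symm_swap, Equiv.swap_apply_right, ← smul_smul, hrepr]

end Unimodular

section Monomial

variable {F ι : Type*} [CommGroupWithZero F]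

theorem prod_zpow_eq_zpow_sum {y : F} (hy : y ≠ 0) (s : Finset ι) (k : ι → ℤ) :
    ∏ i ∈ s, y ^ k i = y ^ ∑ i ∈ s, k i := by
  classical
  induction s using Finset.induction_on with
  | empty => simp
  | insert i s hi ih => rw [Finset.prod_insert hi, Finset.sum_insert hi, zpow_add₀ hy, ih]

variable [Fintype ι]

/-- The Laurent monomials in the `z j` whose exponents are the rows of `U`. -/
def monomialTransform (U : Matrix ι ι ℤ) (z : ι → F) (i : ι) : F := ∏ j, z j ^ U i j

variable {z : ι → F}

theorem monomialTransform_ne_zero (U : Matrix ι ι ℤ) (hz : ∀ j, z j ≠ 0) (i : ι) :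
    monomialTransform U z i ≠ 0 :=
  Finset.prod_ne_zero_iff.2 fun j _ => zpow_ne_zero _ (hz j)

theorem prod_monomialTransform_zpow (U : Matrix ι ι ℤ) (hz : ∀ j, z j ≠ 0) (k : ι → ℤ) :
    ∏ i, monomialTransform U z i ^ k i = ∏ j, z j ^ (k ᵥ* U) j := by
  simp only [monomialTransform, ← Finset.prod_zpow, ← zpow_mul, Matrix.vecMul, dotProduct]
  rw [Finset.prod_comm]
  refine Finset.prod_congr rfl fun j _ => ?_
  simp only [mul_comm (U _ _), prod_zpow_eq_zpow_sum (hz j)]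

theorem monomialTransform_mul (U V : Matrix ι ι ℤ) (hz : ∀ j, z j ≠ 0) :
    monomialTransform V (monomialTransform U z) = monomialTransform (V * U) z :=
  funext fun i => prod_monomialTransform_zpow U hz (V i)

theorem monomialTransform_one [DecidableEq ι] : monomialTransform (1 : Matrix ι ι ℤ) z = z := by
  funext i
  simp [monomialTransform, Matrix.one_apply]

end Monomial

/-- An integer matrix `U` with inverse `V` whose column `i₀` is the vector `w` divided by a positive
integer `g`. In toric terms, a basis of the lattice of one-parameter subgroups containing the
primitive vector on the ray of `w`. -/
structure UnimodularColumn {ι : Type*} [Fintype ι] [DecidableEq ι] (w : ι → ℤ) (i₀ : ι) where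
  U : Matrix ι ι ℤ
  V : Matrix ι ι ℤ
  V_mul_U : V * U = 1
  U_mul_V : U * V = 1
  g : ℤ
  g_pos : 0 < g
  g_mul_U : ∀ j, g * U j i₀ = w j

namespace UnimodularColumn

variable {ι : Type*} [Fintype ι] [DecidableEq ι] {w : ι → ℤ} {i₀ : ι}

theorem nonempty (hw : w ≠ 0) (i₀ : ι) : Nonempty (UnimodularColumn w i₀) := by
  obtain ⟨b, g, hg, hgw⟩ : ∃ (b : Module.Basis ι ℤ (ι → ℤ)) (g : ℤ), 0 < g ∧ w = g • b i₀ := by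
    obtain ⟨b, c, rfl⟩ := exists_basis_eq_smul (Pi.basisFun ℤ ι) w i₀
    obtain hc | rfl | hc := lt_trichotomy c 0
    · exact ⟨b.map (LinearEquiv.neg ℤ), -c, neg_pos.2 hc, by simp⟩
    · exact absurd (zero_smul _ _) hw
    · exact ⟨b, c, hc, rfl⟩
  refine ⟨⟨(Pi.basisFun ℤ ι).toMatrix b, b.toMatrix (Pi.basisFun ℤ ι),
    Module.Basis.toMatrix_mul_toMatrix_flip _ _, Module.Basis.toMatrix_mul_toMatrix_flip _ _,
    g, hg, fun j => ?_⟩⟩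
  rw [hgw]
  simp [Module.Basis.toMatrix_apply]

variable (u : UnimodularColumn w i₀)

theorem isUnit_det : IsUnit u.U.det :=
  IsUnit.of_mul_eq_one u.V.det (by rw [← Matrix.det_mul, u.U_mul_V, Matrix.det_one])

theorem g_mul_vecMul (k : ι → ℤ) : u.g * (k ᵥ* u.U) i₀ = ∑ j, k j * w j := by
  rw [Matrix.vecMul, dotProduct, Finset.mul_sum]
  exact Finset.sum_congr rfl fun j _ => by rw [← u.g_mul_U j]; ring

variable {F : Type*} [CommGroupWithZero F] {z : ι → F}

theorem monomialTransform_V (hz : ∀ j, z j ≠ 0) :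
    monomialTransform u.U (monomialTransform u.V z) = z := by
  rw [monomialTransform_mul _ _ hz, u.U_mul_V, monomialTransform_one]

theorem prod_zpow_eq (hz : ∀ j, z j ≠ 0) (k : ι → ℤ) :
    ∏ j, z j ^ k j = ∏ i, monomialTransform u.V z i ^ (k ᵥ* u.U) i := by
  rw [← prod_monomialTransform_zpow _ (monomialTransform_ne_zero u.V hz),
    u.monomialTransform_V hz]

end UnimodularColumn

section LogarithmicDifferential

variable {K F : Type*} [CommRing K] [Field F] [Algebra K F]

theorem D_zpow (y : F) (hy : y ≠ 0) (k : ℤ) :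
    KaehlerDifferential.D K F (y ^ k) = ((k : F) * y ^ k * y⁻¹) • KaehlerDifferential.D K F y := by
  rw [Derivation.leibniz_zpow, zpow_sub_one₀ hy, ← Int.cast_smul_eq_zsmul F, smul_smul, mul_assoc]

theorem D_zpow_mul {t u : F} (ht : t ≠ 0) (hu : u ≠ 0) (k : ℤ) :
    KaehlerDifferential.D K F (t ^ k * u) = (t ^ k * u) •
      (((k : F) * t⁻¹) • KaehlerDifferential.D K F t + u⁻¹ • KaehlerDifferential.D K F u) := by
  rw [Derivation.leibniz, D_zpow t ht, smul_smul, smul_add, smul_smul, smul_smul, add_comm]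
  congr 2
  · ring
  · rw [mul_inv_cancel_right₀ hu]

theorem D_prod_zpow {ι : Type*} (s : Finset ι) (y : ι → F) (hy : ∀ i, y i ≠ 0) (k : ι → ℤ) :
    KaehlerDifferential.D K F (∏ i ∈ s, y i ^ k i) =
      ∑ i ∈ s, ((∏ i ∈ s, y i ^ k i) * (k i * (y i)⁻¹)) • KaehlerDifferential.D K F (y i) := by
  classical
  induction s using Finset.induction_on with
  | empty => simp
  | insert i s hi ih =>
    rw [Finset.prod_insert hi, Finset.sum_insert hi, Derivation.leibniz, ih, D_zpow _ (hy i),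
      Finset.smul_sum, add_comm, smul_smul]
    congr 1
    · congr 1; ring
    · refine Finset.sum_congr rfl fun j _ => ?_
      rw [smul_smul]; congr 1; ring

theorem ιMulti_D_monomialTransform {n : ℕ} (U : Matrix (Fin n) (Fin n) ℤ) {y : Fin n → F}
    (hy : ∀ i, y i ≠ 0) :
    exteriorPower.ιMulti F n (fun j => KaehlerDifferential.D K F (monomialTransform U y j)) =
      ((∏ j, monomialTransform U y j) * (∏ i, y i)⁻¹ * (U.det : F)) •
        exteriorPower.ιMulti F n (fun i => KaehlerDifferential.D K F (y i)) := by
  have hD : (fun j => KaehlerDifferential.D K F (monomialTransform U y j)) = fun j =>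
      ∑ i, (Matrix.of fun j i => monomialTransform U y j * (Matrix.of fun j i => (y i)⁻¹ *
        (U.map (Int.castRingHom F)) j i) j i) j i • KaehlerDifferential.D K F (y i) := by
    funext j
    rw [monomialTransform, D_prod_zpow _ y hy]
    refine Finset.sum_congr rfl fun i _ => ?_
    simp [monomialTransform, mul_comm]
  rw [hD, alternatingMap_sum_smul, Matrix.det_mul_column, Matrix.det_mul_row,
    ← RingHom.mapMatrix_apply, ← RingHom.map_det, Finset.prod_inv_distrib, mul_assoc]
  rfl

end LogarithmicDifferential

namespace PrimeDivisorOver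

variable {A F : Type*} [CommRing A] [Field F] [Algebra A F]

theorem ord_eq_zero_of_isUnit (E : PrimeDivisorOver A F) {u : E.ring} (hu : IsUnit u) :
    E.ord u = 0 := by
  obtain ⟨v, rfl⟩ := hu
  have hmul : ((v : E.ring) : F) * ((v⁻¹ : E.ringˣ) : E.ring) = 1 := by
    exact_mod_cast congrArg Subtype.val v.mul_inv
  have hord := E.ord_mul (left_ne_zero_of_mul_eq_one hmul) (right_ne_zero_of_mul_eq_one hmul)
  rw [hmul, ord_one] at hord
  have := E.ord_nonneg_of_mem (v : E.ring).2
  have := E.ord_nonneg_of_mem ((v⁻¹ : E.ringˣ) : E.ring).2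
  omega

variable [Algebra ℂ F] {n : ℕ}

theorem ιMulti_D_mem_regularForms (E : PrimeDivisorOver A F) (t : Fin n → F)
    (ht : ∀ i, t i ∈ E.ring) :
    exteriorPower.ιMulti F n (fun i => KaehlerDifferential.D ℂ F (t i)) ∈ E.regularForms n :=
  Submodule.subset_span ⟨fun i => ⟨t i, ht i⟩, rfl⟩

section Coordinates

variable [Algebra ℂ A] [IsScalarTower ℂ A F]

/-- The functions in the valuation ring of `E` whose differential is a combination of the
differentials of the `t i` with coefficients in the valuation ring. When it is the whole
valuation ring, `dt₁ ∧ ⋯ ∧ dtₙ` generates the regular `n`-forms along `E`. -/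
def coordSubalgebra (E : PrimeDivisorOver A F) (t : Fin n → F) : Subalgebra ℂ F where
  carrier := {g | g ∈ E.ring ∧ KaehlerDifferential.D ℂ F g ∈
    Submodule.span E.ring.toSubring (Set.range fun i => KaehlerDifferential.D ℂ F (t i))}
  mul_mem' := by
    rintro a b ⟨ha, ha'⟩ ⟨hb, hb'⟩
    refine ⟨mul_mem ha hb, ?_⟩
    rw [Derivation.leibniz]
    exact add_mem (Submodule.smul_mem _ (⟨a, ha⟩ : E.ring.toSubring) hb')
      (Submodule.smul_mem _ (⟨b, hb⟩ : E.ring.toSubring) ha')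
  add_mem' := by
    rintro a b ⟨ha, ha'⟩ ⟨hb, hb'⟩
    exact ⟨add_mem ha hb, by rw [map_add]; exact add_mem ha' hb'⟩
  algebraMap_mem' c := by
    refine ⟨?_, by simp⟩
    rw [IsScalarTower.algebraMap_apply ℂ A F]
    exact E.algebraMap_mem _

theorem mem_coordSubalgebra_self (E : PrimeDivisorOver A F) (t : Fin n → F) {i : Fin n}
    (hi : t i ∈ E.ring) : t i ∈ E.coordSubalgebra t :=
  ⟨hi, Submodule.subset_span ⟨i, rfl⟩⟩

theorem inv_mem_coordSubalgebra (E : PrimeDivisorOver A F) (t : Fin n → F) {g : F}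
    (hg : g ∈ E.coordSubalgebra t) (hg' : g⁻¹ ∈ E.ring) : g⁻¹ ∈ E.coordSubalgebra t := by
  refine ⟨hg', ?_⟩
  rw [Derivation.leibniz_inv]
  exact Submodule.smul_mem _ (⟨-g⁻¹ ^ 2, neg_mem (pow_mem hg' 2)⟩ : E.ring.toSubring) hg.2

theorem mem_coordSubalgebra_of_fractions (E : PrimeDivisorOver A F) (t : Fin n → F)
    (h : ∀ g ∈ E.ring, ∃ b s : F, b ∈ E.coordSubalgebra t ∧ s ∈ E.coordSubalgebra t ∧ s⁻¹ ∈ E.ring ∧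
      g = b / s) : ∀ g ∈ E.ring, g ∈ E.coordSubalgebra t := by
  intro g hg
  obtain ⟨b, s, hb, hs, hs', rfl⟩ := h g hg
  rw [div_eq_mul_inv]
  exact mul_mem hb (E.inv_mem_coordSubalgebra t hs hs')

theorem regularForms_eq_span (E : PrimeDivisorOver A F) (t : Fin n → F) (ht : ∀ i, t i ∈ E.ring)
    (h : ∀ g ∈ E.ring, g ∈ E.coordSubalgebra t) :
    E.regularForms n = Submodule.span E.ring.toSubring
      {exteriorPower.ιMulti F n fun i => KaehlerDifferential.D ℂ F (t i)} := by
  refine le_antisymm (Submodule.span_le.2 ?_)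
    ((Submodule.span_singleton_le_iff_mem _ _).2 (E.ιMulti_D_mem_regularForms t ht))
  rintro _ ⟨g, rfl⟩
  have hcoeff : ∀ j, ∃ c : Fin n → E.ring.toSubring,
      ∑ i, c i • KaehlerDifferential.D ℂ F (t i) = KaehlerDifferential.D ℂ F (g j) := fun j =>
    (Submodule.mem_span_range_iff_exists_fun _).1 (h _ (g j).2).2
  choose M hM using hcoeff
  have hD : (fun j => KaehlerDifferential.D ℂ F (g j : F)) = fun j =>
      ∑ i, ((Matrix.of M).map E.ring.toSubring.subtype) j i • KaehlerDifferential.D ℂ F (t i) :=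
    funext fun j => (hM j).symm
  rw [hD, alternatingMap_sum_smul, ← RingHom.mapMatrix_apply, ← RingHom.map_det]
  exact Submodule.smul_mem _ (Matrix.of M).det (Submodule.mem_span_singleton_self _)

end Coordinates

theorem smul_ιMulti_smul_D_mem_regularForms (E : PrimeDivisorOver A F) (a : F) {c g : Fin n → F}
    (hg : ∀ i, g i ∈ E.ring) (hc : a * ∏ i, c i ∈ E.ring) :
    a • exteriorPower.ιMulti F n (fun i => c i • KaehlerDifferential.D ℂ F (g i)) ∈
      E.regularForms n := by
  rw [← AlternatingMap.coe_multilinearMap, MultilinearMap.map_smul_univ, smul_smul]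
  exact Submodule.smul_mem _ (⟨_, hc⟩ : E.ring.toSubring) (E.ιMulti_D_mem_regularForms g hg)

/-- Expanding the product, every term with `dt/t` in two places vanishes. -/
theorem smul_ιMulti_add_mem_regularForms (E : PrimeDivisorOver A F) {t : F} (ht : t ∈ E.ring)
    (ht0 : t ≠ 0) {u : Fin n → F} (hu : ∀ i, u i ∈ E.ring) (hu' : ∀ i, (u i)⁻¹ ∈ E.ring)
    (ν : Fin n → ℤ) :
    t • exteriorPower.ιMulti F n (fun i => ((ν i : F) * t⁻¹) • KaehlerDifferential.D ℂ F t +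
      (u i)⁻¹ • KaehlerDifferential.D ℂ F (u i)) ∈ E.regularForms n := by
  classical
  rw [← AlternatingMap.coe_multilinearMap, ← Pi.add_def, MultilinearMap.map_add_univ,
    Finset.smul_sum]
  refine sum_mem fun s _ => ?_
  let c : Fin n → F := s.piecewise (fun i => ν i * t⁻¹) fun i => (u i)⁻¹
  let g : Fin n → F := s.piecewise (fun _ => t) u
  have hterm : (s.piecewise (fun i => ((ν i : F) * t⁻¹) • KaehlerDifferential.D ℂ F t)
      fun i => (u i)⁻¹ • KaehlerDifferential.D ℂ F (u i)) =
      fun i => c i • KaehlerDifferential.D ℂ F (g i) := by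
    funext i
    by_cases hi : i ∈ s <;> simp [c, g, hi]
  rw [hterm]
  by_cases hs : s.card ≤ 1
  · refine E.smul_ιMulti_smul_D_mem_regularForms t (fun i => ?_) ?_
    · by_cases hi : i ∈ s <;> simp [g, hi, ht, hu]
    · rw [Finset.prod_piecewise, ← mul_assoc, Finset.univ_inter]
      refine mul_mem ?_ (prod_mem fun i _ => hu' i)
      obtain hs | hs := Nat.le_one_iff_eq_zero_or_eq_one.1 hs
      · simpa [Finset.card_eq_zero.1 hs] using ht
      · obtain ⟨i, rfl⟩ := Finset.card_eq_one.1 hs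
        simp [mul_left_comm t, ht0]
  · obtain ⟨i, hi, j, hj, hij⟩ := Finset.one_lt_card.1 (not_le.1 hs)
    rw [MultilinearMap.map_smul_univ, AlternatingMap.coe_multilinearMap,
      AlternatingMap.map_eq_zero_of_eq _ _ (by simp [g, hi, hj]) hij, smul_zero, smul_zero]
    exact zero_mem _

theorem FormHasOrd.unique {E : PrimeDivisorOver A F} {ω : ⋀[F]^n Ω[F⁄ℂ]} {k k' : ℤ}
    (h : E.FormHasOrd ω k) (h' : E.FormHasOrd ω k') (hω : ω ≠ 0) : k = k' := by
  obtain ⟨η, f, hf, hη, rfl, rfl⟩ := h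
  obtain ⟨η', f', hf', hη', hω', rfl⟩ := h'
  have hη0 : η ≠ 0 := by rintro rfl; exact hω (smul_zero f)
  have : Module.IsTorsionFree E.ring.toSubring (⋀[F]^n Ω[F⁄ℂ]) := .trans_faithfulSMul _ F _
  obtain ⟨u, rfl⟩ := Submodule.span_singleton_eq_span_singleton.1 (hη.symm.trans hη')
  have hu := E.ord_eq_zero_of_isUnit u.isUnit
  have hff : f = f' * (u : E.ring.toSubring) :=
    smul_left_injective F hη0 (hω'.trans (smul_smul _ _ _))
  rw [hff, E.ord_mul hf' (fun h => hf (by rw [hff, h, mul_zero])), hu, add_zero]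

theorem FormHasOrd.of_smul {E : PrimeDivisorOver A F} {ω : ⋀[F]^n Ω[F⁄ℂ]} {k : ℤ} {h : F}
    (h0 : h ≠ 0) (hω : E.FormHasOrd (h • ω) k) : E.FormHasOrd ω (k - E.ord h) := by
  obtain ⟨η, f, hf, hη, heq, rfl⟩ := hω
  refine ⟨η, h⁻¹ * f, mul_ne_zero (inv_ne_zero h0) hf, hη, ?_, ?_⟩
  · rw [mul_smul, ← heq, inv_smul_smul₀ h0]
  · rw [E.ord_mul (inv_ne_zero h0) hf, E.ord_inv]
    ring

/-- Equivalently, the logarithmic form `⋀ dz_i / z_i` has at most a simple pole along `E`. -/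
theorem FormHasOrd.sum_ord_le {E : PrimeDivisorOver A F} {z : Fin n → F} {k : ℤ}
    (hz : ∀ i, z i ≠ 0)
    (hk : E.FormHasOrd (exteriorPower.ιMulti F n fun i => KaehlerDifferential.D ℂ F (z i)) k)
    (h0 : exteriorPower.ιMulti F n (fun i => KaehlerDifferential.D ℂ F (z i)) ≠ 0) :
    ∑ i, E.ord (z i) - 1 ≤ k := by
  obtain ⟨t, ht0, ht⟩ := E.exists_uniformizer
  have ht' : t ∈ E.ring := E.mem_of_ord_nonneg (by omega)
  let u : Fin n → F := fun i => z i * t ^ (-E.ord (z i))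
  have hu0 : ∀ i, u i ≠ 0 := fun i => mul_ne_zero (hz i) (zpow_ne_zero _ ht0)
  have hord : ∀ i, E.ord (u i) = 0 := fun i => by
    rw [E.ord_mul (hz i) (zpow_ne_zero _ ht0), E.ord_zpow, ht]; ring
  have hD : (fun i => KaehlerDifferential.D ℂ F (z i)) = fun i => z i •
      (((E.ord (z i) : F) * t⁻¹) • KaehlerDifferential.D ℂ F t +
        (u i)⁻¹ • KaehlerDifferential.D ℂ F (u i)) := by
    funext i
    have hzi : t ^ E.ord (z i) * u i = z i := by
      rw [mul_comm, mul_assoc, ← zpow_add₀ ht0, neg_add_cancel, zpow_zero, mul_one]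
    simpa only [hzi] using D_zpow_mul (K := ℂ) ht0 (hu0 i) (E.ord (z i))
  have hlog := E.smul_ιMulti_add_mem_regularForms ht' ht0
    (fun i => E.mem_of_ord_nonneg (hord i).ge)
    (fun i => E.mem_of_ord_nonneg (by rw [E.ord_inv, hord, neg_zero])) fun i => E.ord (z i)
  obtain ⟨η, f, hf, hη, hω, rfl⟩ := hk
  rw [hη] at hlog
  obtain ⟨c, hc⟩ := Submodule.mem_span_singleton.1 hlog
  have hη0 : η ≠ 0 := by rintro rfl; exact h0 (hω.trans (smul_zero f))
  have htf : t * f = (∏ i, z i) * c := by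
    refine smul_left_injective F hη0 ?_
    change (t * f) • η = ((∏ i, z i) * c) • η
    rw [mul_smul, mul_smul, ← hω, hD, ← AlternatingMap.coe_multilinearMap,
      MultilinearMap.map_smul_univ, smul_comm]
    exact congrArg _ hc.symm
  have hc0 : (c : F) ≠ 0 := right_ne_zero_of_mul (htf ▸ mul_ne_zero ht0 hf)
  have hsum := congrArg E.ord htf
  rw [E.ord_mul ht0 hf, ht, E.ord_mul (Finset.prod_ne_zero_iff.2 fun i _ => hz i) hc0,
    E.ord_prod _ _ fun i _ => hz i] at hsum
  have := E.ord_nonneg_of_mem c.2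
  omega

end PrimeDivisorOver

section CoordRing

open MvPolynomial

variable {d r : ℕ} {a : Fin d → ℤ}

theorem muAction_monomial (r : ℕ) (a : Fin d → ℤ) (m : Fin d →₀ ℕ) (c : ℂ) :
    muAction r a (monomial m c) =
      C (Complex.exp (2 * Real.pi * Complex.I / r) ^ (∑ i, a i * m i)) * monomial m c := by
  rw [muAction, aeval_monomial, Finsupp.prod_fintype _ _ (by simp),
    ← prod_zpow_eq_zpow_sum (Complex.exp_ne_zero _), monomial_eq (s := m) (a := c),
    Finsupp.prod_fintype _ _ (by simp)]
  simp only [mul_pow, Finset.prod_mul_distrib, ← map_pow, ← map_prod, algebraMap_eq, zpow_mul,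
    zpow_natCast]
  ring

theorem coeff_muAction (r : ℕ) (a : Fin d → ℤ) (m : Fin d →₀ ℕ) (f : MvPolynomial (Fin d) ℂ) :
    coeff m (muAction r a f) =
      Complex.exp (2 * Real.pi * Complex.I / r) ^ (∑ i, a i * m i) * coeff m f := by
  classical
  induction f using MvPolynomial.induction_on' with
  | monomial n c =>
    rw [muAction_monomial, coeff_C_mul, coeff_monomial]
    split_ifs with h
    · rw [h]
    · rw [mul_zero, mul_zero]
  | add p q hp hq => rw [map_add, coeff_add, coeff_add, hp, hq, mul_add]

theorem mem_coordRing_iff (hr : r ≠ 0) {f : MvPolynomial (Fin d) ℂ} :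
    f ∈ coordRing r a ↔ ∀ m ∈ f.support, (r : ℤ) ∣ ∑ i, a i * m i := by
  rw [coordRing, AlgHom.mem_equalizer, AlgHom.id_apply, MvPolynomial.ext_iff]
  refine forall_congr' fun m => ?_
  rw [coeff_muAction, mem_support_iff, ← (Complex.isPrimitiveRoot_exp r hr).zpow_eq_one_iff_dvd,
    mul_left_eq_self₀, or_comm, or_iff_not_imp_left]

theorem monomial_mem_coordRing (hr : r ≠ 0) {m : Fin d →₀ ℕ} (hm : (r : ℤ) ∣ ∑ i, a i * m i)
    (c : ℂ) : monomial m c ∈ coordRing r a := by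
  classical
  refine (mem_coordRing_iff hr).2 fun m' hm' => ?_
  rwa [Finset.mem_singleton.1 (support_monomial_subset hm')]

/-- The monomial `x ^ m` as an invariant function. -/
def invariantMonomial (hr : r ≠ 0) {m : Fin d →₀ ℕ} (hm : (r : ℤ) ∣ ∑ i, a i * m i) :
    coordRing r a :=
  ⟨monomial m 1, monomial_mem_coordRing hr hm 1⟩

theorem mem_of_forall_invariantMonomial_mem (hr : r ≠ 0) (N : Submodule ℂ (coordRing r a))
    (f : coordRing r a)
    (h : ∀ (m : Fin d →₀ ℕ) (hm : (r : ℤ) ∣ ∑ i, a i * m i),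
      m ∈ (f : MvPolynomial (Fin d) ℂ).support → invariantMonomial hr hm ∈ N) : f ∈ N := by
  have hf := (mem_coordRing_iff hr).1 f.2
  have hsum : f = ∑ m : {m // m ∈ (f : MvPolynomial (Fin d) ℂ).support},
      coeff m.1 (f : MvPolynomial (Fin d) ℂ) • invariantMonomial hr (hf m.1 m.2) := by
    apply Subtype.ext
    simp only [invariantMonomial, AddSubmonoidClass.coe_finsetSum, SetLike.val_smul, smul_monomial,
      smul_eq_mul, mul_one]
    rw [Finset.univ_eq_attach, Finset.sum_attach _ fun m =>
      monomial m (coeff m (f : MvPolynomial (Fin d) ℂ))]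
    exact (f : MvPolynomial (Fin d) ℂ).as_sum
  rw [hsum]
  exact sum_mem fun m _ => N.smul_mem _ (h m.1 (hf m.1 m.2) m.2)

theorem algebraMap_mem_of_forall_invariantMonomial_mem (hr : r ≠ 0) {F : Type*} [Field F]
    [Algebra (coordRing r a) F] [Algebra ℂ F] [IsScalarTower ℂ (coordRing r a) F]
    (S : Subalgebra ℂ F) (h : ∀ (m : Fin d →₀ ℕ) (hm : (r : ℤ) ∣ ∑ i, a i * m i),
      algebraMap (coordRing r a) F (invariantMonomial hr hm) ∈ S) (f : coordRing r a) :
    algebraMap (coordRing r a) F f ∈ S :=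
  mem_of_forall_invariantMonomial_mem hr
    (Subalgebra.toSubmodule (S.comap (IsScalarTower.toAlgHom ℂ (coordRing r a) F))) f
    fun m hm _ => h m hm

theorem mem_coordRing_of_mul_mem {s g : MvPolynomial (Fin d) ℂ} (hs : s ∈ coordRing r a)
    (hs0 : s ≠ 0) (h : s * g ∈ coordRing r a) : g ∈ coordRing r a := by
  rw [coordRing, AlgHom.mem_equalizer, AlgHom.id_apply] at *
  rw [map_mul, hs] at h
  exact mul_left_cancel₀ hs0 h

theorem X_pow_mem_coordRing (hr : r ≠ 0) (i : Fin d) :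
    (X i ^ r : MvPolynomial (Fin d) ℂ) ∈ coordRing r a := by
  rw [X_pow_eq_monomial]
  refine monomial_mem_coordRing hr ?_ 1
  simp [Finsupp.single_apply]

theorem isIntegral_coordRing (hr : r ≠ 0) :
    Algebra.IsIntegral (coordRing r a) (MvPolynomial (Fin d) ℂ) := by
  refine ⟨fun f => ?_⟩
  induction f using MvPolynomial.induction_on with
  | C c => exact isIntegral_algebraMap (x := algebraMap ℂ (coordRing r a) c)
  | add p q hp hq => exact hp.add hq
  | mul_X p i hp =>
    refine hp.mul (IsIntegral.of_pow (Nat.pos_of_ne_zero hr) ?_)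
    exact isIntegral_algebraMap (x := (⟨X i ^ r, X_pow_mem_coordRing hr i⟩ : coordRing r a))

-- By the Artin–Tate lemma the invariant ring is of finite type.
theorem isNoetherianRing_coordRing (hr : r ≠ 0) : IsNoetherianRing (coordRing r a) := by
  have : Algebra.FiniteType (coordRing r a) (MvPolynomial (Fin d) ℂ) :=
    Algebra.FiniteType.of_restrictScalars_finiteType ℂ _ _
  have := isIntegral_coordRing (a := a) hr
  have : Module.Finite (coordRing r a) (MvPolynomial (Fin d) ℂ) := Algebra.IsIntegral.finite
  have : Algebra.FiniteType ℂ (coordRing r a) :=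
    ⟨fg_of_fg_of_fg ℂ (coordRing r a) (MvPolynomial (Fin d) ℂ) Algebra.FiniteType.out
      Module.Finite.fg_top Subtype.val_injective⟩
  exact Algebra.FiniteType.isNoetherianRing ℂ _

theorem isIntegrallyClosed_of_forall_mul_mem {R B : Type*} [CommRing R] [CommRing B] [IsDomain B]
    [IsIntegrallyClosed B] [Algebra R B] (S : Subalgebra R B)
    (h : ∀ s ∈ S, s ≠ 0 → ∀ g, s * g ∈ S → g ∈ S) : IsIntegrallyClosed S := by
  rw [isIntegrallyClosed_iff (FractionRing S)]
  intro x hx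
  let φ : FractionRing S →+* FractionRing B :=
    IsFractionRing.map (j := S.val.toRingHom) Subtype.val_injective
  have hφ (b : S) : φ (algebraMap _ _ b) = algebraMap B _ (b : B) := IsLocalization.map_eq _ b
  obtain ⟨b, s, hs, rfl⟩ := IsFractionRing.div_surjective S x
  have hs0 : (s : B) ≠ 0 := by simpa using nonZeroDivisors.ne_zero hs
  have h_integral := hx.map_of_comp_eq S.val.toRingHom φ (RingHom.ext hφ).symm
  rw [map_div₀, hφ, hφ] at h_integral
  obtain ⟨g, hg⟩ := IsIntegrallyClosed.isIntegral_iff.1 h_integral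
  rw [eq_div_iff (by simpa using hs0), ← map_mul] at hg
  have hgs : g * s = b := IsFractionRing.injective _ _ hg
  refine ⟨⟨g, h s s.2 hs0 g (by rw [mul_comm, hgs]; exact b.2)⟩, ?_⟩
  rw [eq_div_iff (IsLocalization.to_map_ne_zero_of_mem_nonZeroDivisors _ le_rfl hs), ← map_mul]
  exact congrArg _ (Subtype.ext hgs)

theorem isIntegrallyClosed_coordRing : IsIntegrallyClosed (coordRing r a) :=
  isIntegrallyClosed_of_forall_mul_mem _ fun _ hs hs0 _ => mem_coordRing_of_mul_mem hs hs0

theorem originIdeal_isMaximal : (originIdeal r a).IsMaximal := by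
  refine RingHom.ker_isMaximal_of_surjective _ fun c => ⟨algebraMap ℂ _ c, ?_⟩
  exact constantCoeff_C _ c

theorem mem_originIdeal_iff (f : coordRing r a) :
    f ∈ originIdeal r a ↔ constantCoeff (f : MvPolynomial (Fin d) ℂ) = 0 :=
  Iff.rfl

end CoordRing

open MvPolynomial in
/-- Toric coordinates `z i = x i * x i₀ ^ e i` on a cyclic quotient, for an index `i₀` whose weight
is prime to `r`. -/
structure ToricCoordinates {d : ℕ} (r : ℕ) (a : Fin d → ℤ) (i₀ : Fin d) where
  e : Fin d → ℕ
  e_self : e i₀ + 1 = r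
  dvd : ∀ i, (r : ℤ) ∣ a i + e i * a i₀
  isCoprime : IsCoprime (r : ℤ) (a i₀)
  z : Fin d → coordRing r a
  coe_z : ∀ i, (z i : MvPolynomial (Fin d) ℂ) = X i * X i₀ ^ e i

theorem exists_nat_dvd_add_mul {r : ℕ} (hr : r ≠ 0) {b : ℤ} (h : IsCoprime (r : ℤ) b) (a : ℤ) :
    ∃ e : ℕ, (r : ℤ) ∣ a + e * b := by
  obtain ⟨u, v, huv⟩ := h
  refine ⟨(-(v * a) % r).toNat, ?_⟩
  rw [Int.toNat_of_nonneg (Int.emod_nonneg _ (by exact_mod_cast hr))]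
  refine ⟨u * a - -(v * a) / r * b, ?_⟩
  linear_combination b * Int.emod_add_mul_ediv (-(v * a)) r - a * huv

namespace ToricCoordinates

open MvPolynomial

variable {d r : ℕ} {a : Fin d → ℤ} {i₀ : Fin d}

theorem nonempty (hr : r ≠ 0) (h : IsCoprime (r : ℤ) (a i₀)) :
    Nonempty (ToricCoordinates r a i₀) := by
  have hexp (i : Fin d) : ∃ e : ℕ, (i = i₀ → e + 1 = r) ∧ (r : ℤ) ∣ a i + e * a i₀ := by
    by_cases hi : i = i₀
    · refine ⟨r - 1, fun _ => by omega, a i, ?_⟩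
      rw [hi, Nat.cast_pred (Nat.pos_of_ne_zero hr)]
      ring
    · obtain ⟨e, he⟩ := exists_nat_dvd_add_mul hr h (a i)
      exact ⟨e, fun h => absurd h hi, he⟩
  choose e he_self he using hexp
  have hz (i : Fin d) : (X i * X i₀ ^ e i : MvPolynomial (Fin d) ℂ) ∈ coordRing r a := by
    rw [X_pow_eq_monomial, X, monomial_mul]
    refine monomial_mem_coordRing hr ?_ _
    simpa [Finsupp.single_apply, mul_add, Finset.sum_add_distrib, mul_comm] using he i
  exact ⟨⟨e, he_self i₀ rfl, he, h, fun i => ⟨_, hz i⟩, fun _ => rfl⟩⟩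

variable (c : ToricCoordinates r a i₀)

include c in
theorem r_ne_zero : r ≠ 0 :=
  c.e_self ▸ Nat.succ_ne_zero _

theorem coe_z_self : (c.z i₀ : MvPolynomial (Fin d) ℂ) = X i₀ ^ r := by
  rw [c.coe_z, ← pow_succ', c.e_self]

theorem z_ne_zero (i : Fin d) : c.z i ≠ 0 := by
  intro h
  have hX : X i * X i₀ ^ c.e i = (0 : MvPolynomial (Fin d) ℂ) :=
    (c.coe_z i).symm.trans (congrArg Subtype.val h)
  exact mul_ne_zero (X_ne_zero i) (pow_ne_zero _ (X_ne_zero i₀)) hX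

/-- The invariant function `x i ^ r`. -/
def xPow (i : Fin d) : coordRing r a := ⟨X i ^ r, X_pow_mem_coordRing c.r_ne_zero i⟩

theorem xPow_ne_zero (i : Fin d) : c.xPow i ≠ 0 := fun h =>
  pow_ne_zero r (X_ne_zero i) (congrArg Subtype.val h)

theorem z_pow (i : Fin d) : c.z i ^ r = c.xPow i * c.z i₀ ^ c.e i := by
  apply Subtype.ext
  push_cast
  rw [c.coe_z, c.coe_z_self, xPow]
  ring

theorem dvd_sum_e {m : Fin d →₀ ℕ} (hm : (r : ℤ) ∣ ∑ i, a i * m i) :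
    (r : ℤ) ∣ ∑ i, (c.e i : ℤ) * m i := by
  refine c.isCoprime.dvd_of_dvd_mul_left ?_
  have h_split : a i₀ * ∑ i, (c.e i : ℤ) * m i =
      ∑ i, (a i + c.e i * a i₀) * m i - ∑ i, a i * m i := by
    rw [Finset.mul_sum, ← Finset.sum_sub_distrib]
    exact Finset.sum_congr rfl fun i _ => by ring
  rw [h_split]
  exact dvd_sub (Finset.dvd_sum fun i _ => (c.dvd i).mul_right _) hm

theorem invariantMonomial_mul_z_pow {m : Fin d →₀ ℕ} (hm : (r : ℤ) ∣ ∑ i, a i * m i) {l : ℕ}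
    (hl : ∑ i, c.e i * m i = r * l) :
    invariantMonomial c.r_ne_zero hm * c.z i₀ ^ l = ∏ i, c.z i ^ m i := by
  apply Subtype.ext
  push_cast
  change monomial m 1 * _ = _
  rw [c.coe_z_self, ← pow_mul, ← hl, monomial_eq,
    Finsupp.prod_fintype _ _ (by simp), ← Finset.prod_pow_eq_pow_sum, map_one, one_mul,
    ← Finset.prod_mul_distrib]
  refine Finset.prod_congr rfl fun i _ => ?_
  rw [c.coe_z, mul_pow, ← pow_mul]

section Field

variable (F : Type*) [Field F] [Algebra (coordRing r a) F]

/-- The coordinates as rational functions. -/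
def zF (i : Fin d) : F := algebraMap (coordRing r a) F (c.z i)

variable [IsFractionRing (coordRing r a) F]

theorem zF_ne_zero (i : Fin d) : c.zF F i ≠ 0 := by
  rw [zF, Ne, IsFractionRing.to_map_eq_zero_iff]
  exact c.z_ne_zero i

theorem algebraMap_invariantMonomial {m : Fin d →₀ ℕ} (hm : (r : ℤ) ∣ ∑ i, a i * m i) :
    ∃ l : ℤ, ∑ i, (c.e i : ℤ) * m i = r * l ∧ 0 ≤ l ∧
      algebraMap (coordRing r a) F (invariantMonomial c.r_ne_zero hm) =
        ∏ i, c.zF F i ^ ((m i : ℤ) - if i = i₀ then l else 0) := by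
  have hr : (0 : ℤ) < r := by exact_mod_cast Nat.pos_of_ne_zero c.r_ne_zero
  obtain ⟨l, hl⟩ := c.dvd_sum_e hm
  have hl0 : 0 ≤ l :=
    nonneg_of_mul_nonneg_right (hl ▸ Finset.sum_nonneg fun i _ => by positivity) hr
  lift l to ℕ using hl0
  refine ⟨l, hl, by positivity, ?_⟩
  have h_prod : ∏ i, c.zF F i ^ ((m i : ℤ) - if i = i₀ then (l : ℤ) else 0) =
      (∏ i, c.zF F i ^ m i) / c.zF F i₀ ^ l := by
    simp [zpow_sub₀ (c.zF_ne_zero F _), Finset.prod_div_distrib]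
  rw [h_prod, eq_div_iff (pow_ne_zero _ (c.zF_ne_zero F _))]
  simpa only [zF, map_mul, map_pow, map_prod] using congrArg (algebraMap (coordRing r a) F)
    (c.invariantMonomial_mul_z_pow hm (by exact_mod_cast hl))

end Field

end ToricCoordinates

namespace UnimodularColumn

variable {ι : Type*} [Fintype ι] [DecidableEq ι] {w : ι → ℤ} {i₀ : ι} (u : UnimodularColumn w i₀)

theorem g_dvd (j : ι) : u.g ∣ w j :=
  ⟨_, (u.g_mul_U j).symm⟩

theorem sum_V_mul (i : ι) : ∑ j, u.V i j * w j = if i = i₀ then u.g else 0 := by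
  have hVU : ∑ j, u.V i j * w j = u.g * (u.V * u.U) i i₀ := by
    rw [Matrix.mul_apply, Finset.mul_sum]
    exact Finset.sum_congr rfl fun j _ => by rw [← u.g_mul_U j]; ring
  rw [hVU, u.V_mul_U, Matrix.one_apply, mul_ite, mul_one, mul_zero]

theorem dvd_g {q : ℤ} (hq : ∀ j, q ∣ w j) : q ∣ u.g := by
  rw [← if_pos (rfl : i₀ = i₀) (t := u.g) (e := 0), ← u.sum_V_mul]
  exact Finset.dvd_sum fun j _ => (hq j).mul_left _

theorem eq_mul_g {r : ℤ} (hr : 0 < r) {e : ι → ℤ} (hw : ∀ j, j ≠ i₀ → r * w j = e j * w i₀)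
    {i₁ : ι} (hi : i₁ ≠ i₀) (hcop : IsCoprime r (e i₁)) (h0 : 0 < w i₀) : w i₀ = r * u.g := by
  obtain ⟨q, hq⟩ : r ∣ w i₀ := hcop.dvd_of_dvd_mul_left ⟨w i₁, (hw i₁ hi).symm⟩
  have hq0 : 0 < q := pos_of_mul_pos_right (hq ▸ h0) hr.le
  have hwq : ∀ j, j ≠ i₀ → w j = e j * q := fun j hj =>
    mul_left_cancel₀ hr.ne' (by rw [hw j hj, hq]; ring)
  have hqg : q ∣ u.g := u.dvd_g fun j => by
    by_cases hj : j = i₀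
    · exact hj ▸ ⟨r, by rw [hq, mul_comm]⟩
    · exact ⟨e j, by rw [hwq j hj, mul_comm]⟩
  have hgq : u.g ∣ q := by
    obtain ⟨s, t, hst⟩ := hcop
    have hcomb : q = s * w i₀ + t * w i₁ := by
      rw [hq, hwq i₁ hi]
      linear_combination -q * hst
    exact hcomb ▸ dvd_add ((u.g_dvd i₀).mul_left s) ((u.g_dvd i₁).mul_left t)
  rw [hq, Int.dvd_antisymm hq0.le u.g_pos.le hqg hgq]

end UnimodularColumn

namespace PrimeDivisorOver

variable {A : Type*} [CommRing A] {F : Type*} [Field F] [Algebra A F]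

theorem ord_prod_zpow (E : PrimeDivisorOver A F) {ι : Type*} [Fintype ι] {z : ι → F}
    (hz : ∀ i, z i ≠ 0) (k : ι → ℤ) : E.ord (∏ j, z j ^ k j) = ∑ j, k j * E.ord (z j) := by
  simp only [E.ord_prod _ _ fun j _ => zpow_ne_zero (k j) (hz j), ord_zpow]

theorem ord_monomialTransform_V (E : PrimeDivisorOver A F) {ι : Type*} [Fintype ι] [DecidableEq ι]
    {z : ι → F} (hz : ∀ i, z i ≠ 0) {i₀ : ι} (u : UnimodularColumn (fun j => E.ord (z j)) i₀)
    (i : ι) : E.ord (monomialTransform u.V z i) = if i = i₀ then u.g else 0 :=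
  (E.ord_prod_zpow hz _).trans (u.sum_V_mul i)

variable [Algebra ℂ A] [Algebra ℂ F] [IsScalarTower ℂ A F] {n : ℕ}

theorem zpow_mem_coordSubalgebra (E : PrimeDivisorOver A F) (t : Fin n → F) {i : Fin n}
    (hi : E.ord (t i) = 0) (k : ℤ) : t i ^ k ∈ E.coordSubalgebra t := by
  have h_mem : t i ∈ E.coordSubalgebra t :=
    E.mem_coordSubalgebra_self t (E.mem_of_ord_nonneg hi.ge)
  have h_inv_mem : (t i)⁻¹ ∈ E.coordSubalgebra t :=
    E.inv_mem_coordSubalgebra t h_mem (E.mem_of_ord_nonneg (by rw [ord_inv, hi, neg_zero]))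
  obtain ⟨k, rfl | rfl⟩ := k.eq_nat_or_neg
  · rw [zpow_natCast]
    exact pow_mem h_mem k
  · rw [zpow_neg, zpow_natCast, ← inv_pow]
    exact pow_mem h_inv_mem k

theorem prod_zpow_mem_coordSubalgebra (E : PrimeDivisorOver A F) {z : Fin n → F}
    (hz : ∀ i, z i ≠ 0) {i₀ : Fin n} (u : UnimodularColumn (fun j => E.ord (z j)) i₀)
    (k : Fin n → ℤ) (hk : 0 ≤ E.ord (∏ j, z j ^ k j)) :
    ∏ j, z j ^ k j ∈ E.coordSubalgebra (monomialTransform u.V z) := by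
  have hord := E.ord_monomialTransform_V hz u
  rw [E.ord_prod_zpow hz, ← u.g_mul_vecMul] at hk
  have hk0 : 0 ≤ (k ᵥ* u.U) i₀ := nonneg_of_mul_nonneg_right hk u.g_pos
  rw [u.prod_zpow_eq hz]
  refine prod_mem fun i _ => ?_
  by_cases hi : i = i₀
  · subst hi
    lift (k ᵥ* u.U) i to ℕ using hk0 with q
    rw [zpow_natCast]
    refine pow_mem (E.mem_coordSubalgebra_self _ (E.mem_of_ord_nonneg ?_)) q
    rw [hord, if_pos rfl]
    exact u.g_pos.le
  · exact E.zpow_mem_coordSubalgebra _ (by rw [hord, if_neg hi]) _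

theorem formHasOrd_of_coordSubalgebra (E : PrimeDivisorOver A F) {z : Fin n → F}
    (hz : ∀ i, z i ≠ 0) {i₀ : Fin n} (u : UnimodularColumn (fun j => E.ord (z j)) i₀)
    (h : ∀ f ∈ E.ring, f ∈ E.coordSubalgebra (monomialTransform u.V z)) :
    E.FormHasOrd (exteriorPower.ιMulti F n fun i => KaehlerDifferential.D ℂ F (z i))
      (∑ i, E.ord (z i) - u.g) := by
  set y := monomialTransform u.V z
  have hy0 : ∀ i, y i ≠ 0 := monomialTransform_ne_zero u.V hz
  have hord : ∀ i, E.ord (y i) = if i = i₀ then u.g else 0 := E.ord_monomialTransform_V hz u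
  have hdet : IsUnit (u.U.det : E.ring) := u.isUnit_det.map (Int.castRingHom E.ring)
  have hdet0 : (u.U.det : F) ≠ 0 := (u.isUnit_det.map (Int.castRingHom F)).ne_zero
  have horddet : E.ord (u.U.det : F) = 0 := by simpa using E.ord_eq_zero_of_isUnit hdet
  have hz0 : ∏ j, z j ≠ 0 := Finset.prod_ne_zero_iff.2 fun j _ => hz j
  have hyinv0 : (∏ j, y j)⁻¹ ≠ 0 := inv_ne_zero (Finset.prod_ne_zero_iff.2 fun j _ => hy0 j)
  have hform := ιMulti_D_monomialTransform (K := ℂ) u.U hy0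
  rw [u.monomialTransform_V hz] at hform
  refine ⟨_, _, mul_ne_zero (mul_ne_zero hz0 hyinv0) hdet0,
    E.regularForms_eq_span y (fun i => E.mem_of_ord_nonneg ?_) h, hform, ?_⟩
  · rw [hord]
    split_ifs
    exacts [u.g_pos.le, le_rfl]
  · rw [E.ord_mul (mul_ne_zero hz0 hyinv0) hdet0, E.ord_mul hz0 hyinv0, ord_inv, horddet,
      E.ord_prod _ _ fun i _ => hz i, E.ord_prod _ _ fun i _ => hy0 i]
    simp only [hord, Finset.sum_ite_eq', Finset.mem_univ, if_true]
    ring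

theorem mem_coordSubalgebra_of_height_center_eq_one [IsNoetherianRing A] [IsIntegrallyClosed A]
    [IsFractionRing A F] (D : PrimeDivisorOver A F) (hD : D.center.height = 1) (t : Fin n → F)
    (ht : ∀ f, algebraMap A F f ∈ D.coordSubalgebra t) : ∀ f ∈ D.ring, f ∈ D.coordSubalgebra t := by
  have : FaithfulSMul A F := IsFractionRing.instFaithfulSMul _ _
  refine D.mem_coordSubalgebra_of_fractions t fun f hf => ?_
  obtain ⟨b, s, hs, rfl⟩ := (D.mem_ring_iff_of_height_center_eq_one hD f).1 hf
  refine ⟨_, _, ht b, ht s, D.mem_of_ord_nonneg ?_, rfl⟩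
  rw [D.ord_inv, D.ord_algebraMap_eq_zero hs, neg_zero]

end PrimeDivisorOver

section Hyperplane

open MvPolynomial

variable {d r : ℕ} {a : Fin d → ℤ}

/-- The ideal of the image of the hyperplane `x i₀ = 0` in the cyclic quotient. -/
def hyperplaneIdeal (r : ℕ) (a : Fin d → ℤ) (i₀ : Fin d) : Ideal (coordRing r a) :=
  (Ideal.span {(X i₀ : MvPolynomial (Fin d) ℂ)}).comap (coordRing r a).val.toRingHom

theorem mem_hyperplaneIdeal_iff {i₀ : Fin d} {f : coordRing r a} :
    f ∈ hyperplaneIdeal r a i₀ ↔ X i₀ ∣ (f : MvPolynomial (Fin d) ℂ) :=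
  Ideal.mem_span_singleton

theorem hyperplaneIdeal_isPrime (i₀ : Fin d) : (hyperplaneIdeal r a i₀).IsPrime :=
  have : (Ideal.span {(X i₀ : MvPolynomial (Fin d) ℂ)}).IsPrime :=
    (Ideal.span_singleton_prime (X_ne_zero i₀)).2 X_prime
  Ideal.comap_isPrime _ _

end Hyperplane

namespace ToricCoordinates

open MvPolynomial

variable {d r : ℕ} {a : Fin d → ℤ} {i₀ : Fin d} (c : ToricCoordinates r a i₀)

theorem xPow_notMem_hyperplaneIdeal {j : Fin d} (hj : j ≠ i₀) :
    c.xPow j ∉ hyperplaneIdeal r a i₀ := by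
  rw [mem_hyperplaneIdeal_iff]
  intro h
  exact hj (X_dvd_X.1 ((X_prime (R := ℂ) (i := i₀)).dvd_of_dvd_pow (h : X i₀ ∣ X j ^ r))).symm

theorem hyperplaneIdeal_le (p : Ideal (coordRing r a)) [hp : p.IsPrime] (hz : c.z i₀ ∈ p) :
    hyperplaneIdeal r a i₀ ≤ p := by
  intro f hf
  obtain ⟨f', hf'⟩ := mem_hyperplaneIdeal_iff.1 hf
  have hpow : (f : MvPolynomial (Fin d) ℂ) ^ r = c.z i₀ * f' ^ r := by
    rw [c.coe_z_self, ← mul_pow, ← hf']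
  have h_mem : f' ^ r ∈ coordRing r a :=
    mem_coordRing_of_mul_mem (c.z i₀).2 (by simpa using c.z_ne_zero i₀) (hpow ▸ pow_mem f.2 r)
  have hfr : f ^ r = c.z i₀ * ⟨f' ^ r, h_mem⟩ := Subtype.ext hpow
  exact hp.mem_of_pow_mem r (hfr ▸ p.mul_mem_right _ hz)

theorem eq_hyperplaneIdeal_of_height_eq_one (p : Ideal (coordRing r a)) [p.IsPrime]
    (hp : p.height = 1) (hz : c.z i₀ ∈ p) : p = hyperplaneIdeal r a i₀ := by
  have := isNoetherianRing_coordRing (a := a) c.r_ne_zero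
  have := hyperplaneIdeal_isPrime (r := r) (a := a) i₀
  by_contra hne
  have hlt := Ideal.height_strict_mono_of_isPrime
    (lt_of_le_of_ne (c.hyperplaneIdeal_le p hz) (Ne.symm hne))
  rw [hp, Order.lt_one_iff, Ideal.height_eq_zero_iff_eq_bot] at hlt
  have hz_mem : c.z i₀ ∈ hyperplaneIdeal r a i₀ := by
    rw [mem_hyperplaneIdeal_iff, c.coe_z_self]
    exact dvd_pow_self _ c.r_ne_zero
  rw [hlt, Ideal.mem_bot] at hz_mem
  exact c.z_ne_zero i₀ hz_mem

theorem isCoprime_e {i₁ : Fin d} (hcop : IsCoprime (r : ℤ) (a i₁)) :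
    IsCoprime (r : ℤ) (c.e i₁) := by
  obtain ⟨q, hq⟩ := c.dvd i₁
  have hmul : (c.e i₁ * a i₀ : ℤ) = -a i₁ + r * q := by linear_combination hq
  exact IsCoprime.of_mul_right_left (hmul ▸ hcop.neg_right.add_mul_left_right q)

variable {F : Type*} [Field F] [Algebra (coordRing r a) F] [IsFractionRing (coordRing r a) F]

theorem mul_ord_zF (E : PrimeDivisorOver (coordRing r a) F) (i : Fin d) :
    r * E.ord (c.zF F i) = E.ord (algebraMap _ F (c.xPow i)) + c.e i * E.ord (c.zF F i₀) := by
  have hpow : c.zF F i ^ r = algebraMap _ F (c.xPow i) * c.zF F i₀ ^ c.e i := by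
    simpa only [zF, map_mul, map_pow] using congrArg (algebraMap (coordRing r a) F) (c.z_pow i)
  have hx : algebraMap (coordRing r a) F (c.xPow i) ≠ 0 := by
    rw [Ne, IsFractionRing.to_map_eq_zero_iff]
    exact c.xPow_ne_zero i
  rw [← E.ord_pow, hpow, E.ord_mul hx (pow_ne_zero _ (c.zF_ne_zero F i₀)), E.ord_pow]

variable [Algebra ℂ F] [IsScalarTower ℂ (coordRing r a) F]

variable (F) in
/-- The form `dz_1 ∧ … ∧ dz_d`. -/
def form : ⋀[F]^d Ω[F⁄ℂ] :=
  exteriorPower.ιMulti F d fun i => KaehlerDifferential.D ℂ F (c.zF F i)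

theorem mem_coordSubalgebra_of_forall_invariantMonomial (D : PrimeDivisorOver (coordRing r a) F)
    (hD : D.center.height = 1) (t : Fin d → F)
    (h : ∀ (m : Fin d →₀ ℕ) (hm : (r : ℤ) ∣ ∑ i, a i * m i),
      algebraMap _ F (invariantMonomial c.r_ne_zero hm) ∈ D.coordSubalgebra t) :
    ∀ f ∈ D.ring, f ∈ D.coordSubalgebra t := by
  have := isNoetherianRing_coordRing (a := a) c.r_ne_zero
  have := isIntegrallyClosed_coordRing (r := r) (a := a)
  exact D.mem_coordSubalgebra_of_height_center_eq_one hD t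
    (algebraMap_mem_of_forall_invariantMonomial_mem c.r_ne_zero _ h)

theorem formHasOrd_zero_of_notMem_center (D : PrimeDivisorOver (coordRing r a) F)
    (hD : D.center.height = 1) (hz : c.z i₀ ∉ D.center) : D.FormHasOrd (c.form F) 0 := by
  have : FaithfulSMul (coordRing r a) F := IsFractionRing.instFaithfulSMul _ _
  have hmem : ∀ i, c.zF F i ∈ D.ring := fun i => D.algebraMap_mem _
  refine ⟨c.form F, 1, one_ne_zero, D.regularForms_eq_span (c.zF F) hmem
    (c.mem_coordSubalgebra_of_forall_invariantMonomial D hD _ fun m hm => ?_),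
    (one_smul F _).symm, D.ord_one⟩
  obtain ⟨l, -, -, hl⟩ := c.algebraMap_invariantMonomial F hm
  rw [hl]
  refine prod_mem fun i _ => ?_
  by_cases hi : i = i₀
  · have hord : D.ord (c.zF F i₀) = 0 := D.ord_algebraMap_eq_zero hz
    rw [hi]
    exact D.zpow_mem_coordSubalgebra (c.zF F) hord _
  · rw [if_neg hi, sub_zero, zpow_natCast]
    exact pow_mem (D.mem_coordSubalgebra_self _ (hmem i)) _

theorem formHasOrd_of_height_eq_one (D : PrimeDivisorOver (coordRing r a) F)
    (hD : D.center.height = 1) (u : UnimodularColumn (fun j => D.ord (c.zF F j)) i₀) :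
    D.FormHasOrd (c.form F) (∑ i, D.ord (c.zF F i) - u.g) := by
  refine D.formHasOrd_of_coordSubalgebra (c.zF_ne_zero F) u
    (c.mem_coordSubalgebra_of_forall_invariantMonomial D hD _ fun m hm => ?_)
  obtain ⟨l, -, -, hl⟩ := c.algebraMap_invariantMonomial F hm
  rw [hl]
  refine D.prod_zpow_mem_coordSubalgebra (c.zF_ne_zero F) u _ ?_
  rw [← hl]
  exact D.ord_algebraMap_nonneg _

/-- As `a i₁` is prime to `r`, the group `μ_r` acts freely at the generic point of the hyperplane
`x i₀ = 0`, so that `x i₀ ^ r` vanishes to order `r` along its image. -/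
theorem exists_formHasOrd_of_height_eq_one {i₁ : Fin d} (hi : i₁ ≠ i₀)
    (hcop : IsCoprime (r : ℤ) (a i₁)) (D : PrimeDivisorOver (coordRing r a) F)
    (hD : D.center.height = 1) :
    ∃ k : ℤ, D.FormHasOrd (c.form F) k ∧ r * k = (∑ i, (c.e i : ℤ)) * D.ord (c.zF F i₀) := by
  have : FaithfulSMul (coordRing r a) F := IsFractionRing.instFaithfulSMul _ _
  by_cases hz : c.z i₀ ∈ D.center
  swap
  · have hord : D.ord (c.zF F i₀) = 0 := D.ord_algebraMap_eq_zero hz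
    exact ⟨0, c.formHasOrd_zero_of_notMem_center D hD hz, by rw [hord, mul_zero, mul_zero]⟩
  have hprime := D.center_isPrime
  have hx : ∀ j, j ≠ i₀ → r * D.ord (c.zF F j) = c.e j * D.ord (c.zF F i₀) := fun j hj => by
    have hj_mem : c.xPow j ∉ D.center :=
      c.eq_hyperplaneIdeal_of_height_eq_one D.center hD hz ▸ c.xPow_notMem_hyperplaneIdeal hj
    rw [c.mul_ord_zF D j, D.ord_algebraMap_eq_zero hj_mem, zero_add]
  have hpos : 0 < D.ord (c.zF F i₀) := (D.ord_algebraMap_pos_iff (c.z_ne_zero i₀)).2 hz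
  obtain ⟨u⟩ := UnimodularColumn.nonempty (w := fun j => D.ord (c.zF F j))
    (fun h => hpos.ne' (congrFun h i₀)) i₀
  refine ⟨_, c.formHasOrd_of_height_eq_one D hD u, ?_⟩
  have hg : D.ord (c.zF F i₀) = r * u.g :=
    u.eq_mul_g (by exact_mod_cast Nat.pos_of_ne_zero c.r_ne_zero) hx hi (c.isCoprime_e hcop) hpos
  have hsum : ∀ j, r * D.ord (c.zF F j) =
      c.e j * D.ord (c.zF F i₀) + if j = i₀ then r * u.g else 0 := fun j => by
    split_ifs with hj
    · have he : (c.e i₀ : ℤ) + 1 = r := by exact_mod_cast c.e_self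
      rw [hj, ← hg, ← he]
      ring
    · rw [add_zero, hx j hj]
  rw [mul_sub, Finset.mul_sum, Finset.sum_congr rfl fun j _ => hsum j, Finset.sum_add_distrib,
    ← Finset.sum_mul, Finset.sum_ite_eq' Finset.univ i₀, if_pos (Finset.mem_univ _),
    add_sub_cancel_right]

end ToricCoordinates

section RationalForms

variable {K F ι : Type*} [Field K] [Field F] [Algebra K F]

theorem span_range_D_eq_top {z : ι → F} (hz : IntermediateField.adjoin K (Set.range z) = ⊤) :
    Submodule.span F (Set.range fun i => KaehlerDifferential.D K F (z i)) = ⊤ := by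
  rw [eq_top_iff, ← KaehlerDifferential.span_range_derivation, Submodule.span_le]
  rintro _ ⟨f, rfl⟩
  have hf : f ∈ IntermediateField.adjoin K (Set.range z) := hz ▸ IntermediateField.mem_top
  rw [SetLike.mem_coe]
  induction hf using IntermediateField.adjoin_induction with
  | mem f hf =>
    obtain ⟨i, rfl⟩ := hf
    exact Submodule.subset_span ⟨i, rfl⟩
  | algebraMap t => simp only [Derivation.map_algebraMap, zero_mem]
  | add f g _ _ hf hg => simpa only [map_add] using add_mem hf hg
  | inv f _ hf =>
    rw [Derivation.leibniz_inv]
    exact Submodule.smul_mem _ _ hf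
  | mul f g _ _ hf hg =>
    rw [Derivation.leibniz]
    exact add_mem (Submodule.smul_mem _ _ hg) (Submodule.smul_mem _ _ hf)

theorem span_singleton_ιMulti_eq_top {R V : Type*} [CommRing R] [AddCommGroup V] [Module R V]
    {n : ℕ} {v : Fin n → V} (hv : Submodule.span R (Set.range v) = ⊤) :
    Submodule.span R {exteriorPower.ιMulti R n v} = ⊤ := by
  rw [eq_top_iff, ← exteriorPower.ιMulti_span, Submodule.span_le]
  rintro _ ⟨w, rfl⟩
  have hw : ∀ j, ∃ M : Fin n → R, ∑ i, M i • v i = w j := fun j =>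
    (Submodule.mem_span_range_iff_exists_fun R).1 (hv ▸ Submodule.mem_top)
  choose M hM using hw
  have hwM : w = fun j => ∑ i, Matrix.of M j i • v i := funext fun j => (hM j).symm
  rw [hwM, alternatingMap_sum_smul]
  exact Submodule.smul_mem _ _ (Submodule.mem_span_singleton_self _)

theorem isFractionRing_of_algebraicIndependent [Algebra (MvPolynomial ι K) F]
    [IsScalarTower K (MvPolynomial ι K) F]
    (hind : AlgebraicIndependent K fun i => algebraMap (MvPolynomial ι K) F (MvPolynomial.X i))
    (hgen : IntermediateField.adjoin K
      (Set.range fun i => algebraMap (MvPolynomial ι K) F (MvPolynomial.X i)) = ⊤) :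
    IsFractionRing (MvPolynomial ι K) F := by
  have haeval : ∀ p, MvPolynomial.aeval (fun i => algebraMap (MvPolynomial ι K) F
      (MvPolynomial.X i)) p = algebraMap (MvPolynomial ι K) F p := fun p =>
    (DFunLike.congr_fun (MvPolynomial.aeval_unique (IsScalarTower.toAlgHom K _ F)) p).symm
  have : FaithfulSMul (MvPolynomial ι K) F :=
    (faithfulSMul_iff_algebraMap_injective _ _).2 fun p q h =>
      hind (by rwa [haeval, haeval])
  refine IsFractionRing.of_field _ _ fun f => ?_
  obtain ⟨p, q, h⟩ := (IntermediateField.mem_adjoin_range_iff K _ f).1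
    (hgen ▸ IntermediateField.mem_top)
  exact ⟨p, q, by rw [h, haeval, haeval]⟩

theorem ιMulti_D_ne_zero {n : ℕ} {z : Fin n → F} (hind : AlgebraicIndependent K z)
    (hgen : IntermediateField.adjoin K (Set.range z) = ⊤) :
    exteriorPower.ιMulti F n (fun i => KaehlerDifferential.D K F (z i)) ≠ 0 := by
  let coeffAlgebra : Algebra (MvPolynomial (Fin n) K) F := (MvPolynomial.aeval z).toAlgebra
  have hX : (fun i => algebraMap (MvPolynomial (Fin n) K) F (MvPolynomial.X i)) = z := by
    funext i
    rw [RingHom.algebraMap_toAlgebra]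
    exact MvPolynomial.aeval_X z i
  have : IsScalarTower K (MvPolynomial (Fin n) K) F :=
    IsScalarTower.of_algebraMap_eq fun t => ((MvPolynomial.aeval z).commutes t).symm
  have : IsFractionRing (MvPolynomial (Fin n) K) F :=
    isFractionRing_of_algebraicIndependent (by rwa [hX]) (by rwa [hX])
  let b : Module.Basis (Fin n) F (Ω[F⁄K]) :=
    (KaehlerDifferential.mvPolynomialBasis K (Fin n)).ofIsLocalizedModule F
      (nonZeroDivisors (MvPolynomial (Fin n) K))
      (KaehlerDifferential.map K K (MvPolynomial (Fin n) K) F)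
  have hb : (fun i => KaehlerDifferential.D K F (z i)) = b := funext fun i => by
    simp only [b, Module.Basis.ofIsLocalizedModule_apply,
      KaehlerDifferential.mvPolynomialBasis_apply, KaehlerDifferential.map_D, ← hX]
  intro h
  have hdet := congrArg (exteriorPower.alternatingMapLinearEquiv b.det) h
  rw [hb, exteriorPower.alternatingMapLinearEquiv_apply_ιMulti, b.det_self, map_zero] at hdet
  exact one_ne_zero hdet

end RationalForms

section LaurentMonomials

open MvPolynomial

theorem algebraicIndependent_iff_linearIndependent_prod_pow {K A ι : Type*} [CommRing K]
    [CommRing A] [Algebra K A] [Fintype ι] {z : ι → A} :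
    AlgebraicIndependent K z ↔ LinearIndependent K fun m : ι →₀ ℕ => ∏ i, z i ^ m i := by
  have hbasis : (fun m : ι →₀ ℕ => ∏ i, z i ^ m i) =
      (aeval (R := K) z).toLinearMap ∘ basisMonomials ι K := funext fun m => by
    rw [Function.comp_apply, coe_basisMonomials, AlgHom.toLinearMap_apply, aeval_monomial, map_one,
      one_mul, Finsupp.prod_fintype _ _ fun i => pow_zero _]
  rw [hbasis]
  constructor
  · intro h
    exact (basisMonomials ι K).linearIndependent.map' _ (LinearMap.ker_eq_bot.2 h)
  · intro h p q hpq
    have hcomb : ∀ p : MvPolynomial ι K, Finsupp.linearCombination K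
        ((aeval (R := K) z).toLinearMap ∘ basisMonomials ι K) ((basisMonomials ι K).repr p) =
          aeval z p := fun p => by
      rw [← Finsupp.apply_linearCombination, Module.Basis.linearCombination_repr,
        AlgHom.toLinearMap_apply]
    exact (basisMonomials ι K).repr.injective (h (by rw [hcomb, hcomb]; exact hpq))

variable {K F ι : Type*} [Field K] [Field F] [Algebra K F] [Fintype ι] {z : ι → F}

theorem linearIndependent_prod_zpow (hz : AlgebraicIndependent K z) :
    LinearIndependent K fun k : ι → ℤ => ∏ i, z i ^ k i := by
  rw [linearIndependent_iff_finset_linearIndependent]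
  intro s
  obtain ⟨N, hN⟩ := s.bddBelow
  let T : s → ι →₀ ℕ := fun k => Finsupp.equivFunOnFinite.symm fun i => (k.1 i - N i).toNat
  have hT : ∀ k i, (T k i : ℤ) = k.1 i - N i := fun k i =>
    Int.toNat_of_nonneg (sub_nonneg.2 (hN k.2 i))
  have hT_inj : Function.Injective T := fun k l h => Subtype.ext <| funext fun i => by
    have hi : (T k i : ℤ) = T l i := by rw [h]
    rw [hT, hT] at hi
    exact sub_left_injective hi
  have hshift : LinearMap.mulLeft K (∏ i, z i ^ (-N i)) ∘ (fun k : s => ∏ i, z i ^ k.1 i) =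
      (fun m : ι →₀ ℕ => ∏ i, z i ^ m i) ∘ T := funext fun k => by
    simp only [Function.comp_apply, LinearMap.mulLeft_apply, ← Finset.prod_mul_distrib]
    refine Finset.prod_congr rfl fun i _ => ?_
    rw [← zpow_add₀ (hz.ne_zero i), ← zpow_natCast, hT, neg_add_eq_sub]
  refine LinearIndependent.of_comp (LinearMap.mulLeft K (∏ i, z i ^ (-N i))) ?_
  exact hshift ▸ (algebraicIndependent_iff_linearIndependent_prod_pow.1 hz).comp T hT_inj

variable [DecidableEq ι] {U V : Matrix ι ι ℤ}

theorem algebraicIndependent_monomialTransform (hVU : V * U = 1) (hz : AlgebraicIndependent K z) :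
    AlgebraicIndependent K (monomialTransform V z) := by
  have hinj : Function.Injective fun (m : ι →₀ ℕ) => (fun i => (m i : ℤ)) ᵥ* V := fun m n h => by
    have hU := congrArg (· ᵥ* U) h
    simp only [Matrix.vecMul_vecMul, hVU, Matrix.vecMul_one] at hU
    exact Finsupp.ext fun i => by exact_mod_cast congrFun hU i
  have hprod : (fun m : ι →₀ ℕ => ∏ i, monomialTransform V z i ^ m i) =
      (fun k : ι → ℤ => ∏ i, z i ^ k i) ∘ fun m => (fun i => (m i : ℤ)) ᵥ* V := funext fun m => by
    simp only [Function.comp_apply, ← prod_monomialTransform_zpow V fun j => hz.ne_zero j,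
      zpow_natCast]
  rw [algebraicIndependent_iff_linearIndependent_prod_pow]
  exact hprod ▸ (linearIndependent_prod_zpow hz).comp _ hinj

theorem adjoin_range_monomialTransform_eq_top (hUV : U * V = 1) (hz : ∀ j, z j ≠ 0)
    (hgen : IntermediateField.adjoin K (Set.range z) = ⊤) :
    IntermediateField.adjoin K (Set.range (monomialTransform V z)) = ⊤ := by
  rw [eq_top_iff, ← hgen, IntermediateField.adjoin_le_iff]
  rintro _ ⟨j, rfl⟩
  have hzj : z j = monomialTransform U (monomialTransform V z) j := by
    rw [monomialTransform_mul _ _ hz, hUV, monomialTransform_one]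
  rw [hzj]
  exact prod_mem fun i _ =>
    zpow_mem (IntermediateField.subset_adjoin _ _ (Set.mem_range_self i)) _

end LaurentMonomials

namespace ToricCoordinates

open MvPolynomial

variable {d r : ℕ} {a : Fin d → ℤ} {i₀ : Fin d} (c : ToricCoordinates r a i₀)

/-- The exponents in the variables `x` of a monomial in the coordinates `z`. -/
def xExponent (m : Fin d →₀ ℕ) : Fin d →₀ ℕ :=
  m + Finsupp.single i₀ (∑ i, c.e i * m i)

theorem xExponent_injective : Function.Injective c.xExponent := by
  intro m n h
  have happly : ∀ i, m i + (if i = i₀ then ∑ j, c.e j * m j else 0) =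
      n i + (if i = i₀ then ∑ j, c.e j * n j else 0) := fun i => by
    simpa only [xExponent, Finsupp.add_apply, Finsupp.single_apply, eq_comm (a := i₀)] using
      DFunLike.congr_fun h i
  have hne : ∀ i, i ≠ i₀ → m i = n i := fun i hi => by
    simpa only [if_neg hi, add_zero] using happly i
  have hself := happly i₀
  rw [if_pos rfl, if_pos rfl, ← Finset.add_sum_erase _ _ (Finset.mem_univ i₀),
    ← Finset.add_sum_erase (s := Finset.univ) (f := fun j => c.e j * n j) (Finset.mem_univ i₀),
    Finset.sum_congr rfl fun j hj => by rw [hne j (Finset.ne_of_mem_erase hj)], ← add_assoc,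
    ← add_assoc, Nat.add_right_cancel_iff, ← one_add_mul, ← one_add_mul] at hself
  ext i
  by_cases hi : i = i₀
  · rw [hi]
    exact Nat.eq_of_mul_eq_mul_left (by positivity) hself
  · exact hne i hi

theorem prod_coe_z_pow (m : Fin d →₀ ℕ) :
    ∏ i, (c.z i : MvPolynomial (Fin d) ℂ) ^ m i = monomial (c.xExponent m) 1 := by
  have h : monomial (c.xExponent m) (1 : ℂ) =
      monomial m 1 * X i₀ ^ (∑ i, c.e i * m i) := by
    rw [xExponent, X_pow_eq_monomial, monomial_mul, one_mul]
  rw [h, monomial_eq, Finsupp.prod_fintype _ _ fun i => pow_zero _, ← Finset.prod_pow_eq_pow_sum,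
    map_one, one_mul, ← Finset.prod_mul_distrib]
  exact Finset.prod_congr rfl fun i _ => by rw [c.coe_z, mul_pow, ← pow_mul]

theorem algebraicIndependent_z : AlgebraicIndependent ℂ c.z := by
  have hval : (coordRing r a).val ∘ c.z = fun i => (c.z i : MvPolynomial (Fin d) ℂ) := rfl
  rw [← AlgHom.algebraicIndependent_iff (coordRing r a).val Subtype.val_injective, hval,
    algebraicIndependent_iff_linearIndependent_prod_pow]
  simp only [prod_coe_z_pow]
  exact (basisMonomials (Fin d) ℂ).linearIndependent.comp _ c.xExponent_injective

variable (F : Type*) [Field F] [Algebra (coordRing r a) F] [IsFractionRing (coordRing r a) F]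
  [Algebra ℂ F] [IsScalarTower ℂ (coordRing r a) F]

theorem algebraicIndependent_zF : AlgebraicIndependent ℂ (c.zF F) :=
  c.algebraicIndependent_z.map' (f := IsScalarTower.toAlgHom ℂ (coordRing r a) F)
    (IsFractionRing.injective (coordRing r a) F)

theorem adjoin_range_zF_eq_top : IntermediateField.adjoin ℂ (Set.range (c.zF F)) = ⊤ := by
  rw [eq_top_iff]
  intro f _
  have hA : ∀ f, algebraMap (coordRing r a) F f ∈
      (IntermediateField.adjoin ℂ (Set.range (c.zF F))).toSubalgebra := by
    refine algebraMap_mem_of_forall_invariantMonomial_mem c.r_ne_zero _ fun m hm => ?_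
    obtain ⟨l, -, -, hl⟩ := c.algebraMap_invariantMonomial F hm
    rw [hl]
    exact prod_mem fun i _ =>
      zpow_mem (IntermediateField.subset_adjoin _ _ (Set.mem_range_self i)) _
  obtain ⟨b, s, -, rfl⟩ := IsFractionRing.div_surjective (coordRing r a) f
  exact div_mem (hA b) (hA s)

variable {F}

theorem exists_eq_smul_form (ω : ⋀[F]^d Ω[F⁄ℂ]) : ∃ h : F, ω = h • c.form F := by
  have hω : ω ∈ Submodule.span F {c.form F} :=
    span_singleton_ιMulti_eq_top (span_range_D_eq_top (c.adjoin_range_zF_eq_top F)) ▸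
      Submodule.mem_top
  obtain ⟨h, hh⟩ := Submodule.mem_span_singleton.1 hω
  exact ⟨h, hh.symm⟩

variable (F) in
theorem form_ne_zero : c.form F ≠ 0 :=
  ιMulti_D_ne_zero (c.algebraicIndependent_zF F) (c.adjoin_range_zF_eq_top F)

end ToricCoordinates

namespace PrimeDivisorOver

section LocalRing

variable {A R F : Type*} [CommRing A] [CommRing R] [Field F] [Algebra A F] [Algebra R F]
  (E : PrimeDivisorOver A F) {p : Ideal R} (h : ∀ f : F, f ∈ E.ring ↔ IsRegularAt p f)

include h

theorem algebraMap_mem_of_mem_ring_iff (hp : p ≠ ⊤) (b : R) : algebraMap R F b ∈ E.ring :=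
  (h _).2 ⟨b, 1, (Ideal.ne_top_iff_one p).1 hp, by rw [map_one, div_one]⟩

theorem inv_algebraMap_mem_of_mem_ring_iff {s : R} (hs : s ∉ p) : (algebraMap R F s)⁻¹ ∈ E.ring :=
  (h _).2 ⟨1, s, hs, by rw [map_one, one_div]⟩

theorem ord_algebraMap_eq_zero_of_mem_ring_iff {s : R} (hs : s ∉ p) :
    E.ord (algebraMap R F s) = 0 := by
  have hp : p ≠ ⊤ := fun hp => hs (hp ▸ Submodule.mem_top)
  have hinv := E.ord_nonneg_of_mem (E.inv_algebraMap_mem_of_mem_ring_iff h hs)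
  rw [E.ord_inv, Left.nonneg_neg_iff] at hinv
  exact le_antisymm hinv (E.ord_nonneg_of_mem (E.algebraMap_mem_of_mem_ring_iff h hp s))

end LocalRing

theorem ord_algebraMap_eq_one_of_mem_ring_iff {A R F : Type*} [CommRing A] [CommRing R] [Field F]
    [Algebra A F] [Algebra R F] [FaithfulSMul R F] (E : PrimeDivisorOver A F) {t : R}
    (ht : Prime t) (h : ∀ f : F, f ∈ E.ring ↔ IsRegularAt (Ideal.span {t}) f) :
    E.ord (algebraMap R F t) = 1 := by
  have ne_zero {b : R} (hb : b ≠ 0) : algebraMap R F b ≠ 0 := by simpa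
  have hp : Ideal.span {t} ≠ ⊤ := mt Ideal.span_singleton_eq_top.1 ht.not_isUnit
  have nonneg (b : R) : 0 ≤ E.ord (algebraMap R F b) :=
    E.ord_nonneg_of_mem (E.algebraMap_mem_of_mem_ring_iff h hp b)
  obtain ⟨ϖ, hϖ0, hϖ⟩ := E.exists_uniformizer
  obtain ⟨b, s, hs, rfl⟩ := (h ϖ).1 (E.mem_of_ord_nonneg (by omega))
  have hb : algebraMap R F b ≠ 0 := (div_ne_zero_iff.1 hϖ0).1
  rw [E.ord_div hb (div_ne_zero_iff.1 hϖ0).2, E.ord_algebraMap_eq_zero_of_mem_ring_iff h hs,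
    sub_zero] at hϖ
  have hbt : b ∈ Ideal.span {t} := by
    by_contra hbt
    rw [E.ord_algebraMap_eq_zero_of_mem_ring_iff h hbt] at hϖ
    exact zero_ne_one hϖ
  obtain ⟨c, rfl⟩ := Ideal.mem_span_singleton.1 hbt
  have hc : c ≠ 0 := by rintro rfl; exact hb (by rw [mul_zero, map_zero])
  rw [map_mul, E.ord_mul (ne_zero ht.ne_zero) (ne_zero hc)] at hϖ
  have htpos : E.ord (algebraMap R F t) ≠ 0 := fun h0 => by
    have hinv : (algebraMap R F t)⁻¹ ∈ E.ring :=
      E.mem_of_ord_nonneg (by rw [E.ord_inv, h0, neg_zero])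
    obtain ⟨b, s, hs, hbs⟩ := (h _).1 hinv
    have hs0 : algebraMap R F s ≠ 0 := ne_zero fun hs0 => hs (hs0 ▸ zero_mem _)
    refine hs (Ideal.mem_span_singleton.2 ⟨b, FaithfulSMul.algebraMap_injective R F ?_⟩)
    rw [eq_div_iff hs0] at hbs
    rw [map_mul, ← hbs, mul_inv_cancel_left₀ (ne_zero ht.ne_zero)]
  have := nonneg c
  have := nonneg t
  omega

end PrimeDivisorOver

theorem isRegularAt_map_iff {R B F : Type*} [CommRing R] [CommRing B] [Field F] [Algebra R B]
    [Algebra R F] [Algebra B F] [IsScalarTower R B F] (M : Submonoid R) [IsLocalization M B]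
    {p : Ideal R} [hp : p.IsPrime] (hM : Disjoint (M : Set R) p) (f : F) :
    IsRegularAt (p.map (algebraMap R B)) f ↔ IsRegularAt p f := by
  have mem_map_iff (a : R) : algebraMap R B a ∈ p.map (algebraMap R B) ↔ a ∈ p := by
    rw [← Ideal.mem_comap]
    exact SetLike.ext_iff.1 (IsLocalization.under_map_of_isPrime_disjoint M B hp hM) a
  have map_ne_zero (m : M) : algebraMap R F m ≠ 0 := by
    rw [IsScalarTower.algebraMap_apply R B F]
    exact ((IsLocalization.map_units B m).map (algebraMap B F)).ne_zero
  have map_mk' (a : R) (m : M) :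
      algebraMap B F (IsLocalization.mk' B a m) = algebraMap R F a / algebraMap R F m := by
    rw [eq_div_iff (map_ne_zero m), IsScalarTower.algebraMap_apply R B F m,
      IsScalarTower.algebraMap_apply R B F a, ← map_mul, IsLocalization.mk'_spec]
  constructor
  · rintro ⟨b, s, hs, rfl⟩
    obtain ⟨b, m, rfl⟩ := IsLocalization.exists_mk'_eq M b
    obtain ⟨s, n, rfl⟩ := IsLocalization.exists_mk'_eq M s
    rw [IsLocalization.mk'_mem_iff, mem_map_iff] at hs
    refine ⟨b * n, s * m, hp.mul_notMem hs (Set.disjoint_left.1 hM m.2), ?_⟩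
    rw [map_mk', map_mk', div_div_div_eq, map_mul, map_mul, mul_comm (algebraMap R F m)]
  · rintro ⟨b, s, hs, rfl⟩
    refine ⟨algebraMap R B b, algebraMap R B s, (mem_map_iff s).not.2 hs, ?_⟩
    simp only [← IsScalarTower.algebraMap_apply R B F]

theorem PrimeDivisorOver.exists_mem_ring_iff_of_prime {A R F : Type*} [CommRing A] [CommRing R]
    [IsDomain R] [IsNoetherianRing R] [IsIntegrallyClosed R] [Field F] [Algebra A F] [Algebra R F]
    [IsFractionRing R F] (B : Subalgebra A F) (hB : B.FG) [Algebra R B] [IsScalarTower R B F]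
    {s t : R} [IsLocalization.Away s B] (ht : Prime t) (hs : ¬ t ∣ s) :
    ∃ E : PrimeDivisorOver A F, ∀ f : F, f ∈ E.ring ↔ IsRegularAt (Ideal.span {t}) f := by
  have hp : (Ideal.span {t}).IsPrime := (Ideal.span_singleton_prime ht.ne_zero).2 ht
  have hdisj : Disjoint (Submonoid.powers s : Set R) (Ideal.span {t} : Ideal R) :=
    Set.disjoint_left.2 fun _ ⟨n, hn⟩ hmem =>
      hs (ht.dvd_of_dvd_pow (hn ▸ Ideal.mem_span_singleton.1 hmem))
  have hs0 : Submonoid.powers s ≤ nonZeroDivisors R :=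
    powers_le_nonZeroDivisors_of_noZeroDivisors (fun h0 => hs (h0 ▸ dvd_zero t))
  have : IsNoetherianRing B := IsLocalization.isNoetherianRing (Submonoid.powers s) B ‹_›
  have : IsIntegrallyClosed B := isIntegrallyClosed_of_isLocalization B _ hs0
  have : IsFractionRing B F :=
    IsFractionRing.isFractionRing_of_isDomain_of_isLocalization (Submonoid.powers s) B F
  have hP : ((Ideal.span {t}).map (algebraMap R B)).IsPrime :=
    IsLocalization.isPrime_of_isPrime_disjoint (Submonoid.powers s) B _ hp hdisj
  have hP1 : ((Ideal.span {t}).map (algebraMap R B)).height = 1 := by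
    rw [Ideal.map_span, Set.image_singleton] at hP ⊢
    refine Ideal.height_span_singleton_eq_one_of_mem_nonZeroDivisors
      (mem_nonZeroDivisors_of_ne_zero ?_) (Ideal.span_singleton_eq_top.not.1 hP.ne_top)
    exact (map_ne_zero_iff _ (IsLocalization.injective B hs0)).2 ht.ne_zero
  obtain ⟨E, hE⟩ := exists_mem_ring_iff_of_subalgebra B hB _ hP1
  exact ⟨E, fun f => (hE f).trans (isRegularAt_map_iff (Submonoid.powers s) hdisj f)⟩

section Chart

open MvPolynomial

variable {F : Type*} [Field F] [Algebra ℂ F] {d : ℕ} {i₀ : Fin d}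

/-- The ring of regular functions on the toric chart with coordinates `y` in which `y k` is
invertible for `k ≠ i₀`. -/
def chartRing (y : Fin d → F) (i₀ : Fin d) : Subalgebra ℂ F :=
  Algebra.adjoin ℂ (Set.range y ∪ (fun k => (y k)⁻¹) '' {k | k ≠ i₀})

theorem prod_zpow_mem_chartRing (y : Fin d → F) {k : Fin d → ℤ} (hk : 0 ≤ k i₀) :
    ∏ i, y i ^ k i ∈ chartRing y i₀ := by
  have self_mem (i : Fin d) : y i ∈ chartRing y i₀ := Algebra.subset_adjoin (Or.inl ⟨i, rfl⟩)
  have inv_mem {i : Fin d} (hi : i ≠ i₀) : (y i)⁻¹ ∈ chartRing y i₀ :=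
    Algebra.subset_adjoin (Or.inr ⟨i, hi, rfl⟩)
  refine prod_mem fun i _ => ?_
  rcases le_or_gt 0 (k i) with hi | hi
  · rw [← Int.toNat_of_nonneg hi, zpow_natCast]
    exact pow_mem (self_mem i) _
  · rw [← neg_neg (k i), zpow_neg, ← Int.toNat_of_nonneg (neg_nonneg.2 hi.le), zpow_natCast,
      ← inv_pow]
    exact pow_mem (inv_mem (by rintro rfl; exact hi.not_ge hk)) _

variable {A : Type*} [CommRing A] [Algebra ℂ A] [Algebra A F] [IsScalarTower ℂ A F]
  [Algebra (MvPolynomial (Fin d) ℂ) F] [IsScalarTower ℂ (MvPolynomial (Fin d) ℂ) F]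

theorem PrimeDivisorOver.mem_coordSubalgebra_of_mem_ring_iff_isRegularAt_X
    (E : PrimeDivisorOver A F)
    (hE : ∀ f : F, f ∈ E.ring ↔ IsRegularAt (Ideal.span {(X i₀ : MvPolynomial (Fin d) ℂ)}) f) :
    ∀ f ∈ E.ring, f ∈ E.coordSubalgebra fun i => algebraMap (MvPolynomial (Fin d) ℂ) F (X i) := by
  have hp : Ideal.span {(X i₀ : MvPolynomial (Fin d) ℂ)} ≠ ⊤ :=
    mt Ideal.span_singleton_eq_top.1 X_prime.not_isUnit
  have mem_coord (p : MvPolynomial (Fin d) ℂ) : algebraMap (MvPolynomial (Fin d) ℂ) F p ∈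
      E.coordSubalgebra fun i => algebraMap (MvPolynomial (Fin d) ℂ) F (X i) := by
    have hadj : p ∈ Algebra.adjoin ℂ (Set.range (X : Fin d → MvPolynomial (Fin d) ℂ)) :=
      adjoin_range_X (R := ℂ) (σ := Fin d) ▸ Algebra.mem_top
    refine Algebra.adjoin_le (S := (E.coordSubalgebra _).comap
      (IsScalarTower.toAlgHom ℂ (MvPolynomial (Fin d) ℂ) F)) ?_ hadj
    rintro _ ⟨i, rfl⟩
    exact E.mem_coordSubalgebra_self (fun i => algebraMap (MvPolynomial (Fin d) ℂ) F (X i))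
      (E.algebraMap_mem_of_mem_ring_iff hE hp (X i))
  refine E.mem_coordSubalgebra_of_fractions _ fun f hf => ?_
  obtain ⟨b, s, hs, rfl⟩ := (hE f).1 hf
  exact ⟨_, _, mem_coord b, mem_coord s, E.inv_algebraMap_mem_of_mem_ring_iff hE hs, rfl⟩

variable [IsFractionRing (MvPolynomial (Fin d) ℂ) F]

theorem chartRing_le_ofField {s : MvPolynomial (Fin d) ℂ}
    (hs : Submonoid.powers s ≤ nonZeroDivisors (MvPolynomial (Fin d) ℂ))
    (hX : ∀ k ≠ i₀, X k ∣ s) :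
    chartRing (fun i => algebraMap (MvPolynomial (Fin d) ℂ) F (X i)) i₀ ≤
      (Localization.subalgebra.ofField F (Submonoid.powers s) hs).restrictScalars ℂ := by
  refine Algebra.adjoin_le ?_
  rintro _ (⟨i, rfl⟩ | ⟨k, hk, rfl⟩)
  · exact Subalgebra.algebraMap_mem _ (X i)
  · obtain ⟨c, rfl⟩ := hX k hk
    have hc : algebraMap (MvPolynomial (Fin d) ℂ) F c ≠ 0 := by
      have := nonZeroDivisors.ne_zero (hs (Submonoid.mem_powers _))
      simpa using right_ne_zero_of_mul this
    refine ⟨c, X k * c, Submonoid.mem_powers _, ?_⟩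
    dsimp only
    rw [map_mul, mul_inv_rev, mul_inv_cancel_left₀ hc]

theorem PrimeDivisorOver.exists_mem_ring_iff_isRegularAt_X
    (hA : ∀ f : A, algebraMap A F f ∈
      chartRing (fun i => algebraMap (MvPolynomial (Fin d) ℂ) F (X i)) i₀) :
    ∃ E : PrimeDivisorOver A F, ∀ f : F,
      f ∈ E.ring ↔ IsRegularAt (Ideal.span {(X i₀ : MvPolynomial (Fin d) ℂ)}) f := by
  let s : MvPolynomial (Fin d) ℂ := ∏ k ∈ Finset.univ.erase i₀, X k
  have hs : ¬ X i₀ ∣ s := fun h => by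
    obtain ⟨k, hk, hdvd⟩ := (X_prime (R := ℂ) (i := i₀)).exists_mem_finset_dvd h
    exact Finset.ne_of_mem_erase hk (X_dvd_X.1 hdvd).symm
  have hs0 : Submonoid.powers s ≤ nonZeroDivisors (MvPolynomial (Fin d) ℂ) :=
    powers_le_nonZeroDivisors_of_noZeroDivisors fun h0 => hs (h0 ▸ dvd_zero _)
  let S := Localization.subalgebra.ofField F (Submonoid.powers s) hs0
  let B : Subalgebra A F :=
    { S.toSubring with
      algebraMap_mem' := fun f => chartRing_le_ofField hs0
        (fun k hk => Finset.dvd_prod_of_mem _ (Finset.mem_erase.2 ⟨hk, Finset.mem_univ k⟩)) (hA f) }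
  let : Algebra (MvPolynomial (Fin d) ℂ) B := inferInstanceAs (Algebra (MvPolynomial (Fin d) ℂ) S)
  have : IsScalarTower (MvPolynomial (Fin d) ℂ) B F :=
    inferInstanceAs (IsScalarTower (MvPolynomial (Fin d) ℂ) S F)
  have : IsLocalization (Submonoid.powers s) B :=
    Localization.subalgebra.isLocalization_ofField F _ hs0
  have : IsLocalization.Away s B := this
  have : IsScalarTower ℂ (MvPolynomial (Fin d) ℂ) B :=
    IsScalarTower.to₁₂₃ ℂ (MvPolynomial (Fin d) ℂ) B F
  have hFG : B.FG := by
    have : Algebra.FiniteType (MvPolynomial (Fin d) ℂ) B :=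
      IsLocalization.finiteType_of_monoid_fg (Submonoid.powers s) B
    have : Algebra.FiniteType ℂ B :=
      Algebra.FiniteType.trans (S := MvPolynomial (Fin d) ℂ) inferInstance inferInstance
    exact B.fg_iff_finiteType.2 (Algebra.FiniteType.of_restrictScalars_finiteType ℂ A B)
  exact exists_mem_ring_iff_of_prime B hFG (X_prime (i := i₀)) hs

theorem PrimeDivisorOver.exists_ord_X_eq_ite
    (hA : ∀ f : A, algebraMap A F f ∈
      chartRing (fun i => algebraMap (MvPolynomial (Fin d) ℂ) F (X i)) i₀) :
    ∃ E : PrimeDivisorOver A F,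
      (∀ i, E.ord (algebraMap (MvPolynomial (Fin d) ℂ) F (X i)) = if i = i₀ then 1 else 0) ∧
      ∀ f ∈ E.ring, f ∈ E.coordSubalgebra fun i => algebraMap (MvPolynomial (Fin d) ℂ) F (X i) := by
  obtain ⟨E, hE⟩ := exists_mem_ring_iff_isRegularAt_X hA
  refine ⟨E, fun i => ?_, E.mem_coordSubalgebra_of_mem_ring_iff_isRegularAt_X hE⟩
  split_ifs with hi
  · rw [hi, E.ord_algebraMap_eq_one_of_mem_ring_iff X_prime hE]
  · refine E.ord_algebraMap_eq_zero_of_mem_ring_iff hE fun hmem => hi ?_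
    exact (X_dvd_X.1 (Ideal.mem_span_singleton.1 hmem)).symm

end Chart

open MvPolynomial in
theorem PrimeDivisorOver.exists_ord_eq_ite {A F : Type*} [CommRing A] [Algebra ℂ A] [Field F]
    [Algebra ℂ F] [Algebra A F] [IsScalarTower ℂ A F] {d : ℕ} {y : Fin d → F} {i₀ : Fin d}
    (hind : AlgebraicIndependent ℂ y) (hgen : IntermediateField.adjoin ℂ (Set.range y) = ⊤)
    (hA : ∀ f : A, algebraMap A F f ∈ chartRing y i₀) :
    ∃ E : PrimeDivisorOver A F, (∀ i, E.ord (y i) = if i = i₀ then 1 else 0) ∧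
      ∀ f ∈ E.ring, f ∈ E.coordSubalgebra y := by
  let coeffAlgebra : Algebra (MvPolynomial (Fin d) ℂ) F := (aeval y).toAlgebra
  have hX : y = fun i => algebraMap (MvPolynomial (Fin d) ℂ) F (X i) :=
    funext fun i => (aeval_X y i).symm
  have : IsScalarTower ℂ (MvPolynomial (Fin d) ℂ) F :=
    IsScalarTower.of_algebraMap_eq fun z => ((aeval y).commutes z).symm
  clear_value coeffAlgebra
  subst hX
  have : IsFractionRing (MvPolynomial (Fin d) ℂ) F :=
    isFractionRing_of_algebraicIndependent hind hgen
  exact exists_ord_X_eq_ite hA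

namespace PrimeDivisorOver

section Normal

variable {A F : Type*} [CommRing A] [IsDomain A] [IsNoetherianRing A] [IsIntegrallyClosed A]
  [Field F] [Algebra A F] [IsFractionRing A F] (E : PrimeDivisorOver A F) {f : F}

theorem ord_nonneg_of_forall_height_eq_one (h : ∀ D : PrimeDivisorOver A F,
    D.center.height = 1 → D.center ≤ E.center → 0 ≤ D.ord f) : 0 ≤ E.ord f := by
  have : FaithfulSMul A F := IsFractionRing.instFaithfulSMul _ _
  have := E.center_isPrime
  refine E.ord_nonneg_of_isRegularAt_center
    (isRegularAt_of_forall_height_eq_one _ _ fun p hp hp1 hpE => ?_)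
  obtain ⟨D, hD⟩ := exists_mem_ring_iff_of_height_eq_one (F := F) p hp1
  have hDp := D.center_eq_of_mem_ring_iff hD
  exact (hD f).1 (D.mem_of_ord_nonneg (h D (hDp ▸ hp1) (hDp ▸ hpE)))

theorem ord_eq_zero_of_forall_height_eq_one (h : ∀ D : PrimeDivisorOver A F,
    D.center.height = 1 → D.center ≤ E.center → D.ord f = 0) : E.ord f = 0 := by
  have hf : 0 ≤ E.ord f :=
    E.ord_nonneg_of_forall_height_eq_one fun D hD hDE => (h D hD hDE).ge
  have hinv : 0 ≤ E.ord f⁻¹ :=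
    E.ord_nonneg_of_forall_height_eq_one fun D hD hDE => by rw [D.ord_inv, h D hD hDE, neg_zero]
  rw [E.ord_inv] at hinv
  omega

end Normal

open MvPolynomial in
theorem center_eq_originIdeal {d r : ℕ} {a : Fin d → ℤ} (hr : r ≠ 0) {F : Type*} [Field F]
    [Algebra (coordRing r a) F] [FaithfulSMul (coordRing r a) F]
    (E : PrimeDivisorOver (coordRing r a) F)
    (h : ∀ (m : Fin d →₀ ℕ) (hm : (r : ℤ) ∣ ∑ i, a i * m i), m ≠ 0 →
      0 < E.ord (algebraMap _ F (invariantMonomial hr hm))) : E.center = originIdeal r a := by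
  refine (originIdeal_isMaximal.eq_of_le E.center_isPrime.ne_top fun f hf => ?_).symm
  refine mem_of_forall_invariantMonomial_mem hr (E.center.restrictScalars ℂ) f fun m hm hmf => ?_
  have hm_ne : m ≠ 0 := by
    rintro rfl
    exact mem_support_iff.1 hmf ((mem_originIdeal_iff f).1 hf)
  have hm_pos := h m hm hm_ne
  refine (E.ord_algebraMap_pos_iff fun h0 => ?_).1 hm_pos
  rw [h0, map_zero, E.ord_zero] at hm_pos
  exact hm_pos.false

end PrimeDivisorOver

namespace ToricCoordinates

variable {d r : ℕ} {a : Fin d → ℤ} {i₀ : Fin d} (c : ToricCoordinates r a i₀)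

section Weights

variable {v : Fin d → ℚ} {w : Fin d → ℤ} (hw : ∀ i, (w i : ℚ) = v i + c.e i * v i₀)

include hw

theorem weight_self : (w i₀ : ℚ) = r * v i₀ := by
  have he : (c.e i₀ : ℚ) + 1 = r := by exact_mod_cast c.e_self
  rw [hw, ← he]
  ring

theorem sum_mul_weight {m : Fin d → ℕ} {l : ℤ} (hl : ∑ i, (c.e i : ℤ) * m i = r * l) :
    (∑ i, ((m i : ℤ) - if i = i₀ then l else 0) * w i : ℤ) = ∑ i, m i * v i := by
  have hl' : ∑ i, (c.e i : ℚ) * m i = r * l := by exact_mod_cast hl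
  have hsplit : ∑ i, (m i : ℚ) * w i = ∑ i, m i * v i + (∑ i, (c.e i : ℚ) * m i) * v i₀ := by
    rw [Finset.sum_mul, ← Finset.sum_add_distrib]
    exact Finset.sum_congr rfl fun i _ => by rw [hw]; ring
  have hpush : ((∑ i, ((m i : ℤ) - if i = i₀ then l else 0) * w i : ℤ) : ℚ) =
      ∑ i, (m i : ℚ) * w i - l * w i₀ := by
    simp [sub_mul, Finset.sum_sub_distrib, ite_mul]
  rw [hpush, hsplit, hl', c.weight_self hw]
  ring

end Weights

variable {F : Type*} [Field F] [Algebra (coordRing r a) F] [IsFractionRing (coordRing r a) F]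

theorem mul_ord_invariantMonomial {v : Fin d → ℚ} {w : Fin d → ℤ}
    (hw : ∀ i, (w i : ℚ) = v i + c.e i * v i₀) {g : ℤ} (E : PrimeDivisorOver (coordRing r a) F)
    (hE : ∀ j, g * E.ord (c.zF F j) = w j) {m : Fin d →₀ ℕ} (hm : (r : ℤ) ∣ ∑ i, a i * m i) :
    (g * E.ord (algebraMap _ F (invariantMonomial c.r_ne_zero hm)) : ℚ) = ∑ i, m i * v i := by
  obtain ⟨l, hl, -, hprod⟩ := c.algebraMap_invariantMonomial F hm
  rw [hprod, E.ord_prod_zpow (c.zF_ne_zero F), ← c.sum_mul_weight hw hl, ← Int.cast_mul,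
    Finset.mul_sum]
  exact congrArg Int.cast (Finset.sum_congr rfl fun i _ => by rw [← hE]; ring)

theorem sum_ord_zF_sub (E : PrimeDivisorOver (coordRing r a) F) :
    ∑ i, (E.ord (c.zF F i) : ℚ) - (∑ i, (c.e i : ℚ)) * E.ord (c.zF F i₀) / r =
      ∑ i, (E.ord (algebraMap _ F (c.xPow i)) : ℚ) / r := by
  have hr : (r : ℚ) ≠ 0 := by exact_mod_cast c.r_ne_zero
  rw [Finset.sum_mul, Finset.sum_div, ← Finset.sum_sub_distrib]
  refine Finset.sum_congr rfl fun i _ => ?_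
  have hi : (r * E.ord (c.zF F i) : ℚ) =
      E.ord (algebraMap _ F (c.xPow i)) + c.e i * E.ord (c.zF F i₀) := by
    exact_mod_cast c.mul_ord_zF E i
  field_simp
  linear_combination hi

/-- The vector is `κ b (a i₀, …)` up to integers, where `κ` is the order of `z i₀ = x i₀ ^ r` and
`b` is an inverse of `a i₀` modulo `r`. -/
theorem exists_ord_xPow_div_eq (E : PrimeDivisorOver (coordRing r a) F) :
    ∃ k : ℤ, ∀ i, ∃ n : ℤ, (E.ord (algebraMap _ F (c.xPow i)) : ℚ) / r = k * a i / r + n := by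
  have hr : (r : ℚ) ≠ 0 := by exact_mod_cast c.r_ne_zero
  obtain ⟨u, b, hub⟩ := c.isCoprime
  set κ := E.ord (c.zF F i₀)
  refine ⟨κ * b, fun i => ?_⟩
  obtain ⟨l, hl⟩ := c.dvd i
  refine ⟨E.ord (c.zF F i) - κ * b * l - κ * u * c.e i, ?_⟩
  have hz : (r : ℚ) * E.ord (c.zF F i) = E.ord (algebraMap _ F (c.xPow i)) + c.e i * κ := by
    exact_mod_cast c.mul_ord_zF E i
  have hl' : (a i : ℚ) + c.e i * a i₀ = r * l := by exact_mod_cast hl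
  have hub' : (u : ℚ) * r + b * a i₀ = 1 := by exact_mod_cast hub
  push_cast
  field_simp
  linear_combination -hz - (κ * b : ℚ) * hl' + (κ * c.e i : ℚ) * hub'

variable [Algebra ℂ F] [IsScalarTower ℂ (coordRing r a) F]

theorem exists_ord_zF_eq {v : Fin d → ℚ} (hv : ∀ i, 0 ≤ v i) {w : Fin d → ℤ}
    (hw : ∀ i, (w i : ℚ) = v i + c.e i * v i₀) (u : UnimodularColumn w i₀) :
    ∃ E : PrimeDivisorOver (coordRing r a) F, (∀ j, E.ord (c.zF F j) = u.U j i₀) ∧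
      ∀ f ∈ E.ring, f ∈ E.coordSubalgebra (monomialTransform u.V (c.zF F)) := by
  have hz := c.zF_ne_zero F
  obtain ⟨E, hE, hcoord⟩ := PrimeDivisorOver.exists_ord_eq_ite (A := coordRing r a) (i₀ := i₀)
    (algebraicIndependent_monomialTransform u.V_mul_U (c.algebraicIndependent_zF F))
    (adjoin_range_monomialTransform_eq_top u.U_mul_V hz (c.adjoin_range_zF_eq_top F))
    (algebraMap_mem_of_forall_invariantMonomial_mem c.r_ne_zero _ fun m hm => by
      obtain ⟨l, hl, -, hprod⟩ := c.algebraMap_invariantMonomial F hm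
      rw [hprod, u.prod_zpow_eq hz]
      refine prod_zpow_mem_chartRing _ (nonneg_of_mul_nonneg_right ?_ u.g_pos)
      rw [u.g_mul_vecMul, ← Int.cast_nonneg_iff (R := ℚ), c.sum_mul_weight hw hl]
      exact Finset.sum_nonneg fun i _ => mul_nonneg (Nat.cast_nonneg _) (hv i))
  refine ⟨E, fun j => ?_, hcoord⟩
  conv_lhs => rw [← u.monomialTransform_V hz]
  rw [monomialTransform, E.ord_prod_zpow (monomialTransform_ne_zero u.V hz)]
  simp [hE]

theorem isLogDiscrepancy_of_formHasOrd {i₁ : Fin d} (hi : i₁ ≠ i₀)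
    (hcop : IsCoprime (r : ℤ) (a i₁)) (x : Ideal (coordRing r a))
    {E : PrimeDivisorOver (coordRing r a) F} {k : ℤ} (hk : E.FormHasOrd (c.form F) k) :
    E.IsLogDiscrepancy d x (1 + k - (∑ i, (c.e i : ℚ)) * E.ord (c.zF F i₀) / r) := by
  refine ⟨c.form F, r, c.zF F i₀ ^ (-∑ i, (c.e i : ℤ)), c.form_ne_zero F,
    Nat.pos_of_ne_zero c.r_ne_zero, zpow_ne_zero _ (c.zF_ne_zero F i₀), fun D hD _ => ?_, k, hk, ?_⟩
  · obtain ⟨k', hk', hkz⟩ := c.exists_formHasOrd_of_height_eq_one hi hcop D hD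
    exact ⟨k', hk', by rw [D.ord_zpow, hkz]; ring⟩
  · rw [E.ord_zpow]
    push_cast
    ring

/-- Two trivializations of a multiple of the canonical divisor differ by a function `ψ` without
zeros or poles in codimension one near the center of `E`, hence by a unit there. -/
theorem exists_formHasOrd_of_isLogDiscrepancy_center {i₁ : Fin d} (hi : i₁ ≠ i₀)
    (hcop : IsCoprime (r : ℤ) (a i₁)) {E : PrimeDivisorOver (coordRing r a) F} {q : ℚ}
    (hq : E.IsLogDiscrepancy d E.center q) : ∃ k : ℤ, E.FormHasOrd (c.form F) k ∧
      q = 1 + k - (∑ i, (c.e i : ℚ)) * E.ord (c.zF F i₀) / r := by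
  have := isNoetherianRing_coordRing (a := a) c.r_ne_zero
  have := isIntegrallyClosed_coordRing (r := r) (a := a)
  have hr : (r : ℚ) ≠ 0 := by exact_mod_cast c.r_ne_zero
  have hz := c.zF_ne_zero F i₀
  obtain ⟨ω, m, g, hω, hm, hg, hD, k, hk, rfl⟩ := hq
  have hm' : (m : ℚ) ≠ 0 := by exact_mod_cast hm.ne'
  obtain ⟨h, rfl⟩ := c.exists_eq_smul_form ω
  have hh : h ≠ 0 := by rintro rfl; exact hω (zero_smul _ _)
  let ψ : F := h ^ (m * r) * g ^ r * c.zF F i₀ ^ (m * ∑ i, c.e i)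
  have hψ (D : PrimeDivisorOver (coordRing r a) F) : D.ord ψ =
      m * r * D.ord h + r * D.ord g + m * (∑ i, (c.e i : ℤ)) * D.ord (c.zF F i₀) := by
    rw [D.ord_mul (mul_ne_zero (pow_ne_zero _ hh) (pow_ne_zero _ hg)) (pow_ne_zero _ hz),
      D.ord_mul (pow_ne_zero _ hh) (pow_ne_zero _ hg), D.ord_pow, D.ord_pow, D.ord_pow]
    push_cast
    ring
  have hEψ : E.ord ψ = 0 := E.ord_eq_zero_of_forall_height_eq_one fun D hD₁ hDE => by
    obtain ⟨k₁, hk₁, hkg⟩ := hD D hD₁ hDE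
    obtain ⟨k₂, hk₂, hkz⟩ := c.exists_formHasOrd_of_height_eq_one hi hcop D hD₁
    have hkk := (hk₁.of_smul hh).unique hk₂ (c.form_ne_zero F)
    rw [hψ]
    linear_combination (r : ℤ) * hkg - (m * r : ℤ) * hkk - (m : ℤ) * hkz
  rw [hψ] at hEψ
  refine ⟨_, hk.of_smul hh, ?_⟩
  have hEψ' : (m * r * E.ord h + r * E.ord g + m * (∑ i, (c.e i : ℚ)) * E.ord (c.zF F i₀) : ℚ) =
      0 := by exact_mod_cast hEψ
  push_cast
  field_simp
  linear_combination hEψ'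

theorem exists_isLogDiscrepancy_le {i₁ : Fin d} (hi : i₁ ≠ i₀) (hcop : IsCoprime (r : ℤ) (a i₁))
    {v : Fin d → ℚ} (hv : ∀ i, 0 < v i) {w : Fin d → ℤ}
    (hw : ∀ i, (w i : ℚ) = v i + c.e i * v i₀) :
    ∃ (E : PrimeDivisorOver (coordRing r a) F) (q : ℚ), E.center = originIdeal r a ∧
      E.IsLogDiscrepancy d (originIdeal r a) q ∧ q ≤ ∑ i, v i := by
  have : FaithfulSMul (coordRing r a) F := IsFractionRing.instFaithfulSMul _ _
  have hr : (0 : ℚ) < r := by exact_mod_cast Nat.pos_of_ne_zero c.r_ne_zero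
  have hw_ne : w ≠ 0 := fun h => by
    have hw_pos := c.weight_self hw ▸ mul_pos hr (hv i₀)
    simp [h] at hw_pos
  obtain ⟨u⟩ := UnimodularColumn.nonempty hw_ne i₀
  have hg : (0 : ℚ) < u.g := by exact_mod_cast u.g_pos
  obtain ⟨E, hE, hcoord⟩ := c.exists_ord_zF_eq (F := F) (fun i => (hv i).le) hw u
  have hEw (j : Fin d) : u.g * E.ord (c.zF F j) = w j := by rw [hE, u.g_mul_U]
  have hcenter : E.center = originIdeal r a :=
    E.center_eq_originIdeal c.r_ne_zero fun m hm hm_ne => by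
      obtain ⟨j, hj⟩ := Finsupp.ne_iff.1 hm_ne
      have hsum : (0 : ℚ) < ∑ i, m i * v i :=
        Finset.sum_pos' (fun i _ => mul_nonneg (Nat.cast_nonneg _) (hv i).le)
          ⟨j, Finset.mem_univ j, mul_pos (by exact_mod_cast Nat.pos_of_ne_zero hj) (hv j)⟩
      rw [← c.mul_ord_invariantMonomial hw E hEw hm] at hsum
      exact_mod_cast pos_of_mul_pos_right hsum hg.le
  have hform := E.formHasOrd_of_coordSubalgebra (c.zF_ne_zero F)
    { u with g := 1, g_pos := one_pos, g_mul_U := fun j => by rw [one_mul, hE] } hcoord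
  have hE_log := c.isLogDiscrepancy_of_formHasOrd hi hcop (originIdeal r a) hform
  refine ⟨E, (∑ i, v i) / u.g, hcenter, ?_, ?_⟩
  · convert hE_log using 1
    have hsum : u.g * ∑ i, (E.ord (c.zF F i) : ℚ) = ∑ i, v i + (∑ i, (c.e i : ℚ)) * v i₀ := by
      rw [Finset.mul_sum, Finset.sum_mul, ← Finset.sum_add_distrib]
      exact Finset.sum_congr rfl fun i _ => by rw [← hw]; exact_mod_cast hEw i
    have hself : u.g * (E.ord (c.zF F i₀) : ℚ) = r * v i₀ := by
      rw [← c.weight_self hw]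
      exact_mod_cast hEw i₀
    push_cast
    field_simp
    linear_combination -(r : ℚ) * hsum + (∑ i, (c.e i : ℚ)) * hself
  · exact div_le_self (Finset.sum_nonneg fun i _ => (hv i).le) (by exact_mod_cast u.g_pos)

theorem sum_ord_xPow_div_le {i₁ : Fin d} (hi : i₁ ≠ i₀) (hcop : IsCoprime (r : ℤ) (a i₁))
    (E : PrimeDivisorOver (coordRing r a) F) {q : ℚ} (hq : E.IsLogDiscrepancy d E.center q) :
    ∑ i, (E.ord (algebraMap _ F (c.xPow i)) : ℚ) / r ≤ q := by
  obtain ⟨k, hk, rfl⟩ := c.exists_formHasOrd_of_isLogDiscrepancy_center hi hcop hq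
  have hle : ∑ i, (E.ord (c.zF F i) : ℚ) - 1 ≤ k := by
    exact_mod_cast hk.sum_ord_le (c.zF_ne_zero F) (c.form_ne_zero F)
  rw [← c.sum_ord_zF_sub E]
  linarith

open MvPolynomial in
include c in
theorem exists_sum_le_of_isLogDiscrepancy {i₁ : Fin d} (hi : i₁ ≠ i₀)
    (hcop : IsCoprime (r : ℤ) (a i₁)) (E : PrimeDivisorOver (coordRing r a) F) {q : ℚ}
    (hE : E.center = originIdeal r a) (hq : E.IsLogDiscrepancy d (originIdeal r a) q) :
    ∃ (v : Fin d → ℚ) (k : ℤ), (∀ i, 0 < v i) ∧ (∀ i, ∃ n : ℤ, v i = k * a i / r + n) ∧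
      ∑ i, v i ≤ q := by
  have : FaithfulSMul (coordRing r a) F := IsFractionRing.instFaithfulSMul _ _
  have hr : (0 : ℚ) < r := by exact_mod_cast Nat.pos_of_ne_zero c.r_ne_zero
  have hx (i : Fin d) : 0 < E.ord (algebraMap _ F (c.xPow i)) := by
    rw [E.ord_algebraMap_pos_iff (c.xPow_ne_zero i), hE, mem_originIdeal_iff, xPow, map_pow,
      constantCoeff_X, zero_pow c.r_ne_zero]
  obtain ⟨k, hk⟩ := c.exists_ord_xPow_div_eq E
  exact ⟨_, k, fun i => div_pos (by exact_mod_cast hx i) hr, hk,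
    c.sum_ord_xPow_div_le hi hcop E (hE ▸ hq)⟩

end ToricCoordinates

theorem cyclicMld_le {d r : ℕ} {a : Fin d → ℤ} (hr : r ≠ 0) {i₀ i₁ : Fin d} (hi : i₁ ≠ i₀)
    (h₀ : IsCoprime (r : ℤ) (a i₀)) (h₁ : IsCoprime (r : ℤ) (a i₁)) (k : ℤ)
    (hk : ∀ i, ¬ (r : ℤ) ∣ k * a i) :
    cyclicMld r a ≤ (((∑ i, Int.fract ((k * a i : ℚ) / r) : ℚ) : ℝ) : EReal) := by
  obtain ⟨c⟩ := ToricCoordinates.nonempty hr h₀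
  have hr' : (r : ℚ) ≠ 0 := by exact_mod_cast hr
  have hdvd (i : Fin d) : ∃ n : ℤ, (a i : ℚ) + c.e i * a i₀ = r * n := by exact_mod_cast c.dvd i
  choose n hn using hdvd
  have hpos (i : Fin d) : 0 < Int.fract ((k * a i : ℚ) / r) := by
    refine (Int.fract_nonneg _).lt_of_ne' fun hfract => hk i ?_
    obtain ⟨l, hl⟩ := Int.fract_eq_zero_iff.1 hfract
    rw [eq_div_iff hr'] at hl
    refine ⟨l, ?_⟩
    rw [mul_comm (r : ℤ)]
    exact_mod_cast hl.symm
  obtain ⟨E, q, hE, hq, hle⟩ := c.exists_isLogDiscrepancy_le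
    (F := FractionRing (coordRing r a)) hi h₁ hpos
    (w := fun i => k * n i - ⌊(k * a i : ℚ) / r⌋ - c.e i * ⌊(k * a i₀ : ℚ) / r⌋) fun i => by
      simp only [Int.fract]
      push_cast
      field_simp
      linear_combination -(k : ℚ) * hn i
  have hmld : cyclicMld r a ≤ ((q : ℝ) : EReal) := sInf_le ⟨E, q, hE, hq, rfl⟩
  exact hmld.trans (by exact_mod_cast hle)

theorem exists_of_cyclicMld_lt {d r : ℕ} {a : Fin d → ℤ} (hr : r ≠ 0) {i₀ i₁ : Fin d}
    (hi : i₁ ≠ i₀) (h₀ : IsCoprime (r : ℤ) (a i₀)) (h₁ : IsCoprime (r : ℤ) (a i₁)) {b : ℝ}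
    (hb : cyclicMld r a < (b : EReal)) :
    ∃ (v : Fin d → ℚ) (k : ℤ), (∀ i, 0 < v i) ∧ (∀ i, ∃ n : ℤ, v i = k * a i / r + n) ∧
      ((∑ i, v i : ℚ) : ℝ) < b := by
  obtain ⟨c⟩ := ToricCoordinates.nonempty hr h₀
  obtain ⟨_, ⟨E, q, hE, hq, rfl⟩, hlt⟩ := sInf_lt_iff.1 hb
  obtain ⟨v, k, hv, hvk, hvq⟩ := c.exists_sum_le_of_isLogDiscrepancy hi h₁ E hE hq
  have hvq' : ((∑ i, v i : ℚ) : ℝ) ≤ q := by exact_mod_cast hvq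
  exact ⟨v, k, hv, hvk, hvq'.trans_lt (EReal.coe_lt_coe_iff.1 hlt)⟩

section Units

theorem exists_coprime_mid {q : ℕ} (hq : 2 ≤ q) :
    ∃ y : ℕ, y.Coprime q ∧ q ≤ 6 * y ∧ 6 * y ≤ 5 * q := by
  rcases Nat.even_or_odd' q with ⟨n, rfl | rfl⟩
  · rcases Nat.even_or_odd' n with ⟨m, rfl | rfl⟩
    · obtain ⟨m, rfl⟩ : ∃ l, m = l + 1 := ⟨m - 1, by omega⟩
      have h : 2 * (2 * (m + 1)) = (2 * m + 1) * 2 + 2 := by ring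
      refine ⟨2 * m + 1, ?_, by omega, by omega⟩
      rw [h, Nat.coprime_mul_left_add_right]
      simp
    · rcases m.eq_zero_or_pos with rfl | hm
      · exact ⟨1, by simp, by omega, by omega⟩
      obtain ⟨m, rfl⟩ : ∃ l, m = l + 1 := ⟨m - 1, by omega⟩
      have h : 2 * (2 * (m + 1) + 1) = (2 * m + 1) * 2 + 2 ^ 2 := by ring
      refine ⟨2 * m + 1, ?_, by omega, by omega⟩
      rw [h, Nat.coprime_mul_left_add_right]
      exact Nat.Coprime.pow_right 2 (by simp)
  · refine ⟨n, ?_, by omega, by omega⟩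
    rw [Nat.coprime_mul_right_add_right]
    exact Nat.coprime_one_right n

theorem exists_isCoprime_mul_modEq {p y : ℤ} {q D : ℕ} (hqD : 0 < q * D) (hp : IsCoprime p q)
    (hy : IsCoprime y q) : ∃ u : ℤ, IsCoprime u D ∧ u * p ≡ y [ZMOD q] := by
  have : NeZero (q * D) := ⟨hqD.ne'⟩
  obtain ⟨u, hu⟩ := ZMod.unitsMap_surjective (dvd_mul_right q D)
    (ZMod.unitOfIsCoprime y hy * (ZMod.unitOfIsCoprime p hp)⁻¹)
  have hval : (((u : ZMod (q * D)).val : ℤ) : ZMod q) * p = y := by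
    have h := congrArg Units.val (eq_mul_inv_iff_mul_eq.1 hu)
    rw [Units.val_mul, ZMod.unitsMap_val, ZMod.coe_unitOfIsCoprime, ZMod.coe_unitOfIsCoprime,
      ZMod.cast_eq_val] at h
    exact_mod_cast h
  refine ⟨(u : ZMod (q * D)).val,
    (Nat.isCoprime_iff_coprime.2 (ZMod.val_coe_unit_coprime u)).of_isCoprime_of_dvd_right ?_, ?_⟩
  · exact_mod_cast dvd_mul_left D q
  · rw [← ZMod.intCast_eq_intCast_iff]
    exact_mod_cast hval

theorem exists_isCoprime_fract_mul_mem_Icc {x : ℚ} (hx : ∀ n : ℤ, x ≠ n) {D : ℕ} (hD : 0 < D) :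
    ∃ u : ℤ, IsCoprime u D ∧ Int.fract (u * x) ∈ Set.Icc (1 / 6) (5 / 6) := by
  have hden : x.den ≠ 1 := fun h => hx x.num ((Rat.den_eq_one_iff x).1 h).symm
  obtain ⟨y, hy, hlow, hup⟩ := exists_coprime_mid (by have := x.pos; omega : 2 ≤ x.den)
  obtain ⟨u, hu, hmod⟩ := exists_isCoprime_mul_modEq (Nat.mul_pos x.pos hD)
    (Int.isCoprime_iff_gcd_eq_one.2 x.reduced) (Nat.isCoprime_iff_coprime.2 hy)
  refine ⟨u, hu, ?_⟩
  obtain ⟨n, hn⟩ := hmod.symm.dvd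
  have hpos : (0 : ℚ) < x.den := by exact_mod_cast x.pos
  have hlow' : (x.den : ℚ) ≤ 6 * y := by exact_mod_cast hlow
  have hup' : (6 * y : ℚ) ≤ 5 * x.den := by exact_mod_cast hup
  have hux : u * x = y / x.den + n := by
    have hn' : (u * x.num - y : ℚ) = x.den * n := by exact_mod_cast hn
    conv_lhs => rw [← Rat.num_div_den x]
    field_simp
    linear_combination hn'
  have hge : (1 / 6 : ℚ) ≤ y / x.den := by rw [div_le_div_iff₀ (by norm_num) hpos]; linarith
  have hle : (y / x.den : ℚ) ≤ 5 / 6 := by rw [div_le_div_iff₀ hpos (by norm_num)]; linarith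
  rw [hux, Int.fract_add_intCast, Int.fract_eq_self.2 ⟨by linarith, by linarith⟩]
  exact ⟨hge, hle⟩

end Units

section DirectedFloor

open Filter Topology

/-- The value of the floor function at `x + t * w` for all small `t > 0`. -/
def directedFloor (w : ℤ) (x : ℝ) : ℤ := if 0 ≤ w then ⌊x⌋ else ⌈x⌉ - 1

theorem eventually_floor_eq_directedFloor (w : ℤ) (x t₀ : ℝ) :
    ∀ᶠ t : ℝ in 𝓝[>] t₀, ⌊x + t * w⌋ = directedFloor w (x + t₀ * w) := by
  have hcont : Tendsto (fun t : ℝ => x + t * w) (𝓝[>] t₀) (𝓝 (x + t₀ * w)) :=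
    ((by fun_prop : Continuous fun t : ℝ => x + t * w).tendsto t₀).mono_left nhdsWithin_le_nhds
  rw [directedFloor]
  split_ifs with hw
  · refine ((tendsto_nhdsWithin_iff.2 ⟨hcont, ?_⟩).eventually
      (tendsto_pure.1 (tendsto_floor_right_pure_floor _)))
    filter_upwards [self_mem_nhdsWithin] with t ht
    exact add_le_add_right (mul_le_mul_of_nonneg_right (le_of_lt ht) (Int.cast_nonneg hw)) x
  · refine ((tendsto_nhdsWithin_iff.2 ⟨hcont, ?_⟩).eventually
      (tendsto_pure.1 (tendsto_floor_left_pure_ceil_sub_one _)))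
    filter_upwards [self_mem_nhdsWithin] with t ht
    exact add_lt_add_right (mul_lt_mul_of_neg_right ht (Int.cast_lt_zero.2 (not_le.1 hw))) x

theorem eventually_floor_eq_directedFloor_neg (w : ℤ) (x t₀ : ℝ) :
    ∀ᶠ t : ℝ in 𝓝[<] t₀, ⌊x + t * w⌋ = directedFloor (-w) (x + t₀ * w) := by
  have h := tendsto_neg_nhdsLT.eventually (eventually_floor_eq_directedFloor (-w) x (-t₀))
  simpa only [Int.cast_neg, neg_mul_neg] using h

theorem eventually_sum_floor_eq {ι : Type*} [Fintype ι] {w : ι → ℤ} {x : ι → ℝ} {t₀ : ℝ}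
    (h : ∑ i, directedFloor (w i) (x i + t₀ * w i) =
      ∑ i, directedFloor (-w i) (x i + t₀ * w i)) :
    ∀ᶠ t : ℝ in 𝓝[≠] t₀,
      ∑ i, ⌊x i + t * w i⌋ = ∑ i, directedFloor (w i) (x i + t₀ * w i) := by
  rw [← nhdsLT_sup_nhdsGT, eventually_sup]
  constructor
  · filter_upwards [eventually_all.2 fun i =>
      eventually_floor_eq_directedFloor_neg (w i) (x i) t₀] with t ht
    rw [h, Finset.sum_congr rfl fun i _ => ht i]
  · filter_upwards [eventually_all.2 fun i =>
      eventually_floor_eq_directedFloor (w i) (x i) t₀] with t ht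
    exact Finset.sum_congr rfl fun i _ => ht i

theorem eventually_floor_eq {x : ℝ} (hx : ∀ n : ℤ, x ≠ n) : ∀ᶠ y in 𝓝 x, ⌊y⌋ = ⌊x⌋ := by
  filter_upwards [Ioo_mem_nhds (lt_of_le_of_ne (Int.floor_le x) (hx _).symm)
    (Int.lt_floor_add_one x)] with y hy
  exact Int.floor_eq_iff.2 ⟨hy.1.le, hy.2⟩

theorem directedFloor_eq_floor {x : ℝ} (hx : ∀ n : ℤ, x ≠ n) (w : ℤ) :
    directedFloor w x = ⌊x⌋ := by
  have hceil : ⌈x⌉ = ⌊x⌋ + 1 := Int.ceil_eq_iff.2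
    ⟨by push_cast; linarith [lt_of_le_of_ne (Int.floor_le x) (hx _).symm],
      by exact_mod_cast (Int.lt_floor_add_one x).le⟩
  rw [directedFloor, hceil, add_sub_cancel_right, ite_self]

theorem directedFloor_neg_sub_directedFloor (w n : ℤ) :
    directedFloor w n - directedFloor (-w) n = w.sign := by
  simp only [directedFloor, Int.floor_intCast, Int.ceil_intCast]
  rcases lt_trichotomy w 0 with hw | rfl | hw
  · rw [if_neg (by omega), if_pos (by omega), Int.sign_eq_neg_one_of_neg hw]; ring
  · simp
  · rw [if_pos hw.le, if_neg (by omega), Int.sign_eq_one_of_pos hw]; ring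

theorem eventually_add_mul_ne_intCast {x w : ℝ} (h : w = 0 → ∀ n : ℤ, x ≠ n) (t₀ : ℝ) :
    ∀ᶠ t in 𝓝[≠] t₀, ∀ n : ℤ, x + t * w ≠ n := by
  rcases eq_or_ne w 0 with rfl | hw
  · simpa using h rfl
  have hclosed : IsClosed (((↑) : ℤ → ℝ) '' {n : ℤ | (n : ℝ) ≠ x + t₀ * w}) :=
    Int.isClosedEmbedding_coe_real.isClosedMap _ (isClosed_discrete _)
  have hnhds : ∀ᶠ y in 𝓝 (x + t₀ * w), y ∉ ((↑) '' {n : ℤ | (n : ℝ) ≠ x + t₀ * w} : Set ℝ) :=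
    hclosed.isOpen_compl.mem_nhds fun ⟨_, hn, hn'⟩ => hn hn'
  have hcont : Tendsto (fun t : ℝ => x + t * w) (𝓝 t₀) (𝓝 (x + t₀ * w)) :=
    (by fun_prop : Continuous fun t : ℝ => x + t * w).tendsto t₀
  filter_upwards [nhdsWithin_le_nhds (hcont.eventually hnhds), self_mem_nhdsWithin]
    with t ht ht0 n hn
  refine ht ⟨n, fun hnx => ht0 ?_, hn.symm⟩
  exact mul_right_cancel₀ hw (by linarith)

theorem eventually_eq_of_isPreconnected {X α : Type*} [TopologicalSpace X] [T1Space X]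
    [∀ t : X, (𝓝[≠] t).NeBot] {s : Set X} (hs : IsPreconnected s) {f : X → α}
    (hf : ∀ t ∈ s, ∃ m, ∀ᶠ t' in 𝓝[≠] t, f t' = m) {m : α} {t₁ : X} (ht₁ : t₁ ∈ s)
    (hm : ∀ᶠ t in 𝓝[≠] t₁, f t = m) {t₂ : X} (ht₂ : t₂ ∈ s) : ∀ᶠ t in 𝓝[≠] t₂, f t = m := by
  have hopen (p : α → Prop) : IsOpen {t | ∃ m', p m' ∧ ∀ᶠ t' in 𝓝[≠] t, f t' = m'} := by
    refine isOpen_iff_mem_nhds.2 fun t ⟨m', hp, hm'⟩ => ?_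
    have hnear := eventually_nhdsWithin_iff.1 (eventually_nhdsNE_eventually_nhds_iff.2 hm')
    filter_upwards [hnear] with y hy
    rcases eq_or_ne y t with rfl | hyt
    · exact ⟨m', hp, hm'⟩
    · exact ⟨m', hp, (hy hyt).filter_mono nhdsWithin_le_nhds⟩
  have hdisj : Disjoint {t | ∃ m', m' = m ∧ ∀ᶠ t' in 𝓝[≠] t, f t' = m'}
      {t | ∃ m', m' ≠ m ∧ ∀ᶠ t' in 𝓝[≠] t, f t' = m'} := by
    refine Set.disjoint_left.2 fun t ⟨_, hm₁, h₁⟩ ⟨_, hm₂, h₂⟩ => ?_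
    obtain ⟨t', ht₁, ht₂⟩ := (h₁.and h₂).exists
    exact hm₂ (ht₂.symm.trans (ht₁.trans hm₁))
  obtain ⟨_, rfl, h⟩ := hs.subset_left_of_subset_union (hopen _) (hopen _) hdisj
    (fun t ht => (hf t ht).elim fun m' hm' => (em (m' = m)).imp (⟨m', ·, hm'⟩) (⟨m', ·, hm'⟩))
    ⟨t₁, ht₁, m, rfl, hm⟩ ht₂
  exact h

end DirectedFloor

section LargeSums

open Filter Topology

variable {ι : Type*} [Fintype ι]

theorem exists_intCast_eq_of_isCoprime {u D : ℤ} (h : IsCoprime u D) {x : ℝ}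
    (hu : ∃ n : ℤ, u * x = n) (hD : ∃ n : ℤ, D * x = n) : ∃ n : ℤ, x = n := by
  obtain ⟨a, b, hab⟩ := h
  obtain ⟨m, hm⟩ := hu
  obtain ⟨n, hn⟩ := hD
  have hab' : (a * u + b * D : ℝ) = 1 := by exact_mod_cast hab
  refine ⟨a * m + b * n, ?_⟩
  push_cast
  linear_combination a * hm + b * hn - x * hab'

theorem exists_prod_den_mul_eq_intCast (q : ι → ℚ) (i : ι) :
    ∃ n : ℤ, ((∏ j, (q j).den : ℕ) : ℤ) * (q i : ℝ) = n := by
  obtain ⟨m, hm⟩ := Finset.dvd_prod_of_mem (fun j => (q j).den) (Finset.mem_univ i)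
  refine ⟨m * (q i).num, ?_⟩
  have h : ((q i).den * q i : ℝ) = (q i).num := by exact_mod_cast Rat.den_mul_eq_num (q i)
  rw [hm]
  push_cast
  linear_combination (m : ℝ) * h

/-- The fractional parts of every point of `K` without integral coordinates have sum at least
`c - δ`. The multiples of `a / r` modulo `ℤ^ι` have this property if the minimal log discrepancy of
the cyclic quotient is at least `c - δ`. -/
def HasLargeSums (K : AddSubgroup (ι → ℝ)) (c : ℕ) (δ : ℝ) : Prop :=
  ∀ x ∈ K, (∀ i, ∀ n : ℤ, x i ≠ n) → c - δ ≤ ∑ i, Int.fract (x i)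

namespace HasLargeSums

variable {K : AddSubgroup (ι → ℝ)} {c : ℕ} {δ : ℝ} (hK : HasLargeSums K c δ)
  (hcard : Fintype.card ι = 2 * c + 1)

include hK hcard

theorem sum_fract_le {x : ι → ℝ} (hx : x ∈ K) (hxn : ∀ i, ∀ n : ℤ, x i ≠ n) :
    ∑ i, Int.fract (x i) ≤ c + 1 + δ := by
  have hfract (i : ι) : Int.fract ((-x) i) = 1 - Int.fract (x i) := Int.fract_neg fun h =>
    (Int.fract_eq_zero_iff.1 h).elim fun n hn => hxn i n hn.symm
  have hneg := hK (-x) (neg_mem hx) fun i n hn => hxn i (-n) (by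
    push_cast; rw [← hn, Pi.neg_apply, neg_neg])
  simp only [hfract, Finset.sum_sub_distrib, Finset.sum_const, Finset.card_univ, hcard,
    nsmul_eq_mul, mul_one] at hneg
  push_cast at hneg
  linarith

theorem sum_floor_eq {x : ι → ℝ} (hx : x ∈ K) (hxn : ∀ i, ∀ n : ℤ, x i ≠ n) {n : ℤ}
    (hn : ∑ i, x i ∈ Set.Ioo (n + δ) (n + 1 - δ)) : ∑ i, ⌊x i⌋ = n - c := by
  have hsum : ∑ i, Int.fract (x i) = ∑ i, x i - (∑ i, ⌊x i⌋ : ℤ) := by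
    simp only [Int.fract, Finset.sum_sub_distrib, Int.cast_sum]
  have hlow := hK x hx hxn
  have hup := hK.sum_fract_le hcard hx hxn
  refine le_antisymm (Int.lt_add_one_iff.1 ?_) (Int.sub_one_lt_iff.1 ?_) <;>
    rw [← Int.cast_lt (R := ℝ)]
  · rw [Int.cast_add, Int.cast_sub, Int.cast_natCast, Int.cast_one]
    linarith [hn.2]
  · rw [Int.cast_sub, Int.cast_sub, Int.cast_natCast, Int.cast_one]
    linarith [hn.1]

variable {v : ι → ℤ} (hv : ∀ t : ℝ, (fun i => t * v i) ∈ K)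

include hv

theorem sum_directedFloor_eq {x : ι → ℝ} (hx : x ∈ K) (hxn : ∀ i, v i = 0 → ∀ n : ℤ, x i ≠ n)
    {n : ℤ} (hn : ∑ i, x i ∈ Set.Ioo (n + δ) (n + 1 - δ)) :
    ∑ i, directedFloor (v i) (x i) = n - c := by
  have hcont : Tendsto (fun t : ℝ => ∑ i, (x i + t * v i)) (𝓝[>] 0) (𝓝 (∑ i, x i)) :=
    ((by fun_prop : Continuous fun t : ℝ => ∑ i, (x i + t * v i)).tendsto' 0 _ (by simp)).mono_left
      nhdsWithin_le_nhds
  have hnonint : ∀ᶠ t : ℝ in 𝓝[>] 0, ∀ i, ∀ n : ℤ, x i + t * v i ≠ n :=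
    eventually_all.2 fun i => (eventually_add_mul_ne_intCast (fun h =>
      hxn i (Int.cast_eq_zero.1 h)) 0).filter_mono (nhdsWithin_mono _ fun _ => ne_of_gt)
  obtain ⟨t, hfloor, htn, ht⟩ := ((eventually_all.2 fun i =>
    eventually_floor_eq_directedFloor (v i) (x i) 0).and
    (hnonint.and (hcont.eventually (Ioo_mem_nhds hn.1 hn.2)))).exists
  rw [← hK.sum_floor_eq hcard (add_mem hx (hv t)) htn ht]
  exact Finset.sum_congr rfl fun i _ => by simpa using (hfloor i).symm

theorem sum_directedFloor_neg_eq {x : ι → ℝ} (hx : x ∈ K)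
    (hxn : ∀ i, v i = 0 → ∀ n : ℤ, x i ≠ n) {n : ℤ}
    (hn : ∑ i, x i ∈ Set.Ioo (n + δ) (n + 1 - δ)) :
    ∑ i, directedFloor (-v i) (x i) = n - c :=
  hK.sum_directedFloor_eq hcard (v := -v)
    (fun t => by simpa using hv (-t)) hx (fun i hi => hxn i (neg_eq_zero.1 hi)) hn

/-- Both sides of the asserted equality are known when the coordinate sum is far from the integers.
A multiple by an integer prime to all denominators has this property, and it has the same integral
coordinates. -/
theorem sum_directedFloor_eq_sum_directedFloor_neg (hδ : δ < 1 / 6) {q : ι → ℚ}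
    (hq : (fun i => (q i : ℝ)) ∈ K) (hqn : ∀ i, v i = 0 → ∀ n : ℤ, (q i : ℝ) ≠ n)
    (hsum : ∀ n : ℤ, ∑ i, q i ≠ n) :
    ∑ i, directedFloor (v i) (q i) = ∑ i, directedFloor (-v i) (q i) := by
  obtain ⟨u, hu, hfract⟩ := exists_isCoprime_fract_mul_mem_Icc hsum
    (Finset.prod_pos fun i (_ : i ∈ Finset.univ) => (q i).pos)
  have hinteger (i : ι) (h : ∃ n : ℤ, u * (q i : ℝ) = n) : ∃ n : ℤ, (q i : ℝ) = n :=
    exists_intCast_eq_of_isCoprime hu h (exists_prod_den_mul_eq_intCast q i)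
  have hx : (fun i => u * (q i : ℝ)) ∈ K := by
    convert zsmul_mem hq u using 1
    ext i
    simp
  have hxn (i : ι) (hi : v i = 0) (n : ℤ) (hn : u * (q i : ℝ) = n) : False :=
    (hinteger i ⟨n, hn⟩).elim (hqn i hi)
  have hxsum : ∑ i, u * (q i : ℝ) ∈
      Set.Ioo ((⌊u * ∑ i, q i⌋ : ℤ) + δ) ((⌊u * ∑ i, q i⌋ : ℤ) + 1 - δ) := by
    have hsum' : ∑ i, u * (q i : ℝ) = ((⌊u * ∑ i, q i⌋ + Int.fract (u * ∑ i, q i) : ℚ) : ℝ) := by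
      rw [Int.floor_add_fract]; push_cast [Finset.mul_sum]; rfl
    have hlow : (1 / 6 : ℝ) ≤ (Int.fract (u * ∑ i, q i) : ℚ) := by
      simpa using (Rat.cast_le (K := ℝ)).2 hfract.1
    have hup : ((Int.fract (u * ∑ i, q i) : ℚ) : ℝ) ≤ 5 / 6 := by
      simpa using (Rat.cast_le (K := ℝ)).2 hfract.2
    rw [hsum', Rat.cast_add, Rat.cast_intCast]
    constructor <;> linarith
  have hterm (i : ι) : directedFloor (v i) (q i) - directedFloor (-v i) (q i) =
      directedFloor (v i) (u * q i) - directedFloor (-v i) (u * q i) := by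
    by_cases hi : ∃ n : ℤ, (q i : ℝ) = n
    · obtain ⟨n, hn⟩ := hi
      rw [hn, ← Int.cast_mul, directedFloor_neg_sub_directedFloor,
        directedFloor_neg_sub_directedFloor]
    · have hi' : ∀ n : ℤ, u * (q i : ℝ) ≠ n := fun n hn => hi (hinteger i ⟨n, hn⟩)
      push Not at hi
      simp only [directedFloor_eq_floor hi, directedFloor_eq_floor hi', sub_self]
  rw [← sub_eq_zero, ← Finset.sum_sub_distrib, Finset.sum_congr rfl fun i _ => hterm i,
    Finset.sum_sub_distrib, hK.sum_directedFloor_eq hcard hv hx hxn hxsum,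
    hK.sum_directedFloor_neg_eq hcard hv hx hxn hxsum, sub_self]

theorem exists_eventually_sum_floor_eq (hδ : δ < 1 / 6) {q : ι → ℚ}
    (hq : (fun i => (q i : ℝ)) ∈ K) (hqn : ∀ i, ∀ n : ℤ, (q i : ℝ) ≠ n) {t : ℝ}
    (ht : ∀ n : ℤ, ∑ i, (q i + t * v i) ≠ n) :
    ∃ m, ∀ᶠ t' : ℝ in 𝓝[≠] t, ∑ i, ⌊q i + t' * v i⌋ = m := by
  refine ⟨_, eventually_sum_floor_eq ?_⟩
  by_cases hrat : ∃ t' : ℚ, (t' : ℝ) = t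
  · obtain ⟨t', rfl⟩ := hrat
    have h := hK.sum_directedFloor_eq_sum_directedFloor_neg hcard hv hδ
      (q := fun i => q i + t' * v i) (by push_cast; exact add_mem hq (hv t'))
      (fun i hi n => by simpa [hi] using hqn i n)
      (fun n hn => ht n (by exact_mod_cast hn))
    push_cast at h
    exact h
  · refine Finset.sum_congr rfl fun i _ => ?_
    have hnonint (n : ℤ) : q i + t * v i ≠ n := by
      rcases eq_or_ne (v i) 0 with hi | hi
      · simpa [hi] using hqn i n
      · exact (((Irrational.mul_intCast hrat hi).ratCast_add (q i))).ne_int n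
    rw [directedFloor_eq_floor hnonint, directedFloor_eq_floor hnonint]

/-- The sum of the floors along the line `q + t • v` is locally constant wherever the coordinate sum
is not an integer, and it is known where the coordinate sum is a half-integer. -/
theorem eventually_sum_floor_eq_of_mem_Ioo (hδ : δ < 1 / 6) (hv₀ : 0 < ∑ i, v i) {q : ι → ℚ}
    (hq : (fun i => (q i : ℝ)) ∈ K) (hqn : ∀ i, ∀ n : ℤ, (q i : ℝ) ≠ n) {n : ℤ} {t₀ : ℝ}
    (ht₀ : ∑ i, (q i + t₀ * v i) ∈ Set.Ioo (n : ℝ) (n + 1)) :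
    ∀ᶠ t : ℝ in 𝓝[≠] t₀, ∑ i, ⌊q i + t * v i⌋ = n - c := by
  have hs : (0 : ℝ) < ∑ i, (v i : ℝ) := by exact_mod_cast hv₀
  have hsum (t : ℝ) : ∑ i, (q i + t * v i) = ∑ i, (q i : ℝ) + t * ∑ i, (v i : ℝ) := by
    rw [Finset.sum_add_distrib, Finset.mul_sum]
  have hmem (t : ℝ) : t ∈ Set.Ioo ((n - ∑ i, (q i : ℝ)) / ∑ i, (v i : ℝ))
      ((n + 1 - ∑ i, (q i : ℝ)) / ∑ i, (v i : ℝ)) ↔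
      ∑ i, (q i + t * v i) ∈ Set.Ioo (n : ℝ) (n + 1) := by
    rw [Set.mem_Ioo, Set.mem_Ioo, div_lt_iff₀ hs, lt_div_iff₀ hs, hsum, sub_lt_iff_lt_add',
      lt_sub_iff_add_lt']
  obtain ⟨t₁, ht₁⟩ : ∃ t₁ : ℝ, ∑ i, (q i + t₁ * v i) = n + 1 / 2 :=
    ⟨(n + 1 / 2 - ∑ i, (q i : ℝ)) / ∑ i, (v i : ℝ), by rw [hsum, div_mul_cancel₀ _ hs.ne']; ring⟩
  have hclose : ∀ᶠ t : ℝ in 𝓝 t₁, ∑ i, (q i + t * v i) ∈ Set.Ioo (n + δ) (n + 1 - δ) :=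
    ((by fun_prop : Continuous fun t : ℝ => ∑ i, (q i + t * v i)).tendsto' t₁ _ ht₁).eventually
      (Ioo_mem_nhds (by linarith) (by linarith))
  have hmid : ∀ᶠ t : ℝ in 𝓝[≠] t₁, ∑ i, ⌊q i + t * v i⌋ = n - c := by
    filter_upwards [nhdsWithin_le_nhds hclose, eventually_all.2 fun i =>
      eventually_add_mul_ne_intCast (w := (v i : ℝ)) (fun _ => hqn i) t₁] with t ht htn
    exact hK.sum_floor_eq hcard (add_mem hq (hv t)) htn ht
  refine eventually_eq_of_isPreconnected isPreconnected_Ioo (fun t ht =>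
    hK.exists_eventually_sum_floor_eq hcard hv hδ hq hqn fun k hk => ?_)
    ((hmem t₁).2 (by rw [ht₁]; constructor <;> linarith)) hmid ((hmem t₀).2 ht₀)
  have hk' := (hmem t).1 ht
  rw [hk] at hk'
  have hlow : n < k := by exact_mod_cast hk'.1
  have hup : k < n + 1 := by exact_mod_cast hk'.2
  omega

theorem le_sum_fract (hδ : δ < 1 / 6) (hv₀ : 0 < ∑ i, v i) {q : ι → ℚ}
    (hq : (fun i => (q i : ℝ)) ∈ K) (hqn : ∀ i, ∀ n : ℤ, (q i : ℝ) ≠ n) :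
    (c : ℝ) ≤ ∑ i, Int.fract (q i : ℝ) := by
  set n := ⌊∑ i, (q i : ℝ)⌋
  have hfloor : ∀ᶠ t : ℝ in 𝓝 0, ∀ i, ⌊q i + t * v i⌋ = ⌊(q i : ℝ)⌋ := eventually_all.2 fun i =>
    ((by fun_prop : Continuous fun t : ℝ => q i + t * v i).tendsto' 0 (q i : ℝ)
      (by simp)).eventually (eventually_floor_eq (hqn i))
  have hlt : ∀ᶠ t : ℝ in 𝓝 0, ∑ i, (q i + t * v i) < n + 1 :=
    ((by fun_prop : Continuous fun t : ℝ => ∑ i, (q i + t * v i)).tendsto' 0 (∑ i, (q i : ℝ))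
      (by simp)).eventually (gt_mem_nhds (Int.lt_floor_add_one _))
  have hgt : ∀ᶠ t : ℝ in 𝓝[>] 0, n < ∑ i, (q i + t * v i) := by
    filter_upwards [self_mem_nhdsWithin] with t ht
    have hs : (0 : ℝ) < ∑ i, (v i : ℝ) := by exact_mod_cast hv₀
    rw [Finset.sum_add_distrib, ← Finset.mul_sum]
    exact (Int.floor_le _).trans_lt (lt_add_of_pos_right _ (mul_pos ht hs))
  obtain ⟨t₀, hgt₀, hlt₀, hfloor₀⟩ := (hgt.and (nhdsWithin_le_nhds
    (hlt.and (eventually_eventually_nhds.2 hfloor)))).exists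
  obtain ⟨t, ht, ht'⟩ := ((hK.eventually_sum_floor_eq_of_mem_Ioo hcard hv hδ hv₀ hq hqn
    ⟨hgt₀, hlt₀⟩).and (nhdsWithin_le_nhds hfloor₀)).exists
  rw [Finset.sum_congr rfl fun i _ => ht' i] at ht
  have htotal : ∑ i, (⌊(q i : ℝ)⌋ : ℝ) = n - c := by exact_mod_cast ht
  simp only [Int.fract, Finset.sum_sub_distrib, htotal]
  linarith [Int.floor_le (∑ i, (q i : ℝ))]

end HasLargeSums

end LargeSums

section Kronecker

open Filter Topology

theorem sum_fourierChar_mul_div {r : ℕ} [NeZero r] (q : ℤ) :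
    ∑ k : ZMod r, (Real.fourierChar ((k.val * q : ℝ) / r) : ℂ) =
      if (r : ℤ) ∣ q then (r : ℂ) else 0 := by
  have hterm (k : ZMod r) :
      (Real.fourierChar ((k.val * q : ℝ) / r) : ℂ) = ZMod.stdAddChar (k * (q : ZMod r)) := by
    have hk : k * (q : ZMod r) = ((k.val * q : ℤ) : ZMod r) := by simp
    rw [hk, ZMod.stdAddChar_coe, Real.fourierChar_apply]
    push_cast
    ring_nf
  rw [Finset.sum_congr rfl fun k _ => hterm k,
    AddChar.sum_mulShift _ (ZMod.isPrimitive_stdAddChar r), ZMod.card]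
  simp only [ZMod.intCast_zmod_eq_zero_iff_dvd, Nat.cast_ite, Nat.cast_zero]

theorem normSq_one_add_fourierChar (t : ℝ) :
    ‖1 + (Real.fourierChar t : ℂ)‖ ^ 2 = 4 * Real.cos (Real.pi * t) ^ 2 := by
  have h : (2 * Real.pi * t : ℝ) = 2 * (Real.pi * t) := by ring
  rw [Real.fourierChar_apply, Complex.sq_norm, Complex.exp_mul_I, Complex.normSq_apply, h]
  simp only [← Complex.ofReal_cos, ← Complex.ofReal_sin, Complex.add_re, Complex.one_re,
    Complex.ofReal_re, Complex.mul_re, Complex.I_re, Complex.ofReal_im, Complex.I_im,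
    Complex.add_im, Complex.one_im, Complex.mul_im]
  rw [Real.cos_two_mul, Real.sin_two_mul]
  nlinarith [Real.sin_sq_add_cos_sq (Real.pi * t)]

theorem norm_one_add_fourierChar_le (t : ℝ) : ‖1 + (Real.fourierChar t : ℂ)‖ ≤ 2 :=
  (norm_add_le _ _).trans_eq (by rw [norm_one, Circle.norm_coe, one_add_one_eq_two])

theorem exists_normSq_one_add_fourierChar_le {η : ℝ} (hη : 0 < η) : ∃ q : ℝ, 0 ≤ q ∧ q < 1 ∧
    ∀ t : ℝ, (∀ n : ℤ, η ≤ |t - n|) → ‖1 + (Real.fourierChar t : ℂ)‖ ^ 2 ≤ 4 * q := by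
  set δ := min η (1 / 2)
  have hδ : 0 < δ := lt_min hη (by norm_num)
  have hδ' : Real.pi * δ ≤ Real.pi / 2 := by
    nlinarith [Real.pi_pos, min_le_right η (1 / 2)]
  refine ⟨Real.cos (Real.pi * δ) ^ 2, sq_nonneg _, ?_, fun t ht => ?_⟩
  · have hsin : 0 < Real.sin (Real.pi * δ) :=
      Real.sin_pos_of_pos_of_lt_pi (by positivity) (by linarith [Real.pi_pos])
    nlinarith [Real.sin_sq_add_cos_sq (Real.pi * δ)]
  · set τ := |t - round t|
    have hτ : δ ≤ τ := (min_le_left _ _).trans (ht _)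
    have hτ' : τ ≤ 1 / 2 := abs_sub_round t
    have hcos : Real.cos (Real.pi * t) ^ 2 = Real.cos (Real.pi * τ) ^ 2 := by
      have h : Real.pi * t = Real.pi * (t - round t) + round t * Real.pi := by ring
      rw [h, Real.cos_add_int_mul_pi, mul_pow, ← sq_abs ((-1 : ℝ) ^ _), abs_neg_one_zpow, one_pow,
        one_mul, ← Real.cos_abs, abs_mul, abs_of_pos Real.pi_pos]
    rw [normSq_one_add_fourierChar, hcos]
    have hpos : 0 ≤ Real.cos (Real.pi * τ) := Real.cos_nonneg_of_neg_pi_div_two_le_of_le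
      (by nlinarith [Real.pi_pos, abs_nonneg (t - round t)]) (by nlinarith [Real.pi_pos])
    have hle : Real.cos (Real.pi * τ) ≤ Real.cos (Real.pi * δ) :=
      Real.cos_le_cos_of_nonneg_of_le_pi (by positivity) (by nlinarith [Real.pi_pos])
        (mul_le_mul_of_nonneg_left hτ Real.pi_pos.le)
    gcongr

variable {ι κ : Type*} [Fintype ι]

theorem fourierChar_sum_natCast_mul (m : ι → ℕ) (y : ι → ℝ) :
    (Real.fourierChar (∑ i, m i * y i) : ℂ) = ∏ i, (Real.fourierChar (y i) : ℂ) ^ m i := by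
  simp only [Real.fourierChar_apply, ← Complex.exp_nat_mul, ← Complex.exp_sum]
  push_cast [Finset.mul_sum, Finset.sum_mul]
  exact congrArg _ (Finset.sum_congr rfl fun i _ => by ring)

theorem prod_one_add_fourierChar_pow [DecidableEq ι] (y : ι → ℝ) (p : ℕ) :
    ∏ i, (1 + (Real.fourierChar (y i) : ℂ)) ^ p =
      ∑ m ∈ Fintype.piFinset fun _ : ι => Finset.range (p + 1),
        ((∏ i, p.choose (m i) : ℕ) : ℂ) * Real.fourierChar (∑ i, m i * y i) := by
  simp only [add_comm (1 : ℂ), add_pow, one_pow, mul_one]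
  rw [Finset.prod_univ_sum]
  refine Finset.sum_congr rfl fun m _ => ?_
  rw [Finset.prod_mul_distrib, fourierChar_sum_natCast_mul, Nat.cast_prod, mul_comm]

theorem sum_prod_choose [DecidableEq ι] (p : ℕ) :
    ∑ m ∈ Fintype.piFinset fun _ : ι => Finset.range (p + 1), ∏ i, p.choose (m i) =
      (2 ^ p) ^ Fintype.card ι := by
  rw [← Finset.prod_univ_sum]
  simp [Nat.sum_range_choose]

variable {r : ℕ} [NeZero r] {a : ι → ℤ} {x : ι → ℝ}

theorem sum_fourierChar_of_annihilates {m : ι → ℤ}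
    (hx : (r : ℤ) ∣ m ⬝ᵥ a → ∃ n : ℤ, ∑ i, m i * x i = n) :
    ∑ k : ZMod r, (Real.fourierChar (∑ i, m i * ((k.val * a i : ℝ) / r - x i)) : ℂ) =
      if (r : ℤ) ∣ m ⬝ᵥ a then (r : ℂ) else 0 := by
  have hsplit (k : ZMod r) : ∑ i, m i * ((k.val * a i : ℝ) / r - x i) =
      (k.val * (m ⬝ᵥ a : ℤ) : ℝ) / r + -∑ i, m i * x i := by
    simp only [mul_sub, Finset.sum_sub_distrib, ← sub_eq_add_neg, dotProduct, Int.cast_sum,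
      Int.cast_mul, Finset.mul_sum, Finset.sum_div]
    congr 1
    exact Finset.sum_congr rfl fun i _ => by ring
  simp only [hsplit, AddChar.map_add_eq_mul, Circle.coe_mul, ← Finset.sum_mul,
    sum_fourierChar_mul_div]
  split_ifs with h
  · obtain ⟨n, hn⟩ := hx h
    have hone : (Real.fourierChar (-n : ℝ) : ℂ) = 1 := by
      rw [Real.fourierChar_apply, Complex.exp_eq_one_iff]
      exact ⟨-n, by push_cast; ring⟩
    rw [hn, hone, mul_one]
  · rw [zero_mul]

/-- Only the pairs of exponents whose difference kills `a` modulo `r` survive the summation over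
`k`; they contribute positively, and the diagonal pairs are among them. -/
theorem mul_sq_sum_le_card_mul_sum_normSq (s : Finset κ) (μ : κ → ι → ℤ) (c : κ → ℕ)
    (hx : ∀ m ∈ s, ∀ m' ∈ s, (r : ℤ) ∣ (μ m - μ m') ⬝ᵥ a →
      ∃ n : ℤ, ∑ i, (μ m - μ m') i * x i = n) :
    r * (∑ m ∈ s, (c m : ℝ)) ^ 2 ≤ s.card * ∑ k : ZMod r,
      ‖∑ m ∈ s, (c m : ℂ) * Real.fourierChar (∑ i, μ m i * ((k.val * a i : ℝ) / r - x i))‖ ^ 2 := by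
  classical
  have hsq (y : ι → ℝ) :
      ((‖∑ m ∈ s, (c m : ℂ) * Real.fourierChar (∑ i, μ m i * y i)‖ ^ 2 : ℝ) : ℂ) =
      ∑ m ∈ s, ∑ m' ∈ s, (c m * c m' : ℂ) *
        Real.fourierChar (∑ i, ((μ m - μ m') i : ℤ) * y i) := by
    rw [Complex.ofReal_pow, ← Complex.mul_conj', map_sum, Finset.sum_mul_sum]
    refine Finset.sum_congr rfl fun m _ => Finset.sum_congr rfl fun m' _ => ?_
    have hsub : ∑ i, ((μ m - μ m') i : ℤ) * y i = ∑ i, μ m i * y i + -∑ i, μ m' i * y i := by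
      simp only [Pi.sub_apply, Int.cast_sub, sub_mul, Finset.sum_sub_distrib, ← sub_eq_add_neg]
    rw [hsub, AddChar.map_add_eq_mul, AddChar.map_neg_eq_inv, Circle.coe_mul,
      Circle.coe_inv_eq_conj, map_mul, map_natCast]
    ring
  have hsum : ∑ k : ZMod r,
      ‖∑ m ∈ s, (c m : ℂ) * Real.fourierChar (∑ i, μ m i * ((k.val * a i : ℝ) / r - x i))‖ ^ 2 =
      ∑ m ∈ s, ∑ m' ∈ s, (c m * c m' : ℝ) * if (r : ℤ) ∣ (μ m - μ m') ⬝ᵥ a then (r : ℝ) else 0 := by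
    apply Complex.ofReal_injective
    push_cast [hsq, apply_ite ((↑) : ℝ → ℂ)]
    rw [Finset.sum_comm]
    refine Finset.sum_congr rfl fun m hm => ?_
    rw [Finset.sum_comm]
    refine Finset.sum_congr rfl fun m' hm' => ?_
    rw [← Finset.mul_sum, sum_fourierChar_of_annihilates (hx m hm m' hm')]
  have hdiag : ∑ m ∈ s, (c m : ℝ) ^ 2 * r ≤ ∑ m ∈ s, ∑ m' ∈ s,
      (c m * c m' : ℝ) * if (r : ℤ) ∣ (μ m - μ m') ⬝ᵥ a then (r : ℝ) else 0 := by
    refine Finset.sum_le_sum fun m hm => ?_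
    refine le_trans (le_of_eq ?_) (Finset.single_le_sum (fun m' _ => by positivity) hm)
    simp [sq]
  rw [hsum]
  calc r * (∑ m ∈ s, (c m : ℝ)) ^ 2 ≤ r * (s.card * ∑ m ∈ s, (c m : ℝ) ^ 2) := by
        gcongr; exact sq_sum_le_card_mul_sum_sq
    _ = s.card * ∑ m ∈ s, (c m : ℝ) ^ 2 * r := by rw [← Finset.sum_mul]; ring
    _ ≤ _ := by gcongr

theorem normSq_prod_one_add_fourierChar_pow_le {q : ℝ} (y : ι → ℝ) (p : ℕ) {i : ι}
    (hi : ‖1 + (Real.fourierChar (y i) : ℂ)‖ ^ 2 ≤ 4 * q) :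
    ‖∏ j, (1 + (Real.fourierChar (y j) : ℂ)) ^ p‖ ^ 2 ≤ q ^ p * ((2 ^ p) ^ Fintype.card ι) ^ 2 := by
  classical
  have herase : ∏ j ∈ Finset.univ.erase i, ‖1 + (Real.fourierChar (y j) : ℂ)‖ ^ 2 ≤
      4 ^ (Fintype.card ι - 1) := by
    rw [← Finset.card_univ, ← Finset.card_erase_of_mem (Finset.mem_univ i), ← Finset.prod_const]
    refine Finset.prod_le_prod (fun _ _ => by positivity) fun j _ => ?_
    rw [show (4 : ℝ) = 2 ^ 2 by norm_num]
    exact pow_le_pow_left₀ (norm_nonneg _) (norm_one_add_fourierChar_le _) 2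
  have hprod : ∏ j, ‖1 + (Real.fourierChar (y j) : ℂ)‖ ^ 2 ≤ q * 4 ^ Fintype.card ι := by
    rw [← Finset.mul_prod_erase _ _ (Finset.mem_univ i)]
    refine (mul_le_mul hi herase (by positivity) ((sq_nonneg _).trans hi)).trans_eq ?_
    rw [← mul_pow_sub_one (Fintype.card_pos_iff.2 ⟨i⟩).ne' (4 : ℝ)]
    ring
  calc ‖∏ j, (1 + (Real.fourierChar (y j) : ℂ)) ^ p‖ ^ 2
      = (∏ j, ‖1 + (Real.fourierChar (y j) : ℂ)‖ ^ 2) ^ p := by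
        rw [Finset.prod_pow, norm_pow, norm_prod, Finset.prod_pow, ← pow_mul, ← pow_mul, mul_comm]
    _ ≤ (q * 4 ^ Fintype.card ι) ^ p := by gcongr
    _ = q ^ p * ((2 ^ p) ^ Fintype.card ι) ^ 2 := by
        rw [mul_pow, show (4 : ℝ) = 2 ^ 2 by norm_num, ← pow_mul, ← pow_mul, ← pow_mul, ← pow_mul]
        ring_nf

theorem one_le_of_forall_exists_normSq_le {p : ℕ} {q : ℝ}
    (hx : ∀ m : ι → ℤ, (∀ i, |m i| ≤ p) → (r : ℤ) ∣ m ⬝ᵥ a → ∃ n : ℤ, ∑ i, m i * x i = n)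
    (hfar : ∀ k : ℤ, ∃ i, ‖1 + (Real.fourierChar ((k * a i : ℝ) / r - x i) : ℂ)‖ ^ 2 ≤ 4 * q) :
    1 ≤ (p + 1 : ℝ) ^ Fintype.card ι * q ^ p := by
  classical
  set s := Fintype.piFinset fun _ : ι => Finset.range (p + 1) with hs
  set M : ℝ := ((2 ^ p) ^ Fintype.card ι) ^ 2
  have hle {m : ι → ℕ} (hm : m ∈ s) (i : ι) : m i ≤ p :=
    Nat.lt_succ_iff.1 (Finset.mem_range.1 (Fintype.mem_piFinset.1 hm i))
  have hlower := mul_sq_sum_le_card_mul_sum_normSq (r := r) (a := a) (x := x) s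
    (fun m i => (m i : ℤ)) (fun m => ∏ i, p.choose (m i)) fun m hm m' hm' => hx _ fun i =>
      abs_sub_le_of_nonneg_of_le
        (Int.natCast_nonneg _) (Int.ofNat_le.2 (hle hm i)) (Int.natCast_nonneg _)
        (Int.ofNat_le.2 (hle hm' i))
  simp only [Int.cast_natCast, hs, ← prod_one_add_fourierChar_pow, ← Nat.cast_sum,
    sum_prod_choose] at hlower
  have hcard : (s.card : ℝ) = (p + 1 : ℝ) ^ Fintype.card ι := by simp [s]
  have hupper : ∑ k : ZMod r,
      ‖∏ i, (1 + (Real.fourierChar ((k.val * a i : ℝ) / r - x i) : ℂ)) ^ p‖ ^ 2 ≤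
        r * (q ^ p * M) := by
    refine (Finset.sum_le_card_nsmul Finset.univ _ (q ^ p * M) fun k _ => ?_).trans_eq (by simp)
    obtain ⟨i, hi⟩ := hfar k.val
    exact normSq_prod_one_add_fourierChar_pow_le _ p (by exact_mod_cast hi)
  have hM : 0 < r * M := mul_pos (by exact_mod_cast NeZero.pos r) (by positivity)
  refine le_of_mul_le_mul_left (a := r * M) ?_ hM
  calc r * M * 1 = r * ((((2 ^ p) ^ Fintype.card ι : ℕ)) : ℝ) ^ 2 := by simp [M]
    _ ≤ _ := hlower
    _ ≤ (p + 1 : ℝ) ^ Fintype.card ι * (r * (q ^ p * M)) := by rw [← hcard]; gcongr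
    _ = r * M * ((p + 1 : ℝ) ^ Fintype.card ι * q ^ p) := by ring

/-- Kronecker's theorem on simultaneous approximation, uniformly in `r` and `a`. -/
theorem exists_forall_exists_near_multiple (ι : Type*) [Fintype ι] {η : ℝ} (hη : 0 < η) :
    ∃ p : ℕ, ∀ (r : ℕ) (a : ι → ℤ) (x : ι → ℝ), 0 < r →
      (∀ m : ι → ℤ, (∀ i, |m i| ≤ p) → (r : ℤ) ∣ m ⬝ᵥ a → ∃ n : ℤ, ∑ i, m i * x i = n) →
      ∃ k : ℤ, ∀ i, ∃ n : ℤ, |(k * a i : ℝ) / r - x i - n| < η := by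
  obtain ⟨q, hq0, hq1, hq⟩ := exists_normSq_one_add_fourierChar_le hη
  obtain ⟨p, hp⟩ : ∃ p : ℕ, (p + 1 : ℝ) ^ Fintype.card ι * q ^ p < 1 := by
    rcases hq0.eq_or_lt with rfl | hq0
    · exact ⟨1, by simp⟩
    have h := (tendsto_pow_const_mul_const_pow_of_abs_lt_one (Fintype.card ι)
      (by rwa [abs_of_pos hq0])).comp (tendsto_add_atTop_nat 1)
    obtain ⟨p, hp⟩ := (h.eventually (gt_mem_nhds hq0)).exists
    refine ⟨p, lt_of_mul_lt_mul_right ?_ hq0.le⟩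
    simpa [pow_succ, mul_assoc] using hp
  refine ⟨p, fun r a x hr hx => ?_⟩
  have : NeZero r := ⟨hr.ne'⟩
  by_contra! hfar
  refine hp.not_ge (one_le_of_forall_exists_normSq_le hx fun k => ?_)
  obtain ⟨i, hi⟩ := hfar k
  exact ⟨i, hq _ hi⟩

end Kronecker

section EventualSubmodule

open Filter

variable {α R M : Type*}

/-- The elements that belong to `L j` eventually along the filter `l`. -/
def eventualSubmodule [Semiring R] [AddCommMonoid M] [Module R M] (l : Filter α)
    (L : α → Submodule R M) : Submodule R M where
  carrier := {m | ∀ᶠ j in l, m ∈ L j}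
  add_mem' hm hn := by filter_upwards [hm, hn] with j using add_mem
  zero_mem' := Eventually.of_forall fun j => zero_mem _
  smul_mem' c m hm := by filter_upwards [hm] with j using Submodule.smul_mem _ c

theorem eventually_eventualSubmodule_le [Semiring R] [AddCommMonoid M] [Module R M]
    [IsNoetherian R M] (l : Filter α) (L : α → Submodule R M) :
    ∀ᶠ j in l, eventualSubmodule l L ≤ L j := by
  obtain ⟨S, hS⟩ := IsNoetherian.noetherian (eventualSubmodule l L)
  have hspan : ∀ᶠ j in l, ∀ m ∈ S, m ∈ L j :=
    (eventually_all_finset S).2 fun m hm =>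
      (hS ▸ Submodule.subset_span hm : m ∈ eventualSubmodule l L)
  filter_upwards [hspan] with j hj
  exact hS ▸ Submodule.span_le.2 hj

theorem eventually_forall_mem_eventualSubmodule [Semiring R] [AddCommMonoid M] [Module R M]
    (U : Ultrafilter α) (L : α → Submodule R M) (s : Finset M) :
    ∀ᶠ j in U, ∀ m ∈ s, m ∈ L j → m ∈ eventualSubmodule (U : Filter α) L := by
  refine (eventually_all_finset s).2 fun m _ => ?_
  by_cases hm : m ∈ eventualSubmodule (U : Filter α) L
  · exact Eventually.of_forall fun _ _ => hm
  · filter_upwards [Ultrafilter.eventually_not.2 hm] with j hj hj' using absurd hj' hj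

theorem exists_linearMap_ne_zero [CommRing R] [IsDomain R] [IsPrincipalIdealRing R]
    [AddCommGroup M] [Module R M] [Module.Finite R M] {L : Submodule R M} {x : M}
    (hx : ∀ c : R, c ≠ 0 → c • x ∉ L) : ∃ φ : M →ₗ[R] R, L ≤ LinearMap.ker φ ∧ φ x ≠ 0 := by
  let T := Submodule.torsion R (M ⧸ L)
  have hne : T.mkQ (L.mkQ x) ≠ 0 := fun h => by
    obtain ⟨c, hc⟩ := (Submodule.mem_torsion_iff _).1 ((Submodule.Quotient.mk_eq_zero T).1 h)
    exact hx c (nonZeroDivisors.coe_ne_zero c) ((Submodule.Quotient.mk_eq_zero L).1 hc)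
  obtain ⟨i, hi⟩ := Finsupp.ne_iff.1
    ((Module.Free.chooseBasis R ((M ⧸ L) ⧸ T)).repr.map_ne_zero_iff.2 hne)
  refine ⟨(Module.Free.chooseBasis R ((M ⧸ L) ⧸ T)).coord i ∘ₗ T.mkQ ∘ₗ L.mkQ, ?_, hi⟩
  intro m hm
  rw [LinearMap.mem_ker, LinearMap.comp_apply, LinearMap.comp_apply, Submodule.mkQ_apply L,
    (Submodule.Quotient.mk_eq_zero L).2 hm, map_zero, map_zero]

end EventualSubmodule

section Limit

open Filter Topology

variable {ι : Type*} [Fintype ι]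

/-- The integral linear relations modulo `r` between the entries of `a`. -/
def relations (r : ℕ) (a : ι → ℤ) : Submodule ℤ (ι → ℤ) where
  carrier := {m | (r : ℤ) ∣ m ⬝ᵥ a}
  add_mem' {m n} hm hn := (dvd_add hm hn).trans (add_dotProduct m n a).symm.dvd
  zero_mem' := by simp
  smul_mem' c m hm := (Dvd.dvd.mul_left hm c).trans (smul_dotProduct c m a).symm.dvd

/-- The annihilator of `L` under the pairing of `ℤ^ι` and `ℝ^ι` with values in `ℝ/ℤ`, as a subgroup
of `ℝ^ι`. For `L = relations r a` it consists of the vectors that are congruent to a multiple of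
`a / r` modulo `ℤ^ι`. -/
def dualSubgroup (L : Submodule ℤ (ι → ℤ)) : AddSubgroup (ι → ℝ) where
  carrier := {x | ∀ m ∈ L, ∃ n : ℤ, ∑ i, m i * x i = n}
  add_mem' {x y} hx hy m hm := by
    obtain ⟨k, hk⟩ := hx m hm
    obtain ⟨l, hl⟩ := hy m hm
    exact ⟨k + l, by
      simp only [Pi.add_apply, mul_add, Finset.sum_add_distrib, hk, hl, Int.cast_add]⟩
  zero_mem' m _ := ⟨0, by simp⟩
  neg_mem' {x} hx m hm := by
    obtain ⟨k, hk⟩ := hx m hm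
    exact ⟨-k, by simp only [Pi.neg_apply, mul_neg, Finset.sum_neg_distrib, hk, Int.cast_neg]⟩

theorem mul_div_mem_dualSubgroup_relations {r : ℕ} (hr : 0 < r) (a : ι → ℤ) (k : ℤ) :
    (fun i => (k * a i : ℝ) / r) ∈ dualSubgroup (relations r a) := by
  rintro m ⟨n, hn⟩
  have hr' : (r : ℝ) ≠ 0 := by exact_mod_cast hr.ne'
  have hn' : ∑ i, (m i * a i : ℝ) = r * n := by exact_mod_cast hn
  refine ⟨k * n, ?_⟩
  calc ∑ i, (m i : ℝ) * (k * a i / r) = k / r * ∑ i, (m i * a i : ℝ) := by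
        rw [Finset.mul_sum]; exact Finset.sum_congr rfl fun i _ => by ring
    _ = (k * n : ℤ) := by rw [hn']; push_cast; field_simp

theorem mul_mem_dualSubgroup {L : Submodule ℤ (ι → ℤ)} {v : ι → ℤ} (hv : ∀ m ∈ L, m ⬝ᵥ v = 0)
    (t : ℝ) : (fun i => t * v i) ∈ dualSubgroup L := by
  intro m hm
  have h : ∑ i, (m i * v i : ℝ) = 0 := by exact_mod_cast hv m hm
  refine ⟨0, ?_⟩
  simp only [mul_left_comm _ t, ← Finset.mul_sum, h, mul_zero, Int.cast_zero]

theorem exists_dotProduct_eq_zero_of_smul_one_notMem {L : Submodule ℤ (ι → ℤ)}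
    (hL : ∀ N : ℤ, N ≠ 0 → N • (1 : ι → ℤ) ∉ L) :
    ∃ v : ι → ℤ, (∀ m ∈ L, m ⬝ᵥ v = 0) ∧ 0 < ∑ i, v i := by
  classical
  obtain ⟨φ, hφL, hφ⟩ := exists_linearMap_ne_zero hL
  have hφv (m : ι → ℤ) : m ⬝ᵥ (fun i => φ fun j => if i = j then 1 else 0) = φ m :=
    (LinearMap.pi_apply_eq_sum_univ φ m).symm
  rw [← hφv, one_dotProduct] at hφ
  rcases hφ.lt_or_gt with h | h
  · refine ⟨-fun i => φ fun j => if i = j then 1 else 0, fun m hm => ?_, by simpa using h⟩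
    rw [dotProduct_neg, hφv, hφL hm, neg_zero]
  · exact ⟨_, fun m hm => (hφv m).trans (hφL hm), h⟩

theorem eventually_sum_fract_lt {x : ι → ℝ} (hx : ∀ i, ∀ n : ℤ, x i ≠ n) {b : ℝ}
    (hb : ∑ i, Int.fract (x i) < b) :
    ∀ᶠ y : ι → ℝ in 𝓝 x, (∀ i, ∀ n : ℤ, y i ≠ n) ∧ ∑ i, Int.fract (y i) < b := by
  have hcont : Tendsto (fun y : ι → ℝ => ∑ i, Int.fract (y i)) (𝓝 x) (𝓝 (∑ i, Int.fract (x i))) :=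
    tendsto_finsetSum _ fun i _ =>
      (continuousAt_fract (hx i _)).tendsto.comp (continuous_apply i).continuousAt
  refine (eventually_all.2 fun i => ?_).and (hcont.eventually (gt_mem_nhds hb))
  have hopen : IsOpen (Set.range ((↑) : ℤ → ℝ))ᶜ :=
    Int.isClosedEmbedding_coe_real.isClosed_range.isOpen_compl
  filter_upwards [(continuous_apply i).continuousAt.eventually
    (hopen.mem_nhds fun ⟨n, hn⟩ => hx i n hn.symm)] with y hy n hn using hy ⟨n, hn.symm⟩

theorem eventually_exists_near_multiple {α : Type*} (U : Ultrafilter α) {r : α → ℕ}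
    (hr : ∀ j, 0 < r j) (a : α → ι → ℤ) {x : ι → ℝ}
    (hx : x ∈ dualSubgroup (eventualSubmodule (U : Filter α) fun j => relations (r j) (a j)))
    {η : ℝ} (hη : 0 < η) :
    ∀ᶠ j in U, ∃ (k : ℤ) (n : ι → ℤ), ∀ i, |(k * a j i : ℝ) / r j - x i - n i| < η := by
  classical
  obtain ⟨p, hp⟩ := exists_forall_exists_near_multiple ι hη
  filter_upwards [eventually_forall_mem_eventualSubmodule U (fun j => relations (r j) (a j))
    (Fintype.piFinset fun _ => Finset.Icc (-(p : ℤ)) p)] with j hj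
  obtain ⟨k, hk⟩ := hp (r j) (a j) x (hr j) fun m hm hdvd =>
    hx m (hj m (Fintype.mem_piFinset.2 fun i => Finset.mem_Icc.2 (abs_le.1 (hm i))) hdvd)
  choose n hn using hk
  exact ⟨k, n, hn⟩

theorem div_ne_intCast {r : ℕ} (hr : 0 < r) {b : ℤ} (h : ¬ (r : ℤ) ∣ b) (n : ℤ) :
    (b / r : ℝ) ≠ n := by
  intro hn
  rw [div_eq_iff (by exact_mod_cast hr.ne')] at hn
  exact h ⟨n, by rw [mul_comm]; exact_mod_cast hn⟩

theorem hasLargeSums_dualSubgroup_eventualSubmodule {α : Type*} (U : Ultrafilter α) {r : α → ℕ}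
    (hr : ∀ j, 0 < r j) {a : α → ι → ℤ} {c : ℕ} {δ : ℝ}
    (hbig : ∀ j, ∀ k : ℤ, (∀ i, ¬ (r j : ℤ) ∣ k * a j i) →
      c - δ ≤ ∑ i, Int.fract ((k * a j i : ℝ) / r j)) :
    HasLargeSums (dualSubgroup (eventualSubmodule (U : Filter α) fun j => relations (r j) (a j)))
      c δ := by
  intro x hx hxn
  by_contra! hlt
  obtain ⟨η, hη, hball⟩ := Metric.eventually_nhds_iff.1 (eventually_sum_fract_lt hxn hlt)
  obtain ⟨j, k, n, hn⟩ := (eventually_exists_near_multiple U hr a hx hη).exists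
  obtain ⟨hninteger, hsum⟩ := hball (y := fun i => (k * a j i : ℝ) / r j - n i)
    ((dist_pi_lt_iff hη).2 fun i => by rw [Real.dist_eq, sub_right_comm]; exact hn i)
  simp only [Int.fract_sub_intCast] at hsum
  refine hsum.not_ge (hbig j k fun i ⟨q, hq⟩ => hninteger i (q - n i) ?_)
  have hr' : (r j : ℝ) ≠ 0 := by exact_mod_cast (hr j).ne'
  have hq' : (k * a j i : ℝ) = r j * q := by exact_mod_cast hq
  rw [hq', mul_div_cancel_left₀ _ hr', Int.cast_sub]

/-- Along a sequence of counterexamples the relation lattices have a limit, whose dual group has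
large sums because it is approximated by the multiples of `a / r`; it contains these multiples for
some members of the sequence, and a line on which the coordinate sum grows because the sum of `a` is
prime to `r`. -/
theorem exists_bound {c : ℕ} (hcard : Fintype.card ι = 2 * c + 1) {δ : ℝ} (hδ : δ < 1 / 6) :
    ∃ N : ℕ, ∀ (r : ℕ) (a : ι → ℤ), 0 < r → IsCoprime (r : ℤ) (∑ i, a i) →
      (∀ k : ℤ, (∀ i, ¬ (r : ℤ) ∣ k * a i) → c - δ ≤ ∑ i, Int.fract ((k * a i : ℝ) / r)) →
      (∃ k : ℤ, (∀ i, ¬ (r : ℤ) ∣ k * a i) ∧ ∑ i, Int.fract ((k * a i : ℝ) / r) < c) → r ≤ N := by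
  by_contra! hcon
  choose r a hr hcop hbig hsmall hlt using hcon
  set L := eventualSubmodule (hyperfilter ℕ : Filter ℕ) fun j => relations (r j) (a j)
  have hK := hasLargeSums_dualSubgroup_eventualSubmodule (hyperfilter ℕ) hr hbig
  obtain ⟨v, hv, hvpos⟩ : ∃ v : ι → ℤ, (∀ m ∈ L, m ⬝ᵥ v = 0) ∧ 0 < ∑ i, v i := by
    refine exists_dotProduct_eq_zero_of_smul_one_notMem fun N hN hmem => ?_
    obtain ⟨j, hj, hdvd⟩ :=
      (((eventually_ge_atTop N.natAbs).filter_mono Nat.hyperfilter_le_atTop).and hmem).exists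
    have hdvd' : (r j : ℤ) ∣ N * ∑ i, a j i := by
      rw [← one_dotProduct, ← smul_eq_mul, ← smul_dotProduct]; exact hdvd
    have hle := Nat.le_of_dvd (Int.natAbs_pos.2 hN)
      (Int.natCast_dvd.1 ((hcop j).dvd_of_dvd_mul_right hdvd'))
    exact absurd (hlt j) (by omega)
  obtain ⟨j, hj⟩ := (eventually_eventualSubmodule_le (hyperfilter ℕ : Filter ℕ)
    fun j => relations (r j) (a j)).exists
  obtain ⟨k, hk, hk'⟩ := hsmall j
  refine hk'.not_ge ?_
  have h := hK.le_sum_fract hcard (mul_mem_dualSubgroup hv) hδ hvpos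
    (q := fun i => (k * a j i : ℚ) / r j)
  push_cast at h
  exact h (fun m hm => mul_div_mem_dualSubgroup_relations (hr j) (a j) k m (hj hm))
    fun i n => by exact_mod_cast div_ne_intCast (hr j) (hk i) n

end Limit

section LatticePoints

theorem dvd_mul_of_gcd_dvd_gcd {r k a b : ℤ} (h : Int.gcd a r ∣ Int.gcd b r) (ha : r ∣ k * a) :
    r ∣ k * b := by
  have hgcd : r ∣ k * Int.gcd a r := by
    rw [Int.gcd_eq_gcd_ab, mul_add, ← mul_assoc, ← mul_assoc]
    exact dvd_add (ha.mul_right _) ((dvd_mul_left _ _).mul_right _)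
  exact hgcd.trans (mul_dvd_mul_left k
    ((Int.natCast_dvd_natCast.2 h).trans (Int.gcd_dvd_left _ _)))

theorem one_le_of_pos_of_dvd {r : ℕ} (hr : r ≠ 0) {b n : ℤ} {v : ℚ} (hv : v = b / r + n)
    (hpos : 0 < v) (hb : (r : ℤ) ∣ b) : 1 ≤ v := by
  obtain ⟨l, rfl⟩ := hb
  have hr' : (r : ℚ) ≠ 0 := by exact_mod_cast hr
  obtain rfl : v = (l + n : ℤ) := by rw [hv]; push_cast; field_simp
  exact_mod_cast Int.cast_pos.1 hpos

theorem fract_le_of_nonneg {x v : ℚ} {n : ℤ} (hv : v = x + n) (h0 : 0 ≤ v) : Int.fract x ≤ v := by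
  rw [← Int.fract_add_intCast x n, ← hv]
  exact sub_le_self v (Int.cast_nonneg (Int.floor_nonneg.2 h0))

theorem exists_sum_fract_lt_of_cyclicMld_lt {d r c : ℕ} {a : Fin d → ℤ} (hr : r ≠ 0)
    {i₀ i₁ : Fin d} (hi : i₁ ≠ i₀) (h₀ : IsCoprime (r : ℤ) (a i₀)) (h₁ : IsCoprime (r : ℤ) (a i₁))
    (hgcd : ∀ i, c ≤ Finset.card {j | Int.gcd (a i) r ∣ Int.gcd (a j) r})
    (hc : cyclicMld r a < (c : EReal)) :
    ∃ k : ℤ, (∀ i, ¬ (r : ℤ) ∣ k * a i) ∧ ∑ i, Int.fract ((k * a i : ℝ) / r) < c := by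
  obtain ⟨v, k, hpos, hv, hlt⟩ :=
    exists_of_cyclicMld_lt hr hi h₀ h₁ (b := c) (by exact_mod_cast hc)
  choose n hn using hv
  replace hlt : ∑ i, v i < c := by exact_mod_cast hlt
  refine ⟨k, fun i hdvd => hlt.not_ge ?_, ?_⟩
  · calc (c : ℚ) ≤ Finset.card {j | Int.gcd (a i) r ∣ Int.gcd (a j) r} := by
          exact_mod_cast hgcd i
      _ = ∑ j with Int.gcd (a i) r ∣ Int.gcd (a j) r, (1 : ℚ) := by
          rw [Finset.sum_const, nsmul_one]
      _ ≤ ∑ j with Int.gcd (a i) r ∣ Int.gcd (a j) r, v j := Finset.sum_le_sum fun j hj =>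
          one_le_of_pos_of_dvd hr (by rw [hn]; push_cast; rfl) (hpos j)
            (dvd_mul_of_gcd_dvd_gcd (Finset.mem_filter.1 hj).2 hdvd)
      _ ≤ ∑ j, v j := Finset.sum_le_sum_of_subset_of_nonneg (Finset.subset_univ _)
          fun j _ _ => (hpos j).le
  · have hfract : ∑ i, Int.fract ((k * a i : ℚ) / r) < c :=
      (Finset.sum_le_sum fun i _ => fract_le_of_nonneg (hn i) (hpos i).le).trans_lt hlt
    exact_mod_cast hfract

end LatticePoints

end CyclicQuotient

end

theorem mainTheorem4_general (c : ℕ) {ε : ℝ} (hε : 0 < ε) :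
    ∃ Γ₀ : Finset ℕ, (∀ n ∈ Γ₀, 0 < n) ∧
      ∀ (r : ℕ) (a : Fin (2 * c + 1) → ℤ), 0 < r →
        (∃ i₀ i₁, i₁ ≠ i₀ ∧ Int.gcd (a i₀) r = 1 ∧ Int.gcd (a i₁) r = 1) →
        (∀ i, c ≤ Finset.card {j | Int.gcd (a i) r ∣ Int.gcd (a j) r}) →
        Int.gcd (∑ i, a i) r = 1 →
        CyclicQuotient.cyclicMld r a ∈ Set.Ico ((c - 1 / 6 + ε : ℝ) : EReal) (c : EReal) →
        r ∈ Γ₀ := by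
  obtain ⟨N, hN⟩ := CyclicQuotient.exists_bound (ι := Fin (2 * c + 1)) (Fintype.card_fin _)
    (sub_lt_self (1 / 6) hε)
  refine ⟨Finset.Icc 1 N, fun n hn => (Finset.mem_Icc.1 hn).1,
    fun r a hr ⟨i₀, i₁, hi, h₀, h₁⟩ hgcd hsum hmld => Finset.mem_Icc.2 ⟨hr, ?_⟩⟩
  rw [Int.gcd_comm, ← Int.isCoprime_iff_gcd_eq_one] at h₀ h₁ hsum
  refine hN r a hr hsum (fun k hk => ?_)
    (CyclicQuotient.exists_sum_fract_lt_of_cyclicMld_lt hr.ne' hi h₀ h₁ hgcd hmld.2)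
  have hle := EReal.coe_le_coe_iff.1
    (hmld.1.trans (CyclicQuotient.cyclicMld_le hr.ne' hi h₀ h₁ k hk))
  push_cast at hle
  linarith

theorem mainTheorem4 (ε : ℝ) (hε : ε ∈ Set.Ioo (0 : ℝ) (1 / 6)) :
    ∃ Γ₀ : Finset ℕ, (∀ n ∈ Γ₀, 0 < n) ∧
      ∀ (r : ℕ) (a : Fin 5 → ℤ), 0 < r →
        Int.gcd (a 0) r = 1 → Int.gcd (a 1) r = 1 → Int.gcd (a 2) r = 1 →
        Int.gcd (a 3) r = Int.gcd (a 4) r →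
        Int.gcd (∑ i, a i) r = 1 →
        CyclicQuotient.cyclicMld r a ∈ Set.Ico (((11 / 6 + ε : ℝ)) : EReal) (2 : EReal) →
        (a 0 + a 1 + a 4 ≡ 0 [ZMOD r] ∨
          2 * a 3 + a 4 ≡ 0 [ZMOD r] ∨
          (2 * a 0 + a 4 ≡ 0 [ZMOD r] ∧ Int.gcd (a 3) r ≤ 2)) →
        r ∈ Γ₀ := by
  obtain ⟨Γ₀, hpos, hmem⟩ := mainTheorem4_general 2 hε.1
  refine ⟨Γ₀, hpos, fun r a hr h0 h1 h2 h34 hsum hmld _ =>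
    hmem r a hr ⟨0, 1, by decide, h0, h1⟩ (fun i => ?_) hsum ?_⟩
  · have hcard : 2 ≤ Finset.card {j : Fin 5 | j = 3 ∨ j = 4} := by decide
    refine hcard.trans (Finset.card_le_card fun j hj => ?_)
    obtain hj | hj := (Finset.mem_filter.1 hj).2 <;>
      fin_cases i <;> simp [hj, h0, h1, h2, h34]
  · rwa [show ((2 : ℕ) - 1 / 6 + ε : ℝ) = 11 / 6 + ε by norm_num]
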